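/- Let $\widetilde V=\mathbf C^2$ and $G=\{1,-1\}\subset GL_2(\mathbf C)$. A reflection of $K^n$ is an element $g\in GL_n(K)$ of finite order such that $\ker(g-1)$ is a hyperplane; a complex reflection group is a finite subgroup of $GL_n(\mathbf C)$ generated by reflections. For a finite group $H\subset GL_n(\mathbf C)$ let $B=\mathbf C[X_1,\dots,X_n]$, let $B^H_+$ be the space of $H$-invariant polynomials without constant term, and let $V=(B^H_+/(B^H_+)^2)^*$ be the tangent space at $0$ of $\mathbf C^n/H$. The degrees of $H$ are the degrees, with multiplicities, of the graded space $V^*=B^H_+/(B^H_+)^2$ (for the standard grading of $B$). Choose a graded splitting $V^*\to B^H_+$ equivariant under the normalizer of $H$ in $GL_n(\mathbf C)$; it induces a surjective equivariant homomorphism $A=\mathbf C[V]\to B^H$, with kernel $I$. If $H$ is normal in a subgroup $\widetilde W\subset GL_n(\mathbf C)$, then $H$ is called good in $\widetilde W$ if $I$ is a complete intersection (its minimal number of generators is $\dim V-\dim A/I$) and $\widetilde W$ acts trivially on $I/A_+I$. For $G=\{1,-1\}$, with coordinates $(x,y)$ on $\mathbf C^2$, the space $V^*$ has basis $(xy,x^2,y^2)$,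 and the action of $GL_2(\mathbf C)$ on $V=\mathbf C^3$ is the morphism $\varphi:GL_2(\mathbf C)\to GL_3(\mathbf C)$ with $(xy,x^2,y^2)\circ g=\varphi(g)\,(xy,x^2,y^2)$, where triples are written as columns. Its kernel is $\{1,-1\}$. Let $O(R)\subset GL_3(\mathbf C)$ be the orthogonal group of the quadratic form $R=X_1^2-X_2X_3$. 1. Let $\widetilde W\subset GL_2(\mathbf C)$ be a complex reflection group containing $-1$, and let $W=\varphi(\widetilde W)\cong\widetilde W/\{1,-1\}$, acting on $V$. Then $G$ is good in $\widetilde W$ if and only if $\widetilde W$ is generated by reflections of order $2$. In this case the degrees of $W$ in $V$ (for the standard grading of $\mathbf C[V]$) are of the form $2,a,b$, and then the degrees of $\widetilde W$ in $\widetilde V$ are $2a,2b$. 2. The map $\widetilde W\mapsto\varphi(\widetilde W)$ induces a bijection between the set of $GL_2(\mathbf C)$-conjugacy classes of (possibly infinite) subgroups of $GL_2(\mathbf C)$ generated by reflections of order $2$ and containing $-1$, and the set of $O(R)$-conjugacy classes of nontrivial subgroups of $O(R)$ generated by reflections. 3. There is a bijection between the set of $GL_2(\mathbf C)$-conjugacy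 classes of finite subgroups of $GL_2(\mathbf C)$ generated by reflections of order $2$ and containing $-1$, and the set of $GL_3(\mathbf R)$-conjugacy classes of nontrivial finite subgroups of $GL_3(\mathbf R)$ generated by reflections, under which the class of $\widetilde W$ corresponds to the class of $\Gamma$ if and only if $\varphi(\widetilde W)$ and $\Gamma$ are conjugate in $GL_3(\mathbf C)$. 4. There is a bijection between the set of $GL_2(\mathbf C)$-conjugacy classes of finite subgroups of $GL_2(\mathbf C)$ generated by reflections of order $2$ and containing $-1$, and the set of isomorphism classes of finite Coxeter groups of rank $1$, $2$ or $3$ (as groups with Coxeter generators, that is, Coxeter matrices up to reindexing), under which $\widetilde W$ corresponds to the Coxeter matrix $M$ if and only if $\varphi(\widetilde W)\cong\widetilde W/\{1,-1\}$ has a Coxeter presentation of type $M$ whose generators are reflections of $V$. 5. Under the bijection of part 4, the Shephard–Todd groups $G_{12}$, $G_{13}$, $G_{22}$ correspond to the Coxeter groups of type $A_3$, $B_3$, $H_3$ respectively. Here, with Pauli matrices $\sigma_1,\sigma_2,\sigma_3$ and the golden ratio $\tau=\frac{1+\sqrt5}{2}$, the groups are, up to conjugacy, $G_{12}=\langle\frac{\sigma_3-\sigma_1}{\sqrt2},\frac{\sigma_3+\sigma_1}{\sqrt2},\frac{\sigma_1-\sigma_2}{\sqrt2}\rangle$,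 $G_{13}=\langle\sigma_3,\frac{\sigma_3-\sigma_1}{\sqrt2},\frac{\sigma_1-\sigma_2}{\sqrt2}\rangle$ and $G_{22}=\langle\sigma_3,\sigma_2,\frac{\tau^{-1}\sigma_1+\sigma_2+\tau\sigma_3}{2}\rangle$. -/

import Mathlib

namespace ReflQuot

open MvPolynomial

noncomputable section

/-! ### Reflections and reflection groups -/

/-- A reflection of `K ^ n`: an invertible matrix `g` of finite order such that `ker (g - 1)` is a
hyperplane. -/
def IsReflection {K : Type*} [Field K] {n : ℕ} (g : GL (Fin n) K) : Prop :=
  IsOfFinOrder g ∧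
    Module.finrank K
      (LinearMap.ker (Matrix.toLin' ((g : Matrix (Fin n) (Fin n) K) - 1))) + 1 = n

/-- The (possibly infinite) group `W` is generated by the reflections it contains. -/
def GeneratedByReflections {K : Type*} [Field K] {n : ℕ} (W : Subgroup (GL (Fin n) K)) : Prop :=
  Subgroup.closure {g | g ∈ W ∧ IsReflection g} = W

/-- The (possibly infinite) group `W` is generated by the reflections of order `2` it contains. -/
def GeneratedByOrderTwoReflections {K : Type*} [Field K] {n : ℕ}
    (W : Subgroup (GL (Fin n) K)) : Prop :=
  Subgroup.closure {g | g ∈ W ∧ IsReflection g ∧ orderOf g = 2} = W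

/-- A reflection group is a finite group generated by reflections. -/
def IsReflectionGroup {K : Type*} [Field K] {n : ℕ} (W : Subgroup (GL (Fin n) K)) : Prop :=
  Finite W ∧ GeneratedByReflections W

/-! ### Invariants and degrees -/

/-- `f ↦ f ∘ g` on polynomial functions on `ℂ ^ n`, for a matrix `g`. -/
def pullback {n : ℕ} (g : Matrix (Fin n) (Fin n) ℂ) :
    MvPolynomial (Fin n) ℂ →ₐ[ℂ] MvPolynomial (Fin n) ℂ :=
  aeval fun i => ∑ j, C (g i j) * X j

/-- The space `B^G_+` of `G`-invariant polynomials without constant term. -/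
def posInvariants {n : ℕ} (G : Subgroup (GL (Fin n) ℂ)) :
    Submodule ℂ (MvPolynomial (Fin n) ℂ) where
  carrier := {f | (∀ g ∈ G, pullback g f = f) ∧ constantCoeff f = 0}
  add_mem' := by
    rintro a b ⟨ha, ha'⟩ ⟨hb, hb'⟩
    exact ⟨fun g hg => by rw [map_add, ha g hg, hb g hg], by rw [map_add, ha', hb', add_zero]⟩
  zero_mem' := ⟨fun g _ => map_zero _, map_zero _⟩
  smul_mem' := by
    rintro c a ⟨ha, ha'⟩
    exact ⟨fun g hg => by rw [map_smul, ha g hg], by simp [smul_eq_C_mul, ha']⟩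

/-- The projection of polynomials modulo `(B^G_+)^2`. It maps `B^G_+` onto the cotangent space
`B^G_+ / (B^G_+)^2` at the origin of the quotient of `ℂ ^ n` by `G`. -/
def modSq {n : ℕ} (G : Subgroup (GL (Fin n) ℂ)) :
    MvPolynomial (Fin n) ℂ →ₗ[ℂ]
      MvPolynomial (Fin n) ℂ ⧸ (posInvariants G * posInvariants G) :=
  (posInvariants G * posInvariants G).mkQ

/-- The multiplicity of `d` as a degree of `G`: the dimension of the component of degree `d` of
`B^G_+ / (B^G_+)^2`, for the standard grading. -/
def degreeMultiplicity {n : ℕ} (G : Subgroup (GL (Fin n) ℂ)) (d : ℕ) : ℕ :=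
  Module.finrank ℂ ((posInvariants G ⊓ homogeneousSubmodule (Fin n) ℂ d).map (modSq G))

/-- The degrees of `G`, counted with multiplicity, are the elements of the multiset `D`. -/
def HasDegrees {n : ℕ} (G : Subgroup (GL (Fin n) ℂ)) (D : Multiset ℕ) : Prop :=
  ∀ d, degreeMultiplicity G d = D.count d

/-! ### Good normal subgroups -/

/-- Homogeneous invariants `p 1, …, p r` of `G` whose classes form a basis of the cotangent space
`B^G_+ / (B^G_+)^2` and whose span is stable under the normalizer of `G`. Such a family is the same
as a graded equivariant splitting of `B^G_+ → B^G_+ / (B^G_+)^2` together with a homogeneous basis,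
so it embeds the quotient of `ℂ ^ n` by `G` equivariantly into its tangent space at `0`, which has
coordinates `p 1, …, p r`. -/
structure IsFundamentalSystem {n r : ℕ} (G : Subgroup (GL (Fin n) ℂ))
    (p : Fin r → MvPolynomial (Fin n) ℂ) : Prop where
  mem : ∀ i, p i ∈ posInvariants G
  homogeneous : ∀ i, ∃ d, (p i).IsHomogeneous d
  linearIndependent : LinearIndependent ℂ fun i => modSq G (p i)
  span : Submodule.span ℂ (Set.range fun i => modSq G (p i)) = (posInvariants G).map (modSq G)
  stable : ∀ g ∈ Subgroup.normalizer (G : Set (GL (Fin n) ℂ)), ∀ i,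
    pullback (g : Matrix (Fin n) (Fin n) ℂ) (p i) ∈ Submodule.span ℂ (Set.range p)

/-- `c` is the matrix of the linear map induced by `g` on the tangent space with coordinates
`p 1, …, p r`: it satisfies `(p 1, …, p r) (g v) = c (p 1 (v), …, p r (v))`. -/
def IsTangentMatrix {n r : ℕ} (p : Fin r → MvPolynomial (Fin n) ℂ) (g : GL (Fin n) ℂ)
    (c : Matrix (Fin r) (Fin r) ℂ) : Prop :=
  ∀ i, pullback (g : Matrix (Fin n) (Fin n) ℂ) (p i) = ∑ j, c i j • p j

/-- The ideal `I` of relations between `p 1, …, p r`, in `A = ℂ[X 1, …, X r]`. -/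
def relationIdeal {n r : ℕ} (p : Fin r → MvPolynomial (Fin n) ℂ) :
    Ideal (MvPolynomial (Fin r) ℂ) :=
  RingHom.ker (aeval p : MvPolynomial (Fin r) ℂ →ₐ[ℂ] MvPolynomial (Fin n) ℂ)

/-- An ideal `I` of `A = ℂ[X 1, …, X r]` is a complete intersection if its minimal number of
generators equals `r - dim (A / I)`. -/
def IsCompleteIntersection {r : ℕ} (I : Ideal (MvPolynomial (Fin r) ℂ)) : Prop :=
  (Submodule.spanFinrank I : WithBot ℕ∞) + ringKrullDim (MvPolynomial (Fin r) ℂ ⧸ I) = r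

/-- `G` is a good normal subgroup of `W`: `G` is normal in `W`, it is a complete intersection, and
`W` acts trivially on `I / A_+ I`. -/
def IsGood {n : ℕ} (G W : Subgroup (GL (Fin n) ℂ)) : Prop :=
  G ≤ W ∧ W ≤ Subgroup.normalizer (G : Set (GL (Fin n) ℂ)) ∧
  ∃ (r : ℕ) (p : Fin r → MvPolynomial (Fin n) ℂ), IsFundamentalSystem G p ∧
    IsCompleteIntersection (relationIdeal p) ∧
    ∀ w ∈ W, ∀ c, IsTangentMatrix p w c → ∀ f ∈ relationIdeal p,
      pullback c f - f ∈
        RingHom.ker (constantCoeff : MvPolynomial (Fin r) ℂ →+* ℂ) * relationIdeal p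

/-! ### The group `{1, -1}` and the morphism `φ : GL₂(ℂ) → GL₃(ℂ)` -/

/-- The subgroup `{1, -1}` of `GL₂(ℂ)`. -/
def muTwo : Subgroup (GL (Fin 2) ℂ) := Subgroup.zpowers (-1)

/-- The invariants `XY, X², Y²` of `{1, -1}`. -/
def quadInvariants : Fin 3 → MvPolynomial (Fin 2) ℂ := ![X 0 * X 1, X 0 ^ 2, X 1 ^ 2]

/-- The matrix `c` with `(xy, x², y²) ∘ g = c (xy, x², y²)`, as a multiplicative map. -/
def symSq : Matrix (Fin 2) (Fin 2) ℂ →* Matrix (Fin 3) (Fin 3) ℂ where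
  toFun g :=
    !![g 0 0 * g 1 1 + g 0 1 * g 1 0, g 0 0 * g 1 0, g 0 1 * g 1 1;
       2 * g 0 0 * g 0 1, g 0 0 ^ 2, g 0 1 ^ 2;
       2 * g 1 0 * g 1 1, g 1 0 ^ 2, g 1 1 ^ 2]
  map_one' := by
    ext i j
    fin_cases i <;> fin_cases j <;> simp
  map_mul' g h := by
    ext i j
    fin_cases i <;> fin_cases j <;>
      simp [Matrix.mul_apply, Fin.sum_univ_succ] <;> ring

/-- The action `φ` of `GL₂(ℂ)` on the tangent space at `0` of the quotient of `ℂ²` by `{1, -1}`, in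
the coordinates `XY, X², Y²`. -/
def phi : GL (Fin 2) ℂ →* GL (Fin 3) ℂ := Units.map symSq

/-- The quadratic form `R = X₁² - X₂ X₃` on `ℂ³`. -/
def quadForm : MvPolynomial (Fin 3) ℂ := X 0 ^ 2 - X 1 * X 2

theorem pullback_mul {n : ℕ} (g h : Matrix (Fin n) (Fin n) ℂ) (f : MvPolynomial (Fin n) ℂ) :
    pullback (g * h) f = pullback h (pullback g f) := by
  have : pullback (g * h) = (pullback h).comp (pullback g) := by
    apply algHom_ext
    intro i
    simp only [pullback, AlgHom.comp_apply, aeval_X, map_sum, map_mul, algHom_C, Matrix.mul_apply,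
      algebraMap_eq, Finset.sum_mul, Finset.mul_sum]
    rw [Finset.sum_comm]
    simp only [mul_assoc]
  rw [this, AlgHom.comp_apply]

theorem pullback_one {n : ℕ} (f : MvPolynomial (Fin n) ℂ) :
    pullback (1 : Matrix (Fin n) (Fin n) ℂ) f = f := by
  have : pullback (1 : Matrix (Fin n) (Fin n) ℂ) = AlgHom.id ℂ _ := by
    apply algHom_ext
    intro i
    simp [pullback, Matrix.one_apply]
  rw [this, AlgHom.id_apply]

/-- The orthogonal group `O(R)` of the quadratic form `R`. -/
def orthogonalR : Subgroup (GL (Fin 3) ℂ) where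
  carrier := {g | pullback g quadForm = quadForm}
  one_mem' := pullback_one _
  mul_mem' := by
    intro a b ha hb
    change pullback _ quadForm = quadForm at ha hb ⊢
    rw [Units.val_mul, pullback_mul, ha, hb]
  inv_mem' := by
    intro a ha
    change pullback _ quadForm = quadForm at ha ⊢
    conv_lhs => rw [← ha]
    rw [← pullback_mul, Units.mul_inv, pullback_one]

/-! ### Conjugacy classes of subgroups -/

/-- `K = c H c⁻¹` for some element `c` of the subgroup `Γ`. -/
def ConjBy {M : Type*} [Group M] (Γ H K : Subgroup M) : Prop :=
  ∃ c ∈ Γ, H.map (MulAut.conj c).toMonoidHom = K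

/-- `Γ`-conjugacy on the set of subgroups satisfying `P`. -/
def conjSetoid {M : Type*} [Group M] (Γ : Subgroup M) (P : Subgroup M → Prop) :
    Setoid {H : Subgroup M // P H} where
  r H K := ConjBy Γ H.1 K.1
  iseqv :=
    { refl := fun H => ⟨1, Γ.one_mem, by ext x; simp⟩
      symm := by
        rintro ⟨H, _⟩ ⟨K, _⟩ ⟨c, hc, h⟩
        refine ⟨c⁻¹, Γ.inv_mem hc, ?_⟩
        simp only at h ⊢
        rw [← h, Subgroup.map_map]
        ext x
        simp [mul_assoc]
      trans := by
        rintro ⟨H, _⟩ ⟨K, _⟩ ⟨L, _⟩ ⟨c, hc, h⟩ ⟨d, hd, h'⟩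
        refine ⟨d * c, Γ.mul_mem hd hc, ?_⟩
        simp only at h h' ⊢
        rw [← h', ← h, Subgroup.map_map]
        ext x
        simp [mul_assoc] }

/-- The set of `Γ`-conjugacy classes of subgroups satisfying `P`. -/
abbrev SubgroupClasses {M : Type*} [Group M] (Γ : Subgroup M) (P : Subgroup M → Prop) : Type _ :=
  Quotient (conjSetoid Γ P)

/-- The class of a subgroup satisfying `P`. -/
def classOf {M : Type*} [Group M] (Γ : Subgroup M) (P : Subgroup M → Prop) (H : Subgroup M)
    (h : P H) : SubgroupClasses Γ P :=
  Quotient.mk (conjSetoid Γ P) ⟨H, h⟩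

/-- Subgroups of `GL₂(ℂ)` generated by reflections of order `2` and containing `-1`. -/
def UpstairsGroup (W : Subgroup (GL (Fin 2) ℂ)) : Prop :=
  GeneratedByOrderTwoReflections W ∧ -1 ∈ W

/-- Finite subgroups of `GL₂(ℂ)` generated by reflections of order `2` and containing `-1`. -/
def FiniteUpstairsGroup (W : Subgroup (GL (Fin 2) ℂ)) : Prop :=
  Finite W ∧ GeneratedByOrderTwoReflections W ∧ -1 ∈ W

/-- Nontrivial subgroups of `O(R)` generated by reflections. -/
def OrthogonalReflectionSubgroup (W : Subgroup (GL (Fin 3) ℂ)) : Prop :=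
  W ≤ orthogonalR ∧ W ≠ ⊥ ∧ GeneratedByReflections W

/-- Nontrivial finite subgroups of `GL₃(ℝ)` generated by reflections. -/
def RealReflectionGroup (W : Subgroup (GL (Fin 3) ℝ)) : Prop :=
  Finite W ∧ W ≠ ⊥ ∧ GeneratedByReflections W

/-- The inclusion of `GL₃(ℝ)` in `GL₃(ℂ)`. -/
def complexification : GL (Fin 3) ℝ →* GL (Fin 3) ℂ :=
  Matrix.GeneralLinearGroup.map (algebraMap ℝ ℂ)

/-! ### Finite Coxeter groups of rank at most three -/

/-- A finite Coxeter group (with its Coxeter generators) of rank between `1` and `3`, given by its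
Coxeter matrix. -/
structure SmallCoxeter where
  rank : ℕ
  one_le_rank : 1 ≤ rank
  rank_le_three : rank ≤ 3
  matrix : CoxeterMatrix (Fin rank)
  finite : Finite matrix.Group

/-- Isomorphism of Coxeter groups (with their Coxeter generators). -/
def coxeterSetoid : Setoid SmallCoxeter where
  r M N := ∃ e : Fin M.rank ≃ Fin N.rank, M.matrix.reindex e = N.matrix
  iseqv :=
    { refl := fun M => ⟨Equiv.refl _, rfl⟩
      symm := by
        rintro M N ⟨e, h⟩
        refine ⟨e.symm, ?_⟩
        rw [← h]
        ext i j
        simp [CoxeterMatrix.reindex_apply]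
      trans := by
        rintro M N L ⟨e, h⟩ ⟨f, h'⟩
        refine ⟨e.trans f, ?_⟩
        rw [← h', ← h]
        ext i j
        simp [CoxeterMatrix.reindex_apply] }

/-- The linear group `W` is a Coxeter group of type `M` with respect to some set of reflections:
it has a Coxeter presentation of type `M` whose generators are reflections. -/
def HasCoxeterType {K : Type*} [Field K] {n r : ℕ} (W : Subgroup (GL (Fin n) K))
    (M : CoxeterMatrix (Fin r)) : Prop :=
  ∃ cs : CoxeterSystem M W, ∀ i, IsReflection (cs.simple i : GL (Fin n) K)

/-! ### The Shephard-Todd groups `G₁₂`, `G₁₃`, `G₂₂` -/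

/-- The Pauli combination `x σ₁ + y σ₂ + z σ₃`. For a real unit vector `(x, y, z)` it is a unitary
reflection of order `2`. -/
def pauli (x y z : ℝ) : Matrix (Fin 2) (Fin 2) ℂ :=
  !![(z : ℂ), x - y * Complex.I; x + y * Complex.I, -z]

/-- The subgroup of `GL₂(ℂ)` generated by a set of matrices, all of which are invertible in the
uses below. -/
def generatedBy (S : Set (Matrix (Fin 2) (Fin 2) ℂ)) : Subgroup (GL (Fin 2) ℂ) :=
  Subgroup.closure {g | (g : Matrix (Fin 2) (Fin 2) ℂ) ∈ S}

/-- The Shephard-Todd group `G₁₂` (order `48`, degrees `6, 8`). -/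
def G12 : Subgroup (GL (Fin 2) ℂ) :=
  generatedBy {pauli (-(√2)⁻¹) 0 (√2)⁻¹, pauli (√2)⁻¹ 0 (√2)⁻¹, pauli (√2)⁻¹ (-(√2)⁻¹) 0}

/-- The Shephard-Todd group `G₁₃` (order `96`, degrees `8, 12`). -/
def G13 : Subgroup (GL (Fin 2) ℂ) :=
  generatedBy {pauli 0 0 1, pauli (-(√2)⁻¹) 0 (√2)⁻¹, pauli (√2)⁻¹ (-(√2)⁻¹) 0}

/-- The Shephard-Todd group `G₂₂` (order `240`, degrees `12, 20`). -/
def G22 : Subgroup (GL (Fin 2) ℂ) :=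
  generatedBy
    {pauli 0 0 1, pauli 0 1 0,
      pauli (Real.goldenRatio⁻¹ / 2) (1 / 2) (Real.goldenRatio / 2)}

end

end ReflQuot

open ReflQuot

/-! The engine is that `phi` turns reflections of order two of ℂ² into orthogonal reflections for R.
The former are the matrices of trace 0 and determinant -1, which form the quadric R(e) = 1 in ℂ³;
`phi` sends the matrix with coordinates e to the orthogonal reflection negating e
(`symSq_involution`), and every reflection of O(R) arises in this way
(`IsReflection.exists_involution`). Moreover O(R) is the image of the matrices of determinant ±1
(`exists_phi_eq`), and rescaling a matrix does not change conjugation by it. A group containing -1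
is the full preimage of its image, hence the bijection with reflection subgroups of O(R).

A finite W can be made unitary. Its reflections of order two are then Pauli matrices of real unit
vectors, so the image of W is, up to the fixed change of coordinates `toR`, the complexification of
a finite real orthogonal reflection group. Such a group has simple roots (`exists_simple_roots`), is
a Coxeter group (`IsSimpleRoots.exists_coxeterSystem`, by the positivity argument of Tits in
`apply_root_mem_rootCone`), and is determined up to orthogonal conjugacy by the Gram matrix of its
simple roots (`exists_orthogonal_of_gram_eq`). Conversely the Gram matrix of a finite Coxeter group
is positive definite (`posDef_cosMatrix`), so every type of rank at most three occurs. The type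
depends only on the linear group: its sign character is the determinant, and an abstract group with
its sign character determines the Coxeter matrix in rank at most three (`coxeterMatrix_unique`). The
three exceptional groups are treated with explicit simple roots.

For goodness, the ideal of relations is generated by R, and `phi g` multiplies R by det(g)². Hence
goodness means that all determinants are ±1, which forces every reflection to have order two. For
the degrees, the cotangent space of W has dimension exactly two: at most two by an elimination of
Chevalley type applied to Jacobians (`not_linearIndependent_three`), at least two by Nakayama
(`not_posInvariants_le`). Since -1 lies in W, the two basic invariants have even degrees; they lift
to invariants of the image of half the degree, and together with R the lifts form a basis of the
cotangent space of the image (`UpstairsGroup.exists_hasDegrees`). -/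

namespace ReflQuot

open MvPolynomial

noncomputable section

/-! ### The sign of roots in a Coxeter group -/

section Tits

open Real

variable {V : Type*} [AddCommGroup V] [Module ℝ V]

/-- The Chebyshev recursion for sines, which drives every induction on words in two reflections
below. -/
theorem sin_add_two_mul (θ t : ℝ) :
    2 * cos θ * sin ((t + 1) * θ) - sin (t * θ) = sin ((t + 2) * θ) := by
  have h1 : t * θ = (t + 1) * θ - θ := by ring
  have h2 : (t + 2) * θ = (t + 1) * θ + θ := by ring
  rw [h1, h2, sin_sub, sin_add]
  ring

variable {B W : Type*} [Group W] {M : CoxeterMatrix B} (cs : CoxeterSystem M W)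
  (ρ : W →* Module.End ℝ V) (α : B → V) (f : B → Module.Dual ℝ V)

/-- The action on a simple root of an alternating word in two simple reflections. -/
theorem sin_smul_alternatingWord (hρ : ∀ i v, ρ (cs.simple i) v = v - f i v • α i) {i j : B} {θ : ℝ}
    (hii : f i (α i) = 2) (hjj : f j (α j) = 2) (hij : f i (α j) = -2 * cos θ)
    (hji : f j (α i) = -2 * cos θ) (k : ℕ) :
    sin θ • ρ (cs.wordProd (CoxeterSystem.alternatingWord i j k)) (α i) =
      if Even k then sin ((k + 1) * θ) • α i + sin (k * θ) • α j
      else sin (k * θ) • α i + sin ((k + 1) * θ) • α j := by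
  induction k with
  | zero => simp [CoxeterSystem.alternatingWord]
  | succ k ih =>
    rw [CoxeterSystem.alternatingWord_succ', cs.wordProd_cons, map_mul, Module.End.mul_apply,
      ← map_smul, ih]
    have h := sin_add_two_mul θ k
    have e : ((k + 1 : ℕ) + 1 : ℝ) = k + 2 := by push_cast; ring
    by_cases hk : Even k
    · have hk' : ¬ Even (k + 1) := by simpa [Nat.even_add_one] using hk
      simp only [hk, hk', if_true, if_false, hρ, map_add, map_smul, hjj, hji, e]
      rw [← h]
      push_cast
      module
    · have hk' : Even (k + 1) := by simpa [Nat.even_add_one] using hk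
      simp only [hk, hk', if_true, if_false, hρ, map_add, map_smul, hii, hij, e]
      rw [← h]
      push_cast
      module

/-- The cone spanned by the simple roots. -/
abbrev rootCone : Submodule NNReal V := Submodule.span NNReal (Set.range α)

/-- If `w` does not have the right descent `i`, then it maps the simple root `α i` to a
nonnegative combination of simple roots. -/
theorem apply_root_mem_rootCone (hρ : ∀ i v, ρ (cs.simple i) v = v - f i v • α i)
    (hM : ∀ i j, M i j ≠ 0) (hf : ∀ i j, f i (α j) = -2 * cos (π / M i j))
    (n : ℕ) : ∀ w, cs.length w = n → ∀ i, ¬ cs.IsRightDescent w i → ρ w (α i) ∈ rootCone α := by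
  induction n using Nat.strong_induction_on with
  | _ n ih =>
  intro w hn i hi
  by_cases hw : w = 1
  · subst hw
    simpa using Submodule.subset_span (Set.mem_range_self i)
  obtain ⟨j, hj⟩ := cs.exists_rightDescent_of_ne_one hw
  have hij : i ≠ j := by rintro rfl; exact hi hj
  have hfii : ∀ i, f i (α i) = 2 := by
    intro i
    rw [hf, M.diagonal]
    simp
  -- Split off a suffix of `w` that alternates in the letters `i`, `j`, with lengths adding up. The
  -- longest such suffix leaves a factor `v` to which the induction hypothesis applies for both
  -- roots.
  let P : ℕ → Prop := fun k => ∃ v, w = v * cs.wordProd (CoxeterSystem.alternatingWord i j k) ∧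
    cs.length w = cs.length v + k
  have hP1 : P 1 := by
    refine ⟨w * cs.simple j, ?_, ?_⟩
    · simp [CoxeterSystem.alternatingWord]
    · exact ((cs.isRightDescent_iff).1 hj).symm
  have hPle : ∀ k, P k → k ≤ cs.length w := by
    rintro k ⟨v, -, h⟩
    omega
  classical
  set k := Nat.findGreatest P (cs.length w) with hk
  have hPk : P k := Nat.findGreatest_spec (hPle 1 hP1) hP1
  have hk1 : 1 ≤ k := Nat.le_findGreatest (hPle 1 hP1) hP1
  have hmax : ¬ P (k + 1) := fun h => by
    have := Nat.le_findGreatest (hPle _ h) h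
    omega
  obtain ⟨v, hv, hlen⟩ := hPk
  -- A descent of `v` at the letter that continues the alternation would lengthen the suffix,
  -- against maximality.
  have hA : ¬ cs.IsRightDescent v (if Even k then j else i) := by
    intro h
    apply hmax
    refine ⟨v * cs.simple (if Even k then j else i), ?_, ?_⟩
    · rw [CoxeterSystem.alternatingWord_succ', cs.wordProd_cons, mul_assoc,
        cs.simple_mul_simple_cancel_left]
      exact hv
    · have := (cs.isRightDescent_iff).1 h
      omega
  -- A descent of `v` at the first letter of the suffix would cancel it, making `w` shorter than its
  -- length.
  have hB : ¬ cs.IsRightDescent v (if Even k then i else j) := by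
    intro h
    obtain ⟨l, hl⟩ : ∃ l, k = l + 1 := ⟨k - 1, by omega⟩
    have hl' : (if Even k then i else j) = if Even l then j else i := by
      rw [hl]
      by_cases hE : Even l <;> simp [Nat.even_add_one, hE]
    rw [hl'] at h
    have h1 : w = v * cs.simple (if Even l then j else i) *
        cs.wordProd (CoxeterSystem.alternatingWord i j l) := by
      rw [hv, hl, CoxeterSystem.alternatingWord_succ', cs.wordProd_cons, mul_assoc]
    have h2 := cs.length_mul_le (v * cs.simple (if Even l then j else i))
      (cs.wordProd (CoxeterSystem.alternatingWord i j l))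
    rw [← h1] at h2
    have h3 := cs.length_wordProd_le (CoxeterSystem.alternatingWord i j l)
    rw [CoxeterSystem.length_alternatingWord] at h3
    have h4 := (cs.isRightDescent_iff).1 h
    omega
  have hvi : ¬ cs.IsRightDescent v i := by
    by_cases hE : Even k
    · simpa [hE] using hB
    · simpa [hE] using hA
  have hvj : ¬ cs.IsRightDescent v j := by
    by_cases hE : Even k
    · simpa [hE] using hA
    · simpa [hE] using hB
  -- Otherwise appending `i` gives an alternating word longer than `M i j`, which is not reduced,
  -- and `i` would be a descent of `w`. This bound keeps the sines in the formula for the suffix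
  -- nonnegative.
  have hkm : k < M i j := by
    by_contra hcon
    have h1 : cs.length (w * cs.simple i) = cs.length w + 1 := (cs.not_isRightDescent_iff).1 hi
    have h2 : w * cs.simple i = v * cs.wordProd (CoxeterSystem.alternatingWord j i (k + 1)) := by
      rw [CoxeterSystem.alternatingWord_succ, cs.wordProd_concat, hv, mul_assoc]
    have h3 := cs.not_isReduced_alternatingWord j i (m := k + 1) (hM j i)
      (by rw [M.symmetric j i]; omega)
    have h4 := cs.length_wordProd_le (CoxeterSystem.alternatingWord j i (k + 1))
    rw [CoxeterSystem.length_alternatingWord] at h4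
    have h5 : cs.length (cs.wordProd (CoxeterSystem.alternatingWord j i (k + 1))) ≠ k + 1 := by
      intro h
      apply h3
      rw [CoxeterSystem.IsReduced, h, CoxeterSystem.length_alternatingWord]
    have h6 := cs.length_mul_le v (cs.wordProd (CoxeterSystem.alternatingWord j i (k + 1)))
    rw [← h2] at h6
    omega
  have hIi := ih (cs.length v) (by omega) v rfl i hvi
  have hIj := ih (cs.length v) (by omega) v rfl j hvj
  set θ := π / M i j with hθ
  have hm : (0 : ℝ) < M i j := by exact_mod_cast Nat.pos_of_ne_zero (hM i j)
  have hm2 : 2 ≤ M i j := by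
    have := M.off_diagonal i j hij
    have := hM i j
    omega
  have hθ0 : 0 < θ := div_pos pi_pos hm
  have hmθ : M i j * θ = π := by rw [hθ]; field_simp
  have hsin : ∀ l : ℕ, l ≤ M i j → 0 ≤ sin (l * θ) := by
    intro l hl
    apply sin_nonneg_of_nonneg_of_le_pi (by positivity)
    rw [← hmθ]
    gcongr
  have hs : 0 < sin θ := by
    apply sin_pos_of_pos_of_lt_pi hθ0
    rw [← hmθ]
    have : (2 : ℝ) ≤ M i j := by exact_mod_cast hm2
    nlinarith
  have key := sin_smul_alternatingWord cs ρ α f hρ (hfii i) (hfii j) (hf i j)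
    (by rw [hf, M.symmetric]) k
  have hfin : ∀ x y : ℝ, 0 ≤ x → 0 ≤ y → ∀ u, sin θ • u = x • α i + y • α j →
      ρ v u ∈ rootCone α := by
    intro x y hx hy u hu
    have hu' : u = (x / sin θ) • α i + (y / sin θ) • α j := by
      rw [div_eq_inv_mul, div_eq_inv_mul, mul_smul, mul_smul, ← smul_add, ← hu, smul_smul,
        inv_mul_cancel₀ hs.ne', one_smul]
    rw [hu', map_add, map_smul, map_smul]
    exact add_mem ((rootCone α).smul_mem ⟨x / sin θ, by positivity⟩ hIi)
      ((rootCone α).smul_mem ⟨y / sin θ, by positivity⟩ hIj)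
  rw [hv, map_mul, Module.End.mul_apply]
  have hk' := hsin k hkm.le
  have hk'' := hsin (k + 1) hkm
  push_cast at hk''
  split_ifs at key
  · exact hfin _ _ hk'' hk' _ key
  · exact hfin _ _ hk' hk'' _ key

/-- The geometric representation of a Coxeter group is faithful. -/
theorem injective_of_rootCone (hρ : ∀ i v, ρ (cs.simple i) v = v - f i v • α i)
    (hM : ∀ i j, M i j ≠ 0) (hf : ∀ i j, f i (α j) = -2 * cos (π / M i j))
    (lam : Module.Dual ℝ V) (hlam : ∀ i, 0 < lam (α i)) : Function.Injective ρ := by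
  rw [injective_iff_map_eq_one]
  intro w hw
  by_contra hne
  obtain ⟨i, hi⟩ := cs.exists_rightDescent_of_ne_one hne
  -- Since `w` acts trivially and `i` is a descent of `w`, the element `w * cs.simple i` has no
  -- descent at `i` but sends the simple root to its negative, which cannot lie in the cone.
  have h1 := apply_root_mem_rootCone cs ρ α f hρ hM hf _ (w * cs.simple i) rfl i
    ((cs.isRightDescent_iff_not_isRightDescent_mul).1 hi)
  rw [map_mul, hw, one_mul, hρ, hf, M.diagonal] at h1
  have h2 : ∀ v ∈ rootCone α, 0 ≤ lam v := by
    intro v hv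
    induction hv using Submodule.span_induction with
    | mem x hx => obtain ⟨j, rfl⟩ := hx; exact (hlam j).le
    | zero => simp
    | add x y _ _ hx hy => rw [map_add]; exact add_nonneg hx hy
    | smul c x _ hx =>
      rw [NNReal.smul_def, map_smul]
      exact mul_nonneg c.2 hx
  have h3 := h2 _ h1
  have h4 := hlam i
  simp at h3
  linarith

end Tits

/-! ### Products of two reflections, and the geometric representation -/

section Geometric

open Real Module

variable {V : Type*} [AddCommGroup V] [Module ℝ V] {a b : V} {f g : Dual ℝ V} {θ : ℝ}

theorem sin_smul_pow_left (hfa : f a = 2) (hgb : g b = 2) (hfb : f b = -2 * cos θ)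
    (hga : g a = -2 * cos θ) (k : ℕ) :
    sin θ • ((preReflection a f * preReflection b g) ^ k) a =
      sin ((2 * k + 1) * θ) • a + sin (2 * k * θ) • b := by
  induction k with
  | zero => simp
  | succ k ih =>
    rw [pow_succ', Module.End.mul_apply, ← map_smul, ih]
    have h1 := sin_add_two_mul θ (2 * k)
    have h2 := sin_add_two_mul θ (2 * k + 1)
    have e1 : (2 * (k + 1 : ℕ) : ℝ) = 2 * k + 2 := by push_cast; ring
    have e2 : (2 * k + 2 + 1 : ℝ) = 2 * k + 1 + 2 := by ring
    have e3 : (2 * k + 1 + 1 : ℝ) = 2 * k + 2 := by ring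
    rw [e1, e2, ← h2, e3, ← h1]
    simp only [Module.End.mul_apply, preReflection_apply, map_add, map_sub, map_smul, hfa, hgb, hfb,
      hga]
    module

theorem sin_smul_pow_right (hfa : f a = 2) (hgb : g b = 2) (hfb : f b = -2 * cos θ)
    (hga : g a = -2 * cos θ) (k : ℕ) :
    sin θ • ((preReflection a f * preReflection b g) ^ k) b =
      -(sin (2 * k * θ) • a + sin ((2 * k - 1) * θ) • b) := by
  induction k with
  | zero => simp
  | succ k ih =>
    rw [pow_succ', Module.End.mul_apply, ← map_smul, ih]
    have h1 := sin_add_two_mul θ (2 * k - 1)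
    have h2 := sin_add_two_mul θ (2 * k)
    have e1 : (2 * (k + 1 : ℕ) : ℝ) = 2 * k + 2 := by push_cast; ring
    have e2 : (2 * k - 1 + 1 : ℝ) = 2 * k := by ring
    have e3 : (2 * k - 1 + 2 : ℝ) = 2 * k + 1 := by ring
    have e4 : (2 * k + 2 - 1 : ℝ) = 2 * k + 1 := by ring
    rw [e1, e4, ← h2]
    rw [e2, e3] at h1
    rw [← h1]
    simp only [Module.End.mul_apply, preReflection_apply, map_neg, map_add, map_sub, map_smul, hfa,
      hgb, hfb, hga]
    module

/-- The product of two reflections with angle `π / m` has order dividing `m`. -/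
theorem preReflection_mul_pow_eq_one {m : ℕ} (hm : 2 ≤ m) (hfa : f a = 2) (hgb : g b = 2)
    (hfb : f b = -2 * cos (π / m)) (hga : g a = -2 * cos (π / m)) :
    (preReflection a f * preReflection b g) ^ m = 1 := by
  have hm0 : (0 : ℝ) < m := by exact_mod_cast (by omega : 0 < m)
  have hs : 0 < sin (π / m) := by
    apply sin_pos_of_pos_of_lt_pi (by positivity)
    rw [div_lt_iff₀ hm0]
    have : (2 : ℝ) ≤ m := by exact_mod_cast hm
    nlinarith [pi_pos]
  have hl := sin_smul_pow_left hfa hgb hfb hga m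
  have hr := sin_smul_pow_right hfa hgb hfb hga m
  have e1 : 2 * (m : ℝ) * (π / m) = 2 * π := by field_simp
  have e2 : (2 * (m : ℝ) + 1) * (π / m) = π / m + 2 * π := by field_simp; ring
  have e3 : (2 * (m : ℝ) - 1) * (π / m) = -(π / m) + 2 * π := by field_simp; ring
  rw [e1, e2, sin_two_pi, sin_add_two_pi, zero_smul, add_zero] at hl
  rw [e1, e3, sin_two_pi, sin_add_two_pi, zero_smul, zero_add, sin_neg, neg_smul, neg_neg] at hr
  have hl' := smul_right_injective V hs.ne' hl
  have hr' := smul_right_injective V hs.ne' hr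
  ext v
  set c := cos (π / m)
  set s := sin (π / m)
  have hsc : s ^ 2 + c ^ 2 = 1 := sin_sq_add_cos_sq _
  -- The plane of `a` and `b` has a complement on which both forms vanish: the Gram system for the
  -- components of `v` is solvable because its determinant is a multiple of `s ^ 2`.
  obtain ⟨x, y, h1, h2⟩ : ∃ x y : ℝ, f v = 2 * x - 2 * c * y ∧ g v = 2 * y - 2 * c * x := by
    refine ⟨(f v + c * g v) / (2 * s ^ 2), (c * f v + g v) / (2 * s ^ 2), ?_, ?_⟩
    · field_simp
      linear_combination (f v) * hsc
    · field_simp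
      linear_combination (g v) * hsc
  have hv0 : ∀ k : ℕ, ((preReflection a f * preReflection b g) ^ k) (v - x • a - y • b) =
      v - x • a - y • b := by
    intro k
    induction k with
    | zero => simp
    | succ k ih =>
      rw [pow_succ', Module.End.mul_apply, ih]
      have hg0 : g (v - x • a - y • b) = 0 := by
        simp only [map_sub, map_smul, h2, hga, hgb, smul_eq_mul]; ring
      have hf0 : f (v - x • a - y • b) = 0 := by
        simp only [map_sub, map_smul, h1, hfa, hfb, smul_eq_mul]; ring
      simp only [Module.End.mul_apply, preReflection_apply, hg0, hf0, zero_smul, sub_zero]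
  have hv : v = (v - x • a - y • b) + x • a + y • b := by abel
  conv_lhs => rw [hv]
  rw [map_add, map_add, map_smul, map_smul, hl', hr', hv0]
  exact hv.symm

/-- The order of the product of two reflections with angle `π / m` is a multiple of `m`. -/
theorem dvd_of_preReflection_mul_pow_eq_one {m k : ℕ} (hm : 2 ≤ m) (hfa : f a = 2) (hgb : g b = 2)
    (hfb : f b = -2 * cos (π / m)) (hga : g a = -2 * cos (π / m))
    (h : (preReflection a f * preReflection b g) ^ k = 1) : m ∣ k := by
  have hm0 : (0 : ℝ) < m := by exact_mod_cast (by omega : 0 < m)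
  have hs : 0 < sin (π / m) := by
    apply sin_pos_of_pos_of_lt_pi (by positivity)
    rw [div_lt_iff₀ hm0]
    have : (2 : ℝ) ≤ m := by exact_mod_cast hm
    nlinarith [pi_pos]
  have hl := sin_smul_pow_left hfa hgb hfb hga k
  rw [h, Module.End.one_apply] at hl
  set x := sin (2 * k * (π / m)) with hx
  set y := sin ((2 * k + 1) * (π / m)) with hy
  set c := cos (π / m)
  set s := sin (π / m)
  have hsc : s ^ 2 + c ^ 2 = 1 := sin_sq_add_cos_sq _
  have hf := congrArg f hl
  have hg := congrArg g hl
  simp only [map_add, map_smul, hfa, hgb, hfb, hga, smul_eq_mul] at hf hg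
  -- Applying both forms to the relation between `a` and `b` gives a nondegenerate system, so no
  -- linear independence of `a` and `b` is needed.
  have hx0 : x = 0 := by
    have : s ^ 2 * x = 0 := by linear_combination (-c / 2) * hf - (1 / 2) * hg + x * hsc
    rcases mul_eq_zero.1 this with h | h
    · exact absurd h (pow_ne_zero 2 hs.ne')
    · exact h
  have hys : y = s := by rw [hx0] at hf; linarith
  have e : (2 * (k : ℝ) + 1) * (π / m) = 2 * k * (π / m) + π / m := by ring
  rw [hy, e, sin_add, ← hx, hx0, zero_mul, zero_add] at hys
  have hc1 : cos (2 * k * (π / m)) = 1 := by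
    have := mul_right_cancel₀ hs.ne' (hys.trans (one_mul s).symm)
    exact this
  obtain ⟨n, hn⟩ := (cos_eq_one_iff _).1 hc1
  have h3 : (n : ℝ) * m = k := by
    field_simp at hn
    exact hn
  have h4 : n * (m : ℤ) = k := by exact_mod_cast h3
  have : (m : ℤ) ∣ k := ⟨n, by rw [← h4]; ring⟩
  exact_mod_cast this

variable {B : Type*} [Fintype B] [DecidableEq B] (M : CoxeterMatrix B)

/-- The coroots of the geometric representation. -/
def geomCoroot (i : B) : Dual ℝ (B → ℝ) :=
  ∑ j, (-2 * cos (π / M i j)) • LinearMap.proj j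

theorem geomCoroot_single (i j : B) :
    geomCoroot M i (Pi.single j 1) = -2 * cos (π / M i j) := by
  simp [geomCoroot, Pi.single_apply]

theorem geomCoroot_self (i : B) : geomCoroot M i (Pi.single i 1) = 2 := by
  rw [geomCoroot_single, M.diagonal]
  simp

theorem geom_isLiftable :
    M.IsLiftable fun i => preReflection (Pi.single i (1 : ℝ)) (geomCoroot M i) := by
  intro i j
  have hi := geomCoroot_self M i
  have hj := geomCoroot_self M j
  by_cases hij : i = j
  · subst hij
    rw [M.diagonal, pow_one]
    exact LinearMap.ext (involutive_preReflection hi)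
  -- An entry 0 encodes infinite order, so there is no relation to check.
  by_cases h0 : M i j = 0
  · rw [h0, pow_zero]
  · have := M.off_diagonal i j hij
    exact preReflection_mul_pow_eq_one (by omega) hi hj (geomCoroot_single M i j)
      (by rw [geomCoroot_single, M.symmetric])

variable {W : Type*} [Group W] {M} (cs : CoxeterSystem M W)

/-- The geometric representation of a Coxeter group. -/
def geomRep : W →* Module.End ℝ (B → ℝ) := cs.lift ⟨_, geom_isLiftable M⟩

theorem geomRep_simple (i : B) :
    geomRep cs (cs.simple i) = preReflection (Pi.single i (1 : ℝ)) (geomCoroot M i) :=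
  cs.lift_apply_simple (geom_isLiftable M) i

/-- In a Coxeter group, the product of two simple reflections has the expected order. -/
theorem orderOf_simple_mul_simple (i j : B) (h : M i j ≠ 0) :
    orderOf (cs.simple i * cs.simple j) = M i j := by
  by_cases hij : i = j
  · subst hij
    simp
  apply Nat.dvd_antisymm (orderOf_dvd_of_pow_eq_one (cs.simple_mul_simple_pow i j))
  have := M.off_diagonal i j hij
  apply dvd_of_preReflection_mul_pow_eq_one (by omega) (geomCoroot_self M i) (geomCoroot_self M j)
      (geomCoroot_single M i j) (by rw [geomCoroot_single, M.symmetric])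
  rw [← geomRep_simple cs, ← geomRep_simple cs, ← map_mul, ← map_pow, pow_orderOf_eq_one, map_one]

end Geometric

/-! ### Finite Coxeter groups -/

section FiniteCoxeter

open Real Module

variable {B : Type*} (M : CoxeterMatrix B)

/-- The Gram matrix of a Coxeter matrix. -/
def cosMatrix : Matrix B B ℝ := Matrix.of fun i j => -cos (π / M i j)

theorem cosMatrix_apply (i j : B) : cosMatrix M i j = -cos (π / M i j) := rfl

theorem cosMatrix_self (i : B) : cosMatrix M i i = 1 := by
  rw [cosMatrix_apply, M.diagonal]; simp

theorem cosMatrix_symm (i j : B) : cosMatrix M i j = cosMatrix M j i := by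
  rw [cosMatrix_apply, cosMatrix_apply, M.symmetric]

variable [Fintype B] [DecidableEq B] {W : Type*} [Group W] {M}

/-- The Gram matrix of a finite Coxeter group is positive definite. -/
theorem posDef_cosMatrix (cs : CoxeterSystem M W) [Finite W] : (cosMatrix M).PosDef := by
  have := Fintype.ofFinite W
  -- Averaging the dot product over the group gives an invariant positive definite form. It remains
  -- to compare it with the Gram matrix.
  let Q : (B → ℝ) →ₗ[ℝ] (B → ℝ) →ₗ[ℝ] ℝ :=
    ∑ w : W, (dotProductBilin ℝ ℝ (m := B)).compl₁₂ (geomRep cs w) (geomRep cs w)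
  have hQ : ∀ u v, Q u v = ∑ w : W, geomRep cs w u ⬝ᵥ geomRep cs w v := by
    intro u v
    simp [Q, LinearMap.sum_apply, dotProductBilin]
  have hinv : ∀ g u v, Q (geomRep cs g u) (geomRep cs g v) = Q u v := by
    intro g u v
    simp only [hQ, ← Module.End.mul_apply, ← map_mul]
    exact Fintype.sum_equiv (Equiv.mulRight g) _ _ fun w => rfl
  have hpos : ∀ u, u ≠ 0 → 0 < Q u u := by
    intro u hu
    rw [hQ]
    apply Finset.sum_pos' (fun w _ => by
      simpa using dotProduct_self_star_nonneg (geomRep cs w u))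
    refine ⟨1, Finset.mem_univ _, ?_⟩
    rw [map_one, Module.End.one_apply]
    simpa using Matrix.dotProduct_star_self_pos_iff.2 hu
  let e : B → B → ℝ := fun i => Pi.single i 1
  set q : B → ℝ := fun i => Q (e i) (e i) with hq
  have hq0 : ∀ i, 0 < q i := fun i => hpos _ (by simp [e])
  have hsymm : ∀ u v, Q u v = Q v u := by
    intro u v
    simp only [hQ, dotProduct_comm]
  -- Invariance under the `i`-th reflection, which negates `e i`, determines `Q (e i) (e j)` from `q
  -- i`.
  have hQe : ∀ i j, Q (e i) (e j) = q i * cosMatrix M i j := by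
    intro i j
    have h1 := hinv (cs.simple i) (e i) (e j)
    rw [geomRep_simple, preReflection_apply_self (geomCoroot_self M i), preReflection_apply,
      geomCoroot_single, map_neg, LinearMap.neg_apply, map_sub, map_smul] at h1
    simp only [smul_eq_mul] at h1
    rw [cosMatrix_apply]
    simp only [hq]
    linarith
  -- By symmetry `q i = q j` whenever the entry is nonzero, so dividing each basis vector by `√(q
  -- i)` turns `Q` into the Gram matrix.
  have hqij : ∀ i j, cosMatrix M i j * √(q i) * √(q j) = q i * cosMatrix M i j := by
    intro i j
    have h1 : q i * cosMatrix M i j = q j * cosMatrix M i j := by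
      rw [← hQe, hsymm, hQe, cosMatrix_symm]
    by_cases h0 : cosMatrix M i j = 0
    · simp [h0]
    · rw [← mul_right_cancel₀ h0 h1, mul_assoc, mul_self_sqrt (hq0 i).le, mul_comm]
  apply Matrix.PosDef.of_dotProduct_mulVec_pos
  · ext i j
    simp [cosMatrix_symm]
  intro x hx
  have hy : Q (fun i => x i / √(q i)) (fun i => x i / √(q i)) = star x ⬝ᵥ (cosMatrix M).mulVec x := by
    have hdec : ∀ y : B → ℝ, y = ∑ i, y i • e i := by
      intro y
      ext j
      simp [e, Finset.sum_apply, Pi.single_apply]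
    rw [hdec fun i => x i / √(q i)]
    simp only [map_sum, LinearMap.sum_apply, map_smul, LinearMap.smul_apply, hQe, dotProduct,
      Matrix.mulVec, Finset.mul_sum, smul_eq_mul]
    rw [Finset.sum_comm]
    refine Finset.sum_congr rfl fun i _ => Finset.sum_congr rfl fun j _ => ?_
    rw [← hqij]
    have h1 := (sqrt_pos.2 (hq0 i)).ne'
    have h2 := (sqrt_pos.2 (hq0 j)).ne'
    field_simp
    simp
    ring
  rw [← hy]
  apply hpos
  contrapose! hx
  ext i
  have := congrFun hx i
  simpa [(sqrt_pos.2 (hq0 i)).ne'] using this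

/-- A finite Coxeter group has no infinite entries. -/
theorem entry_ne_zero_of_finite (cs : CoxeterSystem M W) [Finite W] (i j : B) : M i j ≠ 0 := by
  intro h0
  have hij : i ≠ j := by
    rintro rfl
    rw [M.diagonal] at h0
    exact one_ne_zero h0
  -- With an entry 0 the convention `π / 0 = 0` gives the Gram entry -1, so the sum of the two basis
  -- vectors is isotropic.
  have h := (posDef_cosMatrix cs).dotProduct_mulVec_pos (x := Pi.single i 1 + Pi.single j 1) (by
    intro h
    have := congrFun h i
    simp [hij] at this)
  simp [Matrix.mulVec_add, cosMatrix_self, cosMatrix_symm M j i, cosMatrix_apply M i j, h0] at h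

theorem half_le_cos {m : ℕ} (h : 3 ≤ m) : 1 / 2 ≤ cos (π / m) := by
  rw [← cos_pi_div_three]
  have : (3 : ℝ) ≤ m := by exact_mod_cast h
  apply cos_le_cos_of_nonneg_of_le_pi (by positivity) (by linarith [pi_pos])
  gcongr

theorem half_le_cos_sq {m : ℕ} (h : 4 ≤ m) : 1 / 2 ≤ cos (π / m) ^ 2 := by
  have h1 : √2 / 2 ≤ cos (π / m) := by
    rw [← cos_pi_div_four]
    have : (4 : ℝ) ≤ m := by exact_mod_cast h
    apply cos_le_cos_of_nonneg_of_le_pi (by positivity) (by linarith [pi_pos])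
    gcongr
  have h2 : (√2 / 2) ^ 2 = 1 / 2 := by rw [div_pow, sq_sqrt (by norm_num)]; norm_num
  rw [← h2]
  gcongr

theorem three_fourths_le_cos_sq {m : ℕ} (h : 6 ≤ m) : 3 / 4 ≤ cos (π / m) ^ 2 := by
  have h1 : √3 / 2 ≤ cos (π / m) := by
    rw [← cos_pi_div_six]
    have : (6 : ℝ) ≤ m := by exact_mod_cast h
    apply cos_le_cos_of_nonneg_of_le_pi (by positivity) (by linarith [pi_pos])
    gcongr
  have h2 : (√3 / 2) ^ 2 = 3 / 4 := by rw [div_pow, sq_sqrt (by norm_num)]; norm_num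
  rw [← h2]
  gcongr

/-- The standard forms of the finite Coxeter matrices of rank three. -/
def IsStandardTriple (M : CoxeterMatrix (Fin 3)) (p q : ℕ) : Prop :=
  M 0 2 = 2 ∧ M 0 1 = p ∧ M 1 2 = q ∧ (p = 2 ∧ 2 ≤ q ∨ p = 3 ∧ (q = 3 ∨ q = 4 ∨ q = 5))

/-- Classification of the finite Coxeter groups of rank three. -/
theorem exists_isStandardTriple {M : CoxeterMatrix (Fin 3)} (cs : CoxeterSystem M W) [Finite W] :
    ∃ (σ : Equiv.Perm (Fin 3)) (p q : ℕ), IsStandardTriple (M.reindex σ) p q := by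
  have hdet : ∀ σ : Equiv.Perm (Fin 3), 0 < 1 - cos (π / M.reindex σ 0 1) ^ 2 -
      cos (π / M.reindex σ 1 2) ^ 2 - cos (π / M.reindex σ 0 2) ^ 2 - 2 *
      (cos (π / M.reindex σ 0 1) * cos (π / M.reindex σ 1 2) * cos (π / M.reindex σ 0 2)) := by
    intro σ
    have h := (posDef_cosMatrix (cs.reindex σ)).det_pos
    rw [Matrix.det_fin_three, cosMatrix_self, cosMatrix_self, cosMatrix_self, cosMatrix_symm _ 1 0,
      cosMatrix_symm _ 2 0, cosMatrix_symm _ 2 1] at h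
    simp only [cosMatrix_apply] at h
    linarith
  have hge : ∀ (σ : Equiv.Perm (Fin 3)) (i j : Fin 3), i ≠ j → 2 ≤ M.reindex σ i j := by
    intro σ i j hij
    have := entry_ne_zero_of_finite (cs.reindex σ) i j
    have := (M.reindex σ).off_diagonal i j hij
    omega
  obtain ⟨σ, h02⟩ : ∃ σ : Equiv.Perm (Fin 3), M.reindex σ 0 2 = 2 := by
    by_contra! hcon
    have h1 := hdet (Equiv.refl _)
    have ha : 3 ≤ M 0 1 := by
      have := hcon (Equiv.swap 1 2)
      have := hge (Equiv.refl _) 0 1 (by decide)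
      simp [CoxeterMatrix.reindex_apply, Equiv.swap_apply_def] at *
      omega
    have hb : 3 ≤ M 0 2 := by
      have := hcon (Equiv.refl _)
      have := hge (Equiv.refl _) 0 2 (by decide)
      simp [CoxeterMatrix.reindex_apply] at *
      omega
    have hc : 3 ≤ M 1 2 := by
      have := hcon (Equiv.swap 0 1)
      have := hge (Equiv.refl _) 1 2 (by decide)
      simp [CoxeterMatrix.reindex_apply, Equiv.swap_apply_def] at *
      omega
    simp only [CoxeterMatrix.reindex_apply, Equiv.refl_symm, Equiv.refl_apply] at h1
    have h2 := half_le_cos ha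
    have h3 := half_le_cos hb
    have h4 := half_le_cos hc
    -- Three cosines that are all at least 1/2 make the determinant at most 1 - 3/4 - 2/8 = 0, so
    -- some pair commutes.
    nlinarith [mul_nonneg (sub_nonneg.2 h2) (sub_nonneg.2 h3),
      mul_nonneg (mul_nonneg (sub_nonneg.2 h2) (sub_nonneg.2 h3)) (sub_nonneg.2 h4),
      mul_nonneg (sub_nonneg.2 h2) (sub_nonneg.2 h4),
      mul_nonneg (sub_nonneg.2 h3) (sub_nonneg.2 h4)]
  have h1 := hdet σ
  have ha := hge σ 0 1 (by decide)
  have hc := hge σ 1 2 (by decide)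
  rw [h02] at h1
  simp only [Nat.cast_ofNat, cos_pi_div_two] at h1
  have hswap : ∀ i j, M.reindex (σ.trans (Equiv.swap 0 2)) i j =
      M.reindex σ (Equiv.swap 0 2 i) (Equiv.swap 0 2 j) := fun i j => rfl
  have hs : (Equiv.swap (0 : Fin 3) 2) 1 = 1 := by decide
  have h20 := (M.reindex σ).symmetric 2 0
  have h21 := (M.reindex σ).symmetric 2 1
  have h10 := (M.reindex σ).symmetric 1 0
  -- The determinant is now 1 minus the two squared cosines. This excludes two labels at least 4
  -- (1/2 + 1/2), and below a label 3 with a label at least 6 (1/4 + 3/4).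
  have h4 : ¬ (4 ≤ M.reindex σ 0 1 ∧ 4 ≤ M.reindex σ 1 2) := by
    rintro ⟨h, h'⟩
    nlinarith [half_le_cos_sq h, half_le_cos_sq h']
  have h36 : ∀ a b : ℕ, cos (π / a) ^ 2 + cos (π / b) ^ 2 < 1 → a = 3 → ¬ 6 ≤ b := by
    rintro a b hab rfl h
    have := three_fourths_le_cos_sq h
    simp only [Nat.cast_ofNat, cos_pi_div_three] at hab
    norm_num at hab
    linarith
  have h5 := h36 (M.reindex σ 0 1) (M.reindex σ 1 2) (by linarith)
  have h6 := h36 (M.reindex σ 1 2) (M.reindex σ 0 1) (by linarith)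
  by_cases hcase : M.reindex σ 0 1 = 2 ∨ (M.reindex σ 0 1 = 3 ∧ M.reindex σ 1 2 ≠ 2)
  · exact ⟨σ, _, _, h02, rfl, rfl, by omega⟩
  · refine ⟨σ.trans (Equiv.swap 0 2), _, _, ?_, rfl, rfl, ?_⟩
    · rw [hswap, Equiv.swap_apply_left, Equiv.swap_apply_right, h20, h02]
    · rw [hswap, hswap, Equiv.swap_apply_left, Equiv.swap_apply_right, hs, h21, h10]
      omega

end FiniteCoxeter

/-! ### A group with sign determines its finite Coxeter type of rank at most three -/

section Uniqueness

variable {G : Type*} [Group G] (ε : G →* ℤˣ)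

theorem mul_eq_inv_of_sq_eq_one {x y : G} (hx : x * x = 1) (hy : y * y = 1) : y * x = (x * y)⁻¹ := by
  rw [mul_inv_rev, inv_eq_of_mul_eq_one_right hx, inv_eq_of_mul_eq_one_right hy]

theorem pow_eq_one_of_orderOf_eq {x : G} {n : ℕ} (h : orderOf x = n) : x ^ n = 1 :=
  h ▸ pow_orderOf_eq_one x

/-- The kernel of the sign separates the ranks: it is trivial in rank one, cyclic and nontrivial in
rank two, and not cyclic in rank three. -/
theorem ker_sign_of_rank_one {M : CoxeterMatrix (Fin 1)} (cs : CoxeterSystem M G)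
    (hε : ∀ i, ε (cs.simple i) = -1) : ε.ker = ⊥ := by
  have key : ∀ g : G, g = 1 ∨ g = cs.simple 0 := by
    intro g
    induction g using cs.simple_induction_left with
    | one => exact Or.inl rfl
    | mul_simple_left w i ih =>
      obtain rfl := Subsingleton.elim i 0
      rcases ih with rfl | rfl
      · simp
      · simp
  rw [eq_bot_iff]
  intro g hg
  rcases key g with rfl | rfl
  · exact Subgroup.one_mem _
  · rw [MonoidHom.mem_ker, hε] at hg
    exact absurd hg (by decide)

theorem ker_sign_of_rank_two {M : CoxeterMatrix (Fin 2)} (cs : CoxeterSystem M G)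
    (hε : ∀ i, ε (cs.simple i) = -1) :
    ε.ker = Subgroup.zpowers (cs.simple 0 * cs.simple 1) := by
  set c := cs.simple 0 * cs.simple 1 with hc
  have key : ∀ g : G, g ∈ Subgroup.zpowers c ∨ cs.simple 0 * g ∈ Subgroup.zpowers c := by
    intro g
    induction g using cs.simple_induction_left with
    | one => exact Or.inl (Subgroup.one_mem _)
    | mul_simple_left w i ih =>
      fin_cases i
      · rcases ih with h | h
        · right
          simpa using h
        · left
          exact h
      · rcases ih with h | h
        · right
          rw [← mul_assoc]
          exact Subgroup.mul_mem _ (Subgroup.mem_zpowers c) h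
        · left
          have : cs.simple 1 * w = c⁻¹ * (cs.simple 0 * w) := by
            simp [hc, mul_assoc]
          rw [show cs.simple ((fun i => i) (⟨1, by decide⟩ : Fin 2)) = cs.simple 1 from rfl, this]
          exact Subgroup.mul_mem _ (Subgroup.inv_mem _ (Subgroup.mem_zpowers c)) h
  have hcε : ε c = 1 := by rw [hc, map_mul, hε, hε]; rfl
  apply le_antisymm
  · intro g hg
    rcases key g with h | h
    · exact h
    · exfalso
      obtain ⟨n, hn⟩ := Subgroup.mem_zpowers_iff.1 h
      have := congrArg ε hn
      rw [map_zpow, hcε, one_zpow, map_mul, hε, MonoidHom.mem_ker.1 hg] at this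
      exact absurd this (by decide)
  · rw [Subgroup.zpowers_le]
    exact hcε

/-- The squares in the kernel of `ε` commute. -/
def SquaresCommute : Prop := ∀ a ∈ ε.ker, ∀ b ∈ ε.ker, a ^ 2 * b ^ 2 = b ^ 2 * a ^ 2

theorem commute_of_orderOf_eq_two {x y : G} (hx : x * x = 1) (hy : y * y = 1)
    (h : orderOf (x * y) = 2) : x * y = y * x := by
  rw [mul_eq_inv_of_sq_eq_one hx hy, eq_comm, inv_eq_iff_mul_eq_one, ← pow_two, ← h,
    pow_orderOf_eq_one]

/-! ### Rank three, reducible types A₁ × I₂(q). -/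

section Reducible

variable {M : CoxeterMatrix (Fin 3)} (cs : CoxeterSystem M G) {q : ℕ}

/-- The first generator is central, so the group is the product of a group of order two and a
dihedral group, whose elements are rotations or one reflection times a rotation. -/
theorem exists_zpow_of_reducible (hM : IsStandardTriple M 2 q) (g : G) : ∃ n : ℤ,
    let c := cs.simple 1 * cs.simple 2
    g = c ^ n ∨ g = cs.simple 1 * c ^ n ∨ g = cs.simple 0 * c ^ n ∨
      g = cs.simple 0 * (cs.simple 1 * c ^ n) := by
  have h0 := cs.simple_mul_simple_self 0
  have h1 := cs.simple_mul_simple_self 1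
  have h2 := cs.simple_mul_simple_self 2
  have h01 := commute_of_orderOf_eq_two h0 h1
    (by rw [orderOf_simple_mul_simple cs 0 1 (by rw [hM.2.1]; decide), hM.2.1])
  have h02 := commute_of_orderOf_eq_two h0 h2
    (by rw [orderOf_simple_mul_simple cs 0 2 (by rw [hM.1]; decide), hM.1])
  generalize hx : cs.simple 0 = x at *
  generalize hy : cs.simple 1 = y at *
  generalize hz : cs.simple 2 = z at *
  have hzc : ∀ n : ℤ, z * (y * z) ^ n = y * (y * z) ^ (n + 1) := by
    intro n
    rw [add_comm, zpow_add, zpow_one, ← mul_assoc, ← mul_assoc, h1, one_mul]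
  have hzyc : ∀ n : ℤ, z * (y * (y * z) ^ n) = (y * z) ^ (n - 1) := by
    intro n
    rw [sub_eq_neg_add, zpow_add, zpow_neg, zpow_one, ← mul_eq_inv_of_sq_eq_one h1 h2, mul_assoc]
  have cx : ∀ w, x * (x * w) = w := fun w => by rw [← mul_assoc, h0, one_mul]
  have cy : ∀ w, y * (y * w) = w := fun w => by rw [← mul_assoc, h1, one_mul]
  have cyx : ∀ w, y * (x * w) = x * (y * w) := fun w => by rw [← mul_assoc, ← h01, mul_assoc]
  have czx : ∀ w, z * (x * w) = x * (z * w) := fun w => by rw [← mul_assoc, ← h02, mul_assoc]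
  induction g using cs.simple_induction_left with
  | one => exact ⟨0, by simp⟩
  | mul_simple_left w i ih =>
    obtain ⟨n, ih⟩ := ih
    have hi : cs.simple i = x ∨ cs.simple i = y ∨ cs.simple i = z := by
      fin_cases i
      · exact Or.inl hx
      · exact Or.inr (Or.inl hy)
      · exact Or.inr (Or.inr hz)
    rcases hi with hi | hi | hi <;> rw [hi] <;> rcases ih with rfl | rfl | rfl | rfl
    · exact ⟨n, by simp⟩
    · exact ⟨n, by simp⟩
    · exact ⟨n, by simp [cx]⟩
    · exact ⟨n, by simp [cx]⟩
    · exact ⟨n, by simp⟩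
    · exact ⟨n, by simp [cy]⟩
    · exact ⟨n, by simp [cyx]⟩
    · exact ⟨n, by simp [cyx, cy]⟩
    · exact ⟨n + 1, by simp [hzc]⟩
    · exact ⟨n - 1, by simp [hzyc]⟩
    · exact ⟨n + 1, by simp [czx, hzc]⟩
    · exact ⟨n - 1, by simp [czx, hzyc]⟩

/-- An even element is a rotation, or the central involution times a reflection, whose square is 1.
Hence all squares of even elements lie in the cyclic group of rotations. -/
theorem squaresCommute_of_reducible (hM : IsStandardTriple M 2 q)
    (hε : ∀ i, ε (cs.simple i) = -1) : SquaresCommute ε := by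
  have h0 := cs.simple_mul_simple_self 0
  have h1 := cs.simple_mul_simple_self 1
  have h2 := cs.simple_mul_simple_self 2
  have h01 := commute_of_orderOf_eq_two h0 h1
    (by rw [orderOf_simple_mul_simple cs 0 1 (by rw [hM.2.1]; decide), hM.2.1])
  have h02 := commute_of_orderOf_eq_two h0 h2
    (by rw [orderOf_simple_mul_simple cs 0 2 (by rw [hM.1]; decide), hM.1])
  have hc : ∀ n : ℤ, ε ((cs.simple 1 * cs.simple 2) ^ n) = 1 := by
    intro n
    rw [map_zpow, map_mul, hε, hε]
    simp
  have hm : (-1 : ℤˣ) ≠ 1 := by decide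
  have key : ∀ a ∈ ε.ker, a ^ 2 ∈ Subgroup.zpowers (cs.simple 1 * cs.simple 2) := by
    intro a ha
    rw [MonoidHom.mem_ker] at ha
    obtain ⟨n, rfl | rfl | rfl | rfl⟩ := exists_zpow_of_reducible cs hM a
    · exact Subgroup.pow_mem _ (Subgroup.zpow_mem_zpowers _ n) 2
    · rw [map_mul, hε, hc, mul_one] at ha
      exact absurd ha hm
    · rw [map_mul, hε, hc, mul_one] at ha
      exact absurd ha hm
    · set x := cs.simple 0
      set y := cs.simple 1
      set z := cs.simple 2
      have hyc : y * (y * z) ^ n * y = (y * z) ^ (-n) := by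
        have : y * (y * z) ^ n * y⁻¹ = (y * (y * z) * y⁻¹) ^ n := (conj_zpow).symm
        rw [inv_eq_of_mul_eq_one_right h1] at this
        rw [this, ← mul_assoc, h1, one_mul, mul_eq_inv_of_sq_eq_one h1 h2, inv_zpow']
      have hcx : Commute x (y * (y * z) ^ n) :=
        Commute.mul_right h01 (Commute.zpow_right (Commute.mul_right h01 h02) n)
      rw [hcx.mul_pow, pow_two x, h0, one_mul, pow_two, ← mul_assoc, hyc, ← zpow_add]
      simp
  intro a ha b hb
  obtain ⟨n, hn⟩ := key a ha
  obtain ⟨m, hm⟩ := key b hb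
  simp only at hn hm
  rw [← hn, ← hm, ← zpow_add, ← zpow_add, add_comm]

/-- The sign together with the character `χ` that is -1 only on the first generator maps onto a
group of order four, with kernel the rotations, of order `q`. -/
theorem card_of_reducible [Finite G] (hM : IsStandardTriple M 2 q)
    (hε : ∀ i, ε (cs.simple i) = -1) : Nat.card G = 4 * q := by
  have hq : 2 ≤ q := by
    rcases hM.2.2.2 with h | h <;> omega
  have hlift : M.IsLiftable (![-1, 1, 1] : Fin 3 → ℤˣ) := by
    have e1 := hM.1
    have e2 := hM.2.1
    have e3 := M.symmetric 1 0
    have e4 := M.symmetric 2 0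
    intro i j
    fin_cases i <;> fin_cases j <;> simp_all
  set χ : G →* ℤˣ := cs.lift ⟨_, hlift⟩
  have hχ0 : χ (cs.simple 0) = -1 := cs.lift_apply_simple hlift 0
  have hχ1 : χ (cs.simple 1) = 1 := cs.lift_apply_simple hlift 1
  have hχ2 : χ (cs.simple 2) = 1 := cs.lift_apply_simple hlift 2
  set c := cs.simple 1 * cs.simple 2 with hc
  have hcε : ∀ n : ℤ, ε (c ^ n) = 1 := by
    intro n
    rw [map_zpow, hc, map_mul, hε, hε]
    simp
  have hcχ : ∀ n : ℤ, χ (c ^ n) = 1 := by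
    intro n
    rw [map_zpow, hc, map_mul, hχ1, hχ2]
    simp
  have hm : (-1 : ℤˣ) ≠ 1 := by decide
  have hker : (ε.prod χ).ker = Subgroup.zpowers c := by
    ext g
    rw [MonoidHom.mem_ker, MonoidHom.prod_apply, Prod.mk_eq_one]
    constructor
    · rintro ⟨h1, h2⟩
      obtain ⟨n, rfl | rfl | rfl | rfl⟩ := exists_zpow_of_reducible cs hM g
      · exact ⟨n, rfl⟩
      · rw [map_mul, hε, hcε, mul_one] at h1
        exact absurd h1 hm
      · rw [map_mul, hε, hcε, mul_one] at h1
        exact absurd h1 hm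
      · rw [map_mul, map_mul, hχ0, hχ1, hcχ, mul_one, mul_one] at h2
        exact absurd h2 hm
    · rintro ⟨n, rfl⟩
      exact ⟨hcε n, hcχ n⟩
  have hrange : (ε.prod χ).range = ⊤ := by
    rw [eq_top_iff]
    have h0 : ((-1 : ℤˣ), (-1 : ℤˣ)) ∈ (ε.prod χ).range :=
      ⟨cs.simple 0, by rw [MonoidHom.prod_apply, hε, hχ0]⟩
    have h1 : ((-1 : ℤˣ), (1 : ℤˣ)) ∈ (ε.prod χ).range :=
      ⟨cs.simple 1, by rw [MonoidHom.prod_apply, hε, hχ1]⟩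
    rintro ⟨a, b⟩ -
    rcases Int.units_eq_one_or a with rfl | rfl <;> rcases Int.units_eq_one_or b with rfl | rfl
    · exact Subgroup.one_mem _
    · have := Subgroup.mul_mem _ h0 h1
      simpa using this
    · exact h1
    · exact h0
  have := Subgroup.card_mul_index (ε.prod χ).ker
  rw [Subgroup.index_ker, hrange, hker, Nat.card_zpowers, Subgroup.card_top, Nat.card_prod,
    Nat.card_eq_fintype_card, Fintype.card_units_int, hc,
    orderOf_simple_mul_simple cs 1 2 (by rw [hM.2.2.1]; omega), hM.2.2.1] at this
  omega

/-- The products of the central generator with the two others are distinct involutions of the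
kernel, whereas a cyclic group has at most two solutions of g² = 1. -/
theorem not_isCyclic_of_reducible (hM : IsStandardTriple M 2 q) [Finite G]
    (hε : ∀ i, ε (cs.simple i) = -1) : ¬ IsCyclic ε.ker := by
  intro hcyc
  have hq : 2 ≤ q := by
    rcases hM.2.2.2 with h | h <;> omega
  have h01 : orderOf (cs.simple 0 * cs.simple 1) = 2 := by
    rw [orderOf_simple_mul_simple cs 0 1 (by rw [hM.2.1]; decide), hM.2.1]
  have h02 : orderOf (cs.simple 0 * cs.simple 2) = 2 := by
    rw [orderOf_simple_mul_simple cs 0 2 (by rw [hM.1]; decide), hM.1]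
  have h12 : orderOf (cs.simple 1 * cs.simple 2) = q := by
    rw [orderOf_simple_mul_simple cs 1 2 (by rw [hM.2.2.1]; omega), hM.2.2.1]
  have hmem : ∀ i j, cs.simple i * cs.simple j ∈ ε.ker := by
    intro i j
    rw [MonoidHom.mem_ker, map_mul, hε, hε]
    rfl
  have := Fintype.ofFinite ε.ker
  classical
  have hcard := IsCyclic.card_pow_eq_one_le (α := ε.ker) (n := 2) (by decide)
  let a : ε.ker := ⟨_, hmem 0 1⟩
  let b : ε.ker := ⟨_, hmem 0 2⟩
  have ha : a ^ 2 = 1 := Subtype.ext (pow_eq_one_of_orderOf_eq h01)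
  have hb : b ^ 2 = 1 := Subtype.ext (pow_eq_one_of_orderOf_eq h02)
  have ha1 : a ≠ 1 := by
    intro h
    have : cs.simple 0 * cs.simple 1 = 1 := congrArg Subtype.val h
    rw [this, orderOf_one] at h01
    omega
  have hb1 : b ≠ 1 := by
    intro h
    have : cs.simple 0 * cs.simple 2 = 1 := congrArg Subtype.val h
    rw [this, orderOf_one] at h02
    omega
  have hab : a ≠ b := by
    intro h
    have : cs.simple 0 * cs.simple 1 = cs.simple 0 * cs.simple 2 := congrArg Subtype.val h
    rw [mul_left_cancel this, cs.simple_mul_simple_self, orderOf_one] at h12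
    omega
  have hsub : ({1, a, b} : Finset ε.ker) ⊆ Finset.univ.filter fun g => g ^ 2 = 1 := by
    intro g hg
    simp only [Finset.mem_insert, Finset.mem_singleton] at hg
    rcases hg with rfl | rfl | rfl <;> simp [ha, hb]
  have h3 := (Finset.card_le_card hsub).trans hcard
  rw [Finset.card_insert_of_notMem (by simp [ha1.symm, hb1.symm]),
    Finset.card_insert_of_notMem (by simpa using hab), Finset.card_singleton] at h3
  omega

end Reducible

/-! ### Rank three, irreducible types A₃, B₃, H₃. -/

section Irreducible

/-- The triangle relations `(3, q, 2)` with `3 ≤ q ≤ 5` are incompatible with commutativity. -/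
theorem not_commute_of_triangle {a b : G} {q : ℕ} (hq : q = 3 ∨ q = 4 ∨ q = 5)
    (ha : orderOf a = 3) (hb : orderOf b = q) (hab : orderOf (a * b) = 2) : a * b ≠ b * a := by
  intro hcomm
  have ha3 : a ^ 3 = 1 := pow_eq_one_of_orderOf_eq ha
  have hbq : b ^ q = 1 := pow_eq_one_of_orderOf_eq hb
  have h2 : (a * b) ^ 2 = 1 := pow_eq_one_of_orderOf_eq hab
  have hc : Commute a b := hcomm
  rw [hc.mul_pow] at h2
  have hba : b ^ 2 = a := by
    have : a * (a ^ 2 * b ^ 2) = a := by rw [h2, mul_one]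
    rwa [← mul_assoc, ← pow_succ', ha3, one_mul] at this
  have hb6 : b ^ 6 = 1 := by
    rw [show 6 = 2 * 3 from rfl, pow_mul, hba, ha3]
  have h6 : q ∣ 6 := hb ▸ orderOf_dvd_of_pow_eq_one hb6
  rcases hq with rfl | rfl | rfl
  · rw [← hba, ← pow_succ, hbq, orderOf_one] at hab
    omega
  · omega
  · omega

/-- As `a` is a power of `a ^ 2`, it would commute with `b ^ 2`. If `q` is odd, `b` is a power of `b
^ 2` and everything commutes. If `q = 4`, the conjugate of `a` by `b` is the product of the inverses
of `a` and `b ^ 2`, and its cube being 1 forces `b ^ 6 = 1`. -/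
theorem not_squares_commute_of_triangle {a b : G} {q : ℕ} (hq : q = 3 ∨ q = 4 ∨ q = 5)
    (ha : orderOf a = 3) (hb : orderOf b = q) (hab : orderOf (a * b) = 2) :
    a ^ 2 * b ^ 2 ≠ b ^ 2 * a ^ 2 := by
  intro hcomm
  have ha3 : a ^ 3 = 1 := pow_eq_one_of_orderOf_eq ha
  have hbq : b ^ q = 1 := pow_eq_one_of_orderOf_eq hb
  have h2 : (a * b) ^ 2 = 1 := pow_eq_one_of_orderOf_eq hab
  have h : Commute (a ^ 2) (b ^ 2) := hcomm
  have hab2 : Commute a (b ^ 2) := by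
    have := h.pow_left 2
    rwa [← pow_mul, show a ^ (2 * 2) = a ^ 3 * a from pow_succ a 3, ha3, one_mul] at this
  rcases hq with rfl | rfl | rfl
  · apply not_commute_of_triangle (Or.inl rfl) ha hb hab
    have := hab2.pow_right 2
    rwa [← pow_mul, show b ^ (2 * 2) = b ^ 3 * b from pow_succ b 3, hbq, one_mul] at this
  · have hconj : b * a * b⁻¹ = a⁻¹ * (b ^ 2)⁻¹ := by
      rw [← mul_inv_rev, eq_inv_iff_mul_eq_one]
      have e : b * a * b⁻¹ * (b ^ 2 * a) = b * (a * b) * a := by group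
      have e' : (a * b) ^ 2 = a * (b * (a * b) * a) * a⁻¹ := by rw [pow_two]; group
      rw [h2, eq_comm, mul_inv_eq_one] at e'
      rw [e]
      exact mul_left_cancel (e'.trans (mul_one a).symm)
    have h6 : (b * a * b⁻¹) ^ 3 = 1 := by rw [conj_pow, ha3]; simp
    rw [hconj, (hab2.inv_inv).mul_pow, inv_pow, ha3, inv_one, one_mul, inv_pow, inv_eq_one,
      ← pow_mul] at h6
    have : 4 ∣ 2 * 3 := hb ▸ orderOf_dvd_of_pow_eq_one h6
    omega
  · apply not_commute_of_triangle (Or.inr (Or.inr rfl)) ha hb hab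
    have := hab2.pow_right 3
    rwa [← pow_mul, show b ^ (2 * 3) = b ^ 5 * b from pow_succ b 5, hbq, one_mul] at this

variable {M : CoxeterMatrix (Fin 3)} (cs : CoxeterSystem M G) {q : ℕ}

theorem triangle_of_irreducible (hM : IsStandardTriple M 3 q) :
    (q = 3 ∨ q = 4 ∨ q = 5) ∧ orderOf (cs.simple 0 * cs.simple 1) = 3 ∧
    orderOf (cs.simple 1 * cs.simple 2) = q ∧
    orderOf ((cs.simple 0 * cs.simple 1) * (cs.simple 1 * cs.simple 2)) = 2 := by
  have hq : q = 3 ∨ q = 4 ∨ q = 5 := by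
    rcases hM.2.2.2 with h | h
    · omega
    · exact h.2
  refine ⟨hq, ?_, ?_, ?_⟩
  · rw [orderOf_simple_mul_simple cs 0 1 (by rw [hM.2.1]; decide), hM.2.1]
  · rw [orderOf_simple_mul_simple cs 1 2 (by rw [hM.2.2.1]; omega), hM.2.2.1]
  · rw [← mul_assoc, cs.simple_mul_simple_cancel_right,
      orderOf_simple_mul_simple cs 0 2 (by rw [hM.1]; decide), hM.1]

theorem not_squaresCommute_of_irreducible (hM : IsStandardTriple M 3 q)
    (hε : ∀ i, ε (cs.simple i) = -1) : ¬ SquaresCommute ε := by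
  intro h
  obtain ⟨hq, ha, hb, hab⟩ := triangle_of_irreducible cs hM
  exact not_squares_commute_of_triangle hq ha hb hab (h _ (by simp [MonoidHom.mem_ker, hε]) _
    (by simp [MonoidHom.mem_ker, hε]))

theorem not_isCyclic_of_irreducible (hM : IsStandardTriple M 3 q)
    (hε : ∀ i, ε (cs.simple i) = -1) : ¬ IsCyclic ε.ker := by
  intro h
  obtain ⟨hq, ha, hb, hab⟩ := triangle_of_irreducible cs hM
  apply not_commute_of_triangle hq ha hb hab
  have h1 : cs.simple 0 * cs.simple 1 ∈ ε.ker := by simp [MonoidHom.mem_ker, hε]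
  have h2 : cs.simple 1 * cs.simple 2 ∈ ε.ker := by simp [MonoidHom.mem_ker, hε]
  have := h.commGroup.mul_comm ⟨_, h1⟩ ⟨_, h2⟩
  exact congrArg Subtype.val this

/-- An even label allows the third generator to have a sign independent of the first two; this
isolates type B₃. -/
theorem exists_character (hM : IsStandardTriple M 3 4) (hε : ∀ i, ε (cs.simple i) = -1) :
    ∃ χ : G →* ℤˣ, χ ≠ 1 ∧ χ ≠ ε := by
  have hlift : M.IsLiftable (![1, 1, -1] : Fin 3 → ℤˣ) := by
    have e1 := hM.1
    have e2 := hM.2.2.1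
    have e3 := M.symmetric 2 1
    have e4 := M.symmetric 2 0
    intro i j
    fin_cases i <;> fin_cases j <;> simp_all <;> decide
  refine ⟨cs.lift ⟨_, hlift⟩, ?_, ?_⟩
  · intro h
    have h2 := cs.lift_apply_simple hlift 2
    rw [h, MonoidHom.one_apply] at h2
    exact absurd h2 (by decide)
  · intro h
    have h2 := cs.lift_apply_simple hlift 0
    rw [h, hε] at h2
    exact absurd h2 (by decide)

theorem eq_one_of_odd_pow {u : ℤˣ} {n : ℕ} (hn : Odd n) (h : u ^ n = 1) : u = 1 := by
  rcases Int.units_eq_one_or u with rfl | rfl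
  · rfl
  · rw [hn.neg_one_pow] at h
    exact h

theorem eq_of_units_mul_eq_one {u v : ℤˣ} (h : u * v = 1) : u = v := by
  rw [mul_eq_one_iff_eq_inv.1 h, Int.units_inv_eq_self]

/-- Adjacent generators with an odd label take the same value under any sign character, so only the
trivial character and `ε` exist. -/
theorem not_exists_character (hM : IsStandardTriple M 3 q) (hq : Odd q)
    (hε : ∀ i, ε (cs.simple i) = -1) : ¬ ∃ χ : G →* ℤˣ, χ ≠ 1 ∧ χ ≠ ε := by
  rintro ⟨χ, h1, h2⟩
  obtain ⟨-, ha, hb, -⟩ := triangle_of_irreducible cs hM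
  have e1 : χ (cs.simple 0) = χ (cs.simple 1) := by
    apply eq_of_units_mul_eq_one
    apply eq_one_of_odd_pow (n := 3) (by decide)
    rw [← map_mul, ← map_pow, pow_eq_one_of_orderOf_eq ha, map_one]
  have e2 : χ (cs.simple 1) = χ (cs.simple 2) := by
    apply eq_of_units_mul_eq_one
    apply eq_one_of_odd_pow hq
    rw [← map_mul, ← map_pow, pow_eq_one_of_orderOf_eq hb, map_one]
  rcases Int.units_eq_one_or (χ (cs.simple 2)) with h | h
  · apply h1
    apply cs.ext_simple
    intro i
    fin_cases i <;> simp_all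
  · apply h2
    apply cs.ext_simple
    intro i
    fin_cases i <;> simp_all

/-- The symmetric group on four letters maps onto that on three letters; this separates A₃ from H₃.
-/
theorem exists_hom_perm (cs : CoxeterSystem M G) (hM : IsStandardTriple M 3 3) :
    ∃ ψ : G →* Equiv.Perm (Fin 3), ∃ g h, ψ g * ψ h ≠ ψ h * ψ g := by
  have hlift : M.IsLiftable (![Equiv.swap 0 1, Equiv.swap 1 2, Equiv.swap 0 1] :
      Fin 3 → Equiv.Perm (Fin 3)) := by
    have e1 := hM.1
    have e2 := hM.2.2.1
    have e2' := hM.2.1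
    have e3 := M.symmetric 2 1
    have e4 := M.symmetric 2 0
    have e5 := M.symmetric 1 0
    intro i j
    fin_cases i <;> fin_cases j <;> simp_all <;> decide
  refine ⟨cs.lift ⟨_, hlift⟩, cs.simple 0, cs.simple 1, ?_⟩
  rw [cs.lift_apply_simple hlift, cs.lift_apply_simple hlift]
  decide

/-- No permutation of three letters has order five, so the last two generators have the same image.
The image of `cs.simple 0 * cs.simple 1` then has both cube and square 1, so all generators have the
same image, which generates a commutative group. -/
theorem not_exists_hom_perm (cs : CoxeterSystem M G) (hM : IsStandardTriple M 3 5) :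
    ¬ ∃ ψ : G →* Equiv.Perm (Fin 3), ∃ g h, ψ g * ψ h ≠ ψ h * ψ g := by
  rintro ⟨ψ, g, h, hne⟩
  apply hne
  obtain ⟨-, ha, hb, hab⟩ := triangle_of_irreducible cs hM
  rw [← mul_assoc, cs.simple_mul_simple_cancel_right] at hab
  have hP5 : ∀ σ : Equiv.Perm (Fin 3), σ ^ 5 = 1 → σ = 1 := by
    intro σ h5
    have h6 : σ ^ 6 = 1 := by
      have := pow_card_eq_one (x := σ)
      rwa [Fintype.card_perm, Fintype.card_fin] at this
    rwa [pow_succ, h5, one_mul] at h6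
  have hP3 : ∀ σ : Equiv.Perm (Fin 3), σ ^ 3 = 1 → σ ^ 2 = 1 → σ = 1 := by
    intro σ h3 h2
    rwa [pow_succ, h2, one_mul] at h3
  have hs : ∀ i, ψ (cs.simple i) * ψ (cs.simple i) = 1 := fun i => by
    rw [← map_mul, cs.simple_mul_simple_self, map_one]
  have heq : ∀ i j, ψ (cs.simple i) * ψ (cs.simple j) = 1 → ψ (cs.simple i) = ψ (cs.simple j) :=
    fun i j h => by rw [mul_eq_one_iff_eq_inv.1 h, inv_eq_of_mul_eq_one_right (hs j)]
  have e12 : ψ (cs.simple 1) = ψ (cs.simple 2) := by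
    apply heq
    apply hP5
    rw [← map_mul, ← map_pow, pow_eq_one_of_orderOf_eq hb, map_one]
  have e01 : ψ (cs.simple 0) = ψ (cs.simple 1) := by
    apply heq
    apply hP3
    · rw [← map_mul, ← map_pow, pow_eq_one_of_orderOf_eq ha, map_one]
    · rw [e12, ← map_mul, ← map_pow, pow_eq_one_of_orderOf_eq hab, map_one]
  have key : ∀ g, ψ g = 1 ∨ ψ g = ψ (cs.simple 0) := by
    intro g
    induction g using cs.simple_induction_left with
    | one => simp
    | mul_simple_left w i ih =>
      have hi : ψ (cs.simple i) = ψ (cs.simple 0) := by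
        fin_cases i
        · rfl
        · exact e01.symm
        · exact (e01.trans e12).symm
      rw [map_mul, hi]
      rcases ih with h | h <;> rw [h]
      · simp
      · left
        exact hs 0
  rcases key g with h1 | h1 <;> rcases key h with h2 | h2 <;> rw [h1, h2] <;> simp

end Irreducible

/-- Commutation of squares of even elements detects reducibility, and then the order gives `q`.
Among the irreducible types, an extra sign character singles out 4, and a noncommutative image in
the permutations of three letters tells 3 from 5. -/
theorem standardTriple_unique [Finite G] {M N : CoxeterMatrix (Fin 3)} (cs : CoxeterSystem M G)
    (cs' : CoxeterSystem N G) {p q p' q' : ℕ} (hM : IsStandardTriple M p q)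
    (hN : IsStandardTriple N p' q') (hε : ∀ i, ε (cs.simple i) = -1)
    (hε' : ∀ i, ε (cs'.simple i) = -1) : p = p' ∧ q = q' := by
  rcases hM.2.2.2 with ⟨rfl, hq⟩ | ⟨rfl, hq⟩ <;> rcases hN.2.2.2 with ⟨rfl, hq'⟩ | ⟨rfl, hq'⟩
  · have h1 := card_of_reducible ε cs hM hε
    have h2 := card_of_reducible ε cs' hN hε'
    omega
  · exact absurd (squaresCommute_of_reducible ε cs hM hε)
      (not_squaresCommute_of_irreducible ε cs' hN hε')
  · exact absurd (squaresCommute_of_reducible ε cs' hN hε')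
      (not_squaresCommute_of_irreducible ε cs hM hε)
  · refine ⟨rfl, ?_⟩
    have o3 : Odd 3 := by decide
    have o5 : Odd 5 := by decide
    rcases hq with rfl | rfl | rfl <;> rcases hq' with rfl | rfl | rfl
    · rfl
    · exact absurd (exists_character ε cs' hN hε') (not_exists_character ε cs hM o3 hε)
    · exact absurd (exists_hom_perm cs hM) (not_exists_hom_perm cs' hN)
    · exact absurd (exists_character ε cs hM hε) (not_exists_character ε cs' hN o3 hε')
    · rfl
    · exact absurd (exists_character ε cs hM hε) (not_exists_character ε cs' hN o5 hε')
    · exact absurd (exists_hom_perm cs' hN) (not_exists_hom_perm cs hM)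
    · exact absurd (exists_character ε cs' hN hε') (not_exists_character ε cs hM o5 hε)
    · rfl

theorem coxeterMatrix_ext_of_le {r : ℕ} {M N : CoxeterMatrix (Fin r)}
    (h : ∀ i j, i < j → M i j = N i j) : M = N := by
  apply CoxeterMatrix.ext
  ext i j
  rcases lt_trichotomy i j with hij | rfl | hij
  · exact h i j hij
  · exact (M.diagonal i).trans (N.diagonal i).symm
  · exact (M.symmetric i j).trans ((h j i hij).trans (N.symmetric j i))

theorem IsStandardTriple.eq {M N : CoxeterMatrix (Fin 3)} {p q : ℕ} (hM : IsStandardTriple M p q)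
    (hN : IsStandardTriple N p q) : M = N := by
  obtain ⟨h1, h2, h3, -⟩ := hM
  obtain ⟨h1', h2', h3', -⟩ := hN
  apply coxeterMatrix_ext_of_le
  intro i j hij
  fin_cases i <;> fin_cases j <;> simp_all

theorem reindex_trans {B B' B'' : Type*} (M : CoxeterMatrix B) (e : B ≃ B') (e' : B' ≃ B'') :
    M.reindex (e.trans e') = (M.reindex e).reindex e' := rfl

theorem reindex_refl {B : Type*} (M : CoxeterMatrix B) : M.reindex (Equiv.refl B) = M := rfl

/-- The Coxeter matrix of a finite Coxeter group of rank at most three is determined by the group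
together with its sign character. -/
theorem coxeterMatrix_unique [Finite G] {r r' : ℕ} (h1 : 1 ≤ r) (h3 : r ≤ 3) (h1' : 1 ≤ r')
    (h3' : r' ≤ 3) {M : CoxeterMatrix (Fin r)} {N : CoxeterMatrix (Fin r')}
    (cs : CoxeterSystem M G) (cs' : CoxeterSystem N G) (hε : ∀ i, ε (cs.simple i) = -1)
    (hε' : ∀ i, ε (cs'.simple i) = -1) : ∃ e : Fin r ≃ Fin r', M.reindex e = N := by
  have hcyc2 : ∀ {K : CoxeterMatrix (Fin 2)} (ks : CoxeterSystem K G),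
      (∀ i, ε (ks.simple i) = -1) → IsCyclic ε.ker ∧ Nat.card ε.ker = K 0 1 := by
    intro K ks hk
    rw [ker_sign_of_rank_two ε ks hk, Nat.card_zpowers,
      orderOf_simple_mul_simple ks 0 1 (entry_ne_zero_of_finite ks 0 1)]
    exact ⟨inferInstance, rfl⟩
  have hne2 : ∀ {K : CoxeterMatrix (Fin 2)} (ks : CoxeterSystem K G),
      (∀ i, ε (ks.simple i) = -1) → ε.ker ≠ ⊥ := by
    intro K ks hk h
    have := (hcyc2 ks hk).2
    rw [h, Subgroup.card_bot] at this
    exact K.off_diagonal 0 1 (by decide) this.symm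
  have hne3 : ∀ {K : CoxeterMatrix (Fin 3)} (ks : CoxeterSystem K G),
      (∀ i, ε (ks.simple i) = -1) → ¬ IsCyclic ε.ker := by
    intro K ks hk
    obtain ⟨σ, p, q, hσ⟩ := exists_isStandardTriple ks
    have hk' : ∀ i, ε ((ks.reindex σ).simple i) = -1 := fun i => hk _
    rcases hσ.2.2.2 with ⟨rfl, -⟩ | ⟨rfl, -⟩
    · exact not_isCyclic_of_reducible ε (ks.reindex σ) hσ hk'
    · exact not_isCyclic_of_irreducible ε (ks.reindex σ) hσ hk'
  have hbot : ε.ker = ⊥ → IsCyclic ε.ker := by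
    intro h
    rw [h]
    infer_instance
  -- Different ranks are excluded by the kernel of `ε`; in rank two its order is the label.
  interval_cases r <;> interval_cases r'
  · exact ⟨Equiv.refl _, coxeterMatrix_ext_of_le fun i j hij => by omega⟩
  · exact absurd (ker_sign_of_rank_one ε cs hε) (hne2 cs' hε')
  · exact absurd (hbot (ker_sign_of_rank_one ε cs hε)) (hne3 cs' hε')
  · exact absurd (ker_sign_of_rank_one ε cs' hε') (hne2 cs hε)
  · refine ⟨Equiv.refl _, coxeterMatrix_ext_of_le fun i j hij => ?_⟩
    have e1 := (hcyc2 cs hε).2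
    have e2 := (hcyc2 cs' hε').2
    rw [reindex_refl]
    obtain ⟨rfl, rfl⟩ : i = 0 ∧ j = 1 := by omega
    rw [← e1, ← e2]
  · exact absurd (hcyc2 cs hε).1 (hne3 cs' hε')
  · exact absurd (hbot (ker_sign_of_rank_one ε cs' hε')) (hne3 cs hε)
  · exact absurd (hcyc2 cs' hε').1 (hne3 cs hε)
  · obtain ⟨σ, p, q, hσ⟩ := exists_isStandardTriple cs
    obtain ⟨τ, p', q', hτ⟩ := exists_isStandardTriple cs'
    obtain ⟨rfl, rfl⟩ := standardTriple_unique ε (cs.reindex σ) (cs'.reindex τ) hσ hτ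
      (fun i => hε _) (fun i => hε' _)
    refine ⟨σ.trans τ.symm, ?_⟩
    rw [reindex_trans, hσ.eq hτ, ← reindex_trans, Equiv.self_trans_symm, reindex_refl]

end Uniqueness

/-! ### Simple systems of finite sets of unit vectors stable under reflections -/

section SimpleSystem

open Real Matrix

variable {n : ℕ}

/-- The orthogonal reflection with unit normal vector `a`. -/
def reflVec (a v : Fin n → ℝ) : Fin n → ℝ := v - (2 * (a ⬝ᵥ v)) • a

theorem reflVec_self {a : Fin n → ℝ} (ha : a ⬝ᵥ a = 1) : reflVec a a = -a := by
  rw [reflVec, ha, mul_one, two_smul]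
  abel

theorem reflVec_neg (a v : Fin n → ℝ) : reflVec a (-v) = -reflVec a v := by
  simp only [reflVec, dotProduct_neg]
  module

theorem reflVec_reflVec {a : Fin n → ℝ} (ha : a ⬝ᵥ a = 1) (v : Fin n → ℝ) :
    reflVec a (reflVec a v) = v := by
  simp only [reflVec, dotProduct_sub, dotProduct_smul, ha, smul_eq_mul]
  module

/-- A finite set of unit vectors stable under the reflections it defines. -/
structure IsUnitRootSet (Φ : Set (Fin n → ℝ)) : Prop where
  finite : Φ.Finite
  unit : ∀ a ∈ Φ, a ⬝ᵥ a = 1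
  stable : ∀ a ∈ Φ, ∀ b ∈ Φ, reflVec a b ∈ Φ

variable {Φ : Set (Fin n → ℝ)} (hΦ : IsUnitRootSet Φ)

theorem IsUnitRootSet.neg_mem (hΦ : IsUnitRootSet Φ) {a : Fin n → ℝ} (ha : a ∈ Φ) : -a ∈ Φ := by
  rw [← reflVec_self (hΦ.unit a ha)]
  exact hΦ.stable a ha a ha

/-- The cone spanned by a set of vectors. -/
abbrev coneSpan (D : Set (Fin n → ℝ)) : Submodule NNReal (Fin n → ℝ) := Submodule.span NNReal D

theorem smul_mem_coneSpan {D : Set (Fin n → ℝ)} {v : Fin n → ℝ} (hv : v ∈ coneSpan D) {c : ℝ}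
    (hc : 0 ≤ c) : c • v ∈ coneSpan D := (coneSpan D).smul_mem ⟨c, hc⟩ hv

/-- `D` is a simple system in the set `Φ`, with respect to the linear form `lam`. -/
structure IsSimpleSystem (Φ : Set (Fin n → ℝ)) (lam : Module.Dual ℝ (Fin n → ℝ))
    (D : Finset (Fin n → ℝ)) : Prop where
  ne_zero : ∀ a ∈ Φ, lam a ≠ 0
  sub : ∀ a ∈ D, a ∈ Φ
  pos : ∀ a ∈ D, 0 < lam a
  cone : ∀ a ∈ Φ, 0 < lam a → a ∈ coneSpan (D : Set (Fin n → ℝ))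
  crit : ∀ a ∈ D, a ∉ coneSpan ((D : Set (Fin n → ℝ)) \ {a})

/-- Choose a linear form vanishing on no root, and among the sets of positive roots whose cone
contains all positive roots take a minimal one. Minimality says that no element lies in the cone of
the others. -/
theorem exists_isSimpleSystem (hΦ : IsUnitRootSet Φ) : ∃ lam D, IsSimpleSystem Φ lam D := by
  classical
  obtain ⟨lam, hlam⟩ : ∃ lam : Module.Dual ℝ (Fin n → ℝ), ∀ a ∈ Φ, lam a ≠ 0 := by
    have := hΦ.finite.to_subtype
    obtain ⟨f, hf⟩ := Module.exists_dual_forall_apply_ne_zero (K := ℝ) (fun a : Φ => (a : Fin n → ℝ))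
      (fun a h => by
        have := hΦ.unit a a.2
        rw [h] at this
        simp at this)
    exact ⟨f, fun a ha => hf ⟨a, ha⟩⟩
  let P : Finset (Fin n → ℝ) → Prop := fun D => (∀ a ∈ D, a ∈ Φ ∧ 0 < lam a) ∧
    ∀ a ∈ Φ, 0 < lam a → a ∈ coneSpan (D : Set (Fin n → ℝ))
  obtain ⟨D, ⟨hD1, hD2⟩, hmin⟩ := exists_minimal_of_wellFoundedLT P
    ⟨hΦ.finite.toFinset.filter fun a => 0 < lam a, by simp, fun a ha h =>
      Submodule.subset_span (by simp [ha, h])⟩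
  refine ⟨lam, D, hlam, fun a ha => (hD1 a ha).1, fun a ha => (hD1 a ha).2, hD2, ?_⟩
  intro a ha hcon
  have hP : P (D.erase a) := by
    refine ⟨fun b hb => hD1 b (Finset.mem_of_mem_erase hb), fun b hb hpos => ?_⟩
    have h1 := hD2 b hb hpos
    refine (Submodule.span_le.2 ?_ : coneSpan _ ≤ coneSpan _) h1
    intro c hc
    by_cases hca : c = a
    · subst hca
      simpa using hcon
    · exact Submodule.subset_span (by simpa [hca] using hc)
  have := hmin hP (Finset.erase_subset a D) ha
  simp at this

namespace IsSimpleSystem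

variable {lam : Module.Dual ℝ (Fin n → ℝ)} {D : Finset (Fin n → ℝ)}

theorem eq_zero_or_pos (hD : IsSimpleSystem Φ lam D) {v : Fin n → ℝ}
    (hv : v ∈ coneSpan (D : Set (Fin n → ℝ))) : v = 0 ∨ 0 < lam v := by
  induction hv using Submodule.span_induction with
  | mem x hx => exact Or.inr (hD.pos x hx)
  | zero => exact Or.inl rfl
  | add x y _ _ hx hy =>
    rcases hx with rfl | hx <;> rcases hy with rfl | hy
    · simp
    · simpa using Or.inr hy
    · simpa using Or.inr hx
    · right
      rw [map_add]
      positivity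
  | smul c x _ hx =>
    rcases hx with rfl | hx
    · simp
    · rcases eq_or_lt_of_le (zero_le (a := c)) with rfl | hc
      · simp
      · right
        rw [NNReal.smul_def, map_smul]
        exact mul_pos hc hx

theorem exists_decomp {a v : Fin n → ℝ} (ha : a ∈ D) (hv : v ∈ coneSpan (D : Set (Fin n → ℝ))) :
    ∃ k : ℝ, 0 ≤ k ∧ ∃ z ∈ coneSpan ((D : Set (Fin n → ℝ)) \ {a}), v = k • a + z := by
  have : (D : Set (Fin n → ℝ)) = insert a ((D : Set (Fin n → ℝ)) \ {a}) := by
    rw [Set.insert_sdiff_singleton, Set.insert_eq_of_mem ha]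
  rw [this] at hv
  obtain ⟨k, z, hz, rfl⟩ := Submodule.mem_span_insert.1 hv
  exact ⟨k, k.2, z, hz, rfl⟩

theorem mono (a : Fin n → ℝ) :
    coneSpan ((D : Set (Fin n → ℝ)) \ {a}) ≤ coneSpan (D : Set (Fin n → ℝ)) :=
  Submodule.span_mono Set.sdiff_subset

theorem nonneg (hD : IsSimpleSystem Φ lam D) {v : Fin n → ℝ}
    (hv : v ∈ coneSpan (D : Set (Fin n → ℝ))) : 0 ≤ lam v := by
  rcases hD.eq_zero_or_pos hv with rfl | h
  · simp
  · exact h.le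

theorem not_smul_mem (hD : IsSimpleSystem Φ lam D) {a z : Fin n → ℝ} (ha : a ∈ D)
    (hz : z ∈ coneSpan ((D : Set (Fin n → ℝ)) \ {a})) {c : ℝ} (hc : 0 < c) : c • a ≠ z := by
  intro h
  apply hD.crit a ha
  have := smul_mem_coneSpan hz (inv_nonneg.2 hc.le)
  rwa [← h, smul_smul, inv_mul_cancel₀ hc.ne', one_smul] at this

/-- No root has coefficients of both signs in the simple roots `a` and `b`. -/
theorem sub_notMem (hΦ : IsUnitRootSet Φ) (hD : IsSimpleSystem Φ lam D) {a b : Fin n → ℝ}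
    (ha : a ∈ D) (hb : b ∈ D) (hab : a ≠ b) {x y : ℝ} (hx : 0 < x) (hy : 0 < y) :
    y • b - x • a ∉ Φ := by
  -- If the vector were a positive root, comparing its expansion in the simple roots with its given
  -- form would put a positive multiple of `b` in the cone of the other simple roots.
  have key : ∀ a b : Fin n → ℝ, a ∈ D → b ∈ D → a ≠ b → ∀ x y : ℝ, 0 < x → 0 < y →
      y • b - x • a ∈ Φ → ¬ 0 < lam (y • b - x • a) := by
    intro a b ha hb hab x y hx hy hmem hpos
    obtain ⟨k, hk, z, hz, h⟩ := exists_decomp hb (hD.cone _ hmem hpos)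
    have h1 : (y - k) • b = x • a + z := by
      rw [sub_smul, sub_eq_iff_eq_add]
      rw [sub_eq_iff_eq_add] at h
      rw [h]
      abel
    have ha' : a ∈ coneSpan ((D : Set (Fin n → ℝ)) \ {b}) :=
      Submodule.subset_span ⟨ha, hab⟩
    have h2 := congrArg lam h1
    rw [map_add, map_smul, map_smul, smul_eq_mul, smul_eq_mul] at h2
    have h3 : 0 < (y - k) * lam b := by
      rw [h2]
      have := hD.nonneg (mono b hz)
      have := mul_pos hx (hD.pos a ha)
      linarith
    exact hD.not_smul_mem hb (add_mem (smul_mem_coneSpan ha' hx.le) hz)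
      (pos_of_mul_pos_left h3 (hD.pos b hb).le) h1
  intro hmem
  rcases lt_or_gt_of_ne (hD.ne_zero _ hmem) with h | h
  · have hneg := hΦ.neg_mem hmem
    rw [neg_sub] at hneg
    refine key b a hb ha hab.symm y x hy hx hneg ?_
    rw [← neg_sub, map_neg]
    linarith
  · exact key a b ha hb hab x y hx hy hmem h

/-- If the product were positive, the image of `b` under the reflection in `a` would be a root with
coefficients of both signs. -/
theorem dotProduct_nonpos (hΦ : IsUnitRootSet Φ) (hD : IsSimpleSystem Φ lam D) {a b : Fin n → ℝ}
    (ha : a ∈ D) (hb : b ∈ D) (hab : a ≠ b) : a ⬝ᵥ b ≤ 0 := by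
  by_contra! h
  have := hΦ.stable a (hD.sub a ha) b (hD.sub b hb)
  refine hD.sub_notMem hΦ ha hb hab (x := 2 * (a ⬝ᵥ b)) (y := 1) (by positivity) one_pos ?_
  rwa [one_smul]

/-- Vectors in an open half space with pairwise nonpositive products are independent. -/
theorem linearIndependent (hΦ : IsUnitRootSet Φ) (hD : IsSimpleSystem Φ lam D) :
    LinearIndependent ℝ (fun a : D => (a : Fin n → ℝ)) := by
  refine LinearMap.BilinForm.linearIndependent_of_pairwise_le_zero (dotProductBilin ℝ ℝ) ?_ lam _
    (fun a => hD.pos a a.2) ?_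
  · intro v hv
    simpa [LinearMap.BilinMap.toQuadraticMap_apply, dotProductBilin] using
      dotProduct_star_self_pos_iff.2 hv
  · intro a b hab
    exact hD.dotProduct_nonpos hΦ a.2 b.2 fun h => hab (Subtype.ext h)

/-- The angle between two simple roots. -/
theorem exists_angle (hΦ : IsUnitRootSet Φ) (hD : IsSimpleSystem Φ lam D) {a b : Fin n → ℝ}
    (ha : a ∈ D) (hb : b ∈ D) (hab : a ≠ b) :
    2 ≤ ⌈π / arccos (-(a ⬝ᵥ b))⌉₊ ∧
      a ⬝ᵥ b = -cos (π / ⌈π / arccos (-(a ⬝ᵥ b))⌉₊) := by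
  set θ := arccos (-(a ⬝ᵥ b)) with hθ
  have h0 := hD.dotProduct_nonpos hΦ ha hb hab
  have haa := hΦ.unit a (hD.sub a ha)
  have hbb := hΦ.unit b (hD.sub b hb)
  have h1 : -1 < a ⬝ᵥ b := by
    have h2 : 0 < (a + b) ⬝ᵥ (a + b) := by
      have : a + b ≠ 0 := by
        intro h
        have := congrArg lam h
        rw [map_add, map_zero] at this
        linarith [hD.pos a ha, hD.pos b hb]
      simpa using dotProduct_star_self_pos_iff.2 this
    rw [dotProduct_add, add_dotProduct, add_dotProduct, haa, hbb, dotProduct_comm b a] at h2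
    linarith
  have hcos : cos θ = -(a ⬝ᵥ b) := cos_arccos (by linarith) (by linarith)
  have hθ0 : 0 < θ := arccos_pos.2 (by linarith)
  have hθ1 : θ ≤ π / 2 := arccos_le_pi_div_two.2 (by linarith)
  have hpi := pi_pos
  have hsin : 0 < sin θ := sin_pos_of_pos_of_lt_pi hθ0 (by linarith)
  set m := ⌈π / θ⌉₊ with hm
  have hm2 : 2 ≤ m := by
    have : (2 : ℝ) ≤ π / θ := by rw [le_div_iff₀ hθ0]; linarith
    exact_mod_cast this.trans (Nat.le_ceil _)
  refine ⟨hm2, ?_⟩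
  have hab' : a ⬝ᵥ b = -cos θ := by rw [hcos, neg_neg]
  -- Alternating the two reflections produces a sequence of roots whose coefficients are ratios of
  -- sines of consecutive multiples of `θ`.
  have hseq : ∀ k : ℕ, (sin ((k + 1) * θ) / sin θ) • a + (sin (k * θ) / sin θ) • b ∈ Φ ∧
      (sin (k * θ) / sin θ) • a + (sin ((k + 1) * θ) / sin θ) • b ∈ Φ := by
    intro k
    induction k with
    | zero => simp [hsin.ne', hD.sub a ha, hD.sub b hb]
    | succ k ih =>
      have h := sin_add_two_mul θ k
      have e : ((k + 1 : ℕ) + 1 : ℝ) = k + 2 := by push_cast; ring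
      rw [e, ← h]
      push_cast
      constructor
      · convert hΦ.stable a (hD.sub a ha) _ ih.2 using 1
        simp only [reflVec, dotProduct_add, dotProduct_smul, haa, hab', smul_eq_mul]
        match_scalars <;> field_simp
        ring
      · convert hΦ.stable b (hD.sub b hb) _ ih.1 using 1
        simp only [reflVec, dotProduct_add, dotProduct_smul, hbb, dotProduct_comm b a, hab',
          smul_eq_mul]
        match_scalars <;> field_simp
        ring
  have hle : π ≤ m * θ := by
    rw [← div_le_iff₀ hθ0]
    exact Nat.le_ceil _
  have hlt : ((m - 1 : ℕ) : ℝ) * θ < π := by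
    rw [← lt_div_iff₀ hθ0]
    exact Nat.lt_ceil.1 (by omega)
  rcases eq_or_lt_of_le hle with heq | hgt
  · rw [hab', heq]
    congr 2
    field_simp
  -- If `m * θ` exceeds π, then the sines of `(m - 1) * θ` and `m * θ` have opposite signs, and step
  -- `m - 1` of the sequence is a root with mixed signs.
  · exfalso
    have h3 := (hseq (m - 1)).1
    have e : ((m - 1 : ℕ) : ℝ) + 1 = m := by
      rw [Nat.cast_sub (by omega)]
      push_cast
      ring
    rw [e] at h3
    have hpos : 0 < sin ((m - 1 : ℕ) * θ) := by
      apply sin_pos_of_pos_of_lt_pi _ hlt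
      have : (0 : ℝ) < (m - 1 : ℕ) := by exact_mod_cast (by omega : 0 < m - 1)
      positivity
    have hneg : sin (m * θ) < 0 := by
      have h4 : 0 < sin (m * θ - π) := by
        apply sin_pos_of_pos_of_lt_pi (by linarith)
        have : m * θ = (m - 1 : ℕ) * θ + θ := by rw [← e]; ring
        linarith
      rw [sin_sub_pi] at h4
      linarith
    refine hD.sub_notMem hΦ ha hb hab (x := -(sin (m * θ) / sin θ))
      (y := sin ((m - 1 : ℕ) * θ) / sin θ) ?_ (by positivity) ?_
    · rw [neg_pos]
      exact div_neg_of_neg_of_pos hneg hsin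
    · convert h3 using 1
      module

/-- Every root is obtained from simple roots by simple reflections. -/
theorem mem_of_stable (hΦ : IsUnitRootSet Φ) (hD : IsSimpleSystem Φ lam D)
    {S : Set (Fin n → ℝ)} (hS : ∀ a ∈ D, a ∈ S) (hS' : ∀ a ∈ D, ∀ v ∈ S, reflVec a v ∈ S)
    {b : Fin n → ℝ} (hb : b ∈ Φ) : b ∈ S := by
  have key : ∀ S : Set (Fin n → ℝ), (∀ a ∈ D, a ∈ S) → (∀ a ∈ D, ∀ v ∈ S, reflVec a v ∈ S) →
      ∀ b ∈ Φ, 0 < lam b → b ∈ S := by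
    intro S hS hS'
    by_contra! hcon
    obtain ⟨b₀, hb₀, hb₀', hb₀''⟩ := hcon
    -- Take a counterexample of least height, measured by `lam`; reflecting it in a simple root that
    -- has positive product with it lowers the height.
    obtain ⟨b, ⟨hb, hpos, hbS⟩, hmin⟩ := Set.exists_min_image {b | b ∈ Φ ∧ 0 < lam b ∧ b ∉ S} lam
      (hΦ.finite.subset fun b hb => hb.1) ⟨b₀, hb₀, hb₀', hb₀''⟩
    have hbb := hΦ.unit b hb
    obtain ⟨a, ha, hab⟩ : ∃ a ∈ D, 0 < a ⬝ᵥ b := by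
      by_contra! h
      have : ∀ v ∈ coneSpan (D : Set (Fin n → ℝ)), v ⬝ᵥ b ≤ 0 := by
        intro v hv
        induction hv using Submodule.span_induction with
        | mem x hx => exact h x hx
        | zero => simp
        | add x y _ _ hx hy => rw [add_dotProduct]; linarith
        | smul c x _ hx =>
          rw [NNReal.smul_def, smul_dotProduct]
          exact mul_nonpos_of_nonneg_of_nonpos c.2 hx
      have := this b (hD.cone b hb hpos)
      linarith
    have haa := hΦ.unit a (hD.sub a ha)
    have hne : b ≠ a := by
      rintro rfl
      exact hbS (hS b ha)
    have hc := hΦ.stable a (hD.sub a ha) b hb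
    have hbc : reflVec a (reflVec a b) = b := reflVec_reflVec haa b
    rcases lt_or_gt_of_ne (hD.ne_zero _ hc) with h | h
    -- If the reflected root is negative, then `b` and its opposite are both nonnegative
    -- combinations whose sum is a multiple of `a`. So `b` has no other component and equals `a`,
    -- contrary to `hne`.
    · have hc' := hΦ.neg_mem hc
      obtain ⟨k, hk, z, hz, h1⟩ := exists_decomp ha (hD.cone b hb hpos)
      obtain ⟨k', hk', z', hz', h2⟩ := exists_decomp ha (hD.cone _ hc' (by rw [map_neg]; linarith))
      have h3 : (2 * (a ⬝ᵥ b) - k - k') • a = z + z' := by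
        rw [reflVec, neg_sub, sub_eq_iff_eq_add] at h2
        rw [sub_smul, sub_smul, h2, h1]
        abel
      rcases lt_or_ge 0 (2 * (a ⬝ᵥ b) - k - k') with h4 | h4
      · exact hD.not_smul_mem ha (add_mem hz hz') h4 h3
      · have h5 := congrArg lam h3
        rw [map_smul, map_add, smul_eq_mul] at h5
        have h6 := mul_nonpos_of_nonpos_of_nonneg h4 (hD.pos a ha).le
        have h7 := hD.nonneg (mono a hz')
        rcases hD.eq_zero_or_pos (mono a hz) with rfl | h8
        · rw [add_zero] at h1
          rw [h1, smul_dotProduct, dotProduct_smul, haa] at hbb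
          have hk1 : k = 1 := by
            simp only [smul_eq_mul, mul_one] at hbb
            nlinarith
          exact hne (by rw [h1, hk1, one_smul])
        · linarith
    · have hlt : lam (reflVec a b) < lam b := by
        rw [reflVec, map_sub, map_smul, smul_eq_mul]
        have := mul_pos hab (hD.pos a ha)
        linarith
      have hcS : reflVec a b ∈ S := by
        by_contra hcS
        have := hmin _ ⟨hc, h, hcS⟩
        linarith
      apply hbS
      rw [← hbc]
      exact hS' a ha _ hcS
  -- Negative roots are reached by applying the positive case to the vectors lying in `S` together
  -- with their opposites.
  have key' : ∀ b ∈ Φ, 0 < lam b → b ∈ {v | v ∈ S ∧ -v ∈ S} := by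
    apply key
    · intro a ha
      refine ⟨hS a ha, ?_⟩
      rw [← reflVec_self (hΦ.unit a (hD.sub a ha))]
      exact hS' a ha a (hS a ha)
    · rintro a ha v ⟨h1, h2⟩
      refine ⟨hS' a ha v h1, ?_⟩
      rw [← reflVec_neg]
      exact hS' a ha _ h2
  rcases lt_or_gt_of_ne (hD.ne_zero _ hb) with h | h
  · have := (key' _ (hΦ.neg_mem hb) (by rw [map_neg]; linarith)).2
    rwa [neg_neg] at this
  · exact (key' b hb h).1

end IsSimpleSystem

/-- Existence of simple roots, with their Coxeter matrix. -/
theorem exists_simple_roots (hΦ : IsUnitRootSet Φ) :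
    ∃ (r : ℕ) (α : Fin r → Fin n → ℝ) (M : CoxeterMatrix (Fin r)), LinearIndependent ℝ α ∧
      (∀ i, α i ∈ Φ) ∧ (∀ i j, α i ⬝ᵥ α j = -cos (π / M i j)) ∧ (∀ i j, M i j ≠ 0) ∧
      (∀ S : Set (Fin n → ℝ), (∀ i, α i ∈ S) → (∀ i, ∀ v ∈ S, reflVec (α i) v ∈ S) → Φ ⊆ S) := by
  obtain ⟨lam, D, hD⟩ := exists_isSimpleSystem hΦ
  let e : Fin D.card ≃ D := D.equivFin.symm
  let α : Fin D.card → Fin n → ℝ := fun i => e i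
  have hne : ∀ i j, i ≠ j → α i ≠ α j := fun i j hij h => hij (e.injective (Subtype.ext h))
  have hang : ∀ i j, i ≠ j → _ := fun i j hij =>
    hD.exists_angle hΦ (e i).2 (e j).2 (hne i j hij)
  have hone : ∀ i, α i ⬝ᵥ α i = 1 := fun i => hΦ.unit _ (hD.sub _ (e i).2)
  -- The formula for the labels is also correct on the diagonal, as arccos(-1) = π.
  have hdiag : ∀ i, ⌈π / arccos (-(α i ⬝ᵥ α i))⌉₊ = 1 := by
    intro i
    rw [hone, arccos_neg, arccos_one, sub_zero, div_self pi_ne_zero, Nat.ceil_one]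
  let M : CoxeterMatrix (Fin D.card) :=
    { M := Matrix.of fun i j => ⌈π / arccos (-(α i ⬝ᵥ α j))⌉₊
      isSymm := by
        ext i j
        simp [dotProduct_comm]
      diagonal := hdiag
      off_diagonal := fun i j hij h => by
        have := (hang i j hij).1
        change 2 ≤ ⌈π / arccos (-(α i ⬝ᵥ α j))⌉₊ at this
        change ⌈π / arccos (-(α i ⬝ᵥ α j))⌉₊ = 1 at h
        omega }
  have hM : ∀ i j, M i j = ⌈π / arccos (-(α i ⬝ᵥ α j))⌉₊ := fun i j => rfl
  refine ⟨D.card, α, M, (hD.linearIndependent hΦ).comp e e.injective, fun i => hD.sub _ (e i).2,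
    ?_, ?_, ?_⟩
  · intro i j
    by_cases hij : i = j
    · subst hij
      rw [M.diagonal, hone]
      simp
    · rw [hM]
      exact (hang i j hij).2
  · intro i j
    by_cases hij : i = j
    · subst hij
      rw [M.diagonal]
      exact one_ne_zero
    · rw [hM]
      have := (hang i j hij).1
      change 2 ≤ ⌈π / arccos (-(α i ⬝ᵥ α j))⌉₊ at this
      omega
  · intro S h1 h2 b hb
    have hsurj : ∀ a ∈ D, ∃ i, α i = a := fun a ha => ⟨e.symm ⟨a, ha⟩, by simp [α]⟩
    refine hD.mem_of_stable hΦ ?_ ?_ hb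
    · intro a ha
      obtain ⟨i, rfl⟩ := hsurj a ha
      exact h1 i
    · intro a ha
      obtain ⟨i, rfl⟩ := hsurj a ha
      exact h2 i

end SimpleSystem

/-! ### Matrices of reflections -/

section ReflectionMatrices

open Matrix

variable {K : Type*} [Field K] {n : ℕ}

theorem one_add_vecMulVec_mul (u v : Fin n → K) (x y : K) :
    ((1 : Matrix (Fin n) (Fin n) K) + x • vecMulVec u v) * (1 + y • vecMulVec u v) =
      1 + (x + y + x * y * (v ⬝ᵥ u)) • vecMulVec u v := by
  rw [add_mul, mul_add, mul_add, smul_mul_smul_comm, vecMulVec_mul_vecMulVec, vecMulVec_smul]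
  simp only [one_mul, mul_one]
  module

/-- A reflection is of the form `1 + u vᵀ`. -/
theorem IsReflection.exists_eq [CharZero K] {g : GL (Fin n) K} (hg : IsReflection g) :
    ∃ u v : Fin n → K, (g : Matrix (Fin n) (Fin n) K) = 1 + vecMulVec u v ∧ v ⬝ᵥ u ≠ 0 := by
  obtain ⟨hfin, hker⟩ := hg
  set T := toLin' ((g : Matrix (Fin n) (Fin n) K) - 1) with hT
  have h1 := T.finrank_range_add_finrank_ker
  rw [Module.finrank_fin_fun] at h1
  have h2 : Module.finrank K (LinearMap.range T) = 1 := by omega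
  obtain ⟨⟨u, hu⟩, hne, hspan⟩ := finrank_eq_one_iff'.1 h2
  have hne' : u ≠ 0 := fun h => hne (Subtype.ext h)
  have hv : ∀ j, ∃ c : K, c • u = T (Pi.single j 1) := by
    intro j
    obtain ⟨c, hc⟩ := hspan ⟨T (Pi.single j 1), LinearMap.mem_range_self _ _⟩
    exact ⟨c, congrArg Subtype.val hc⟩
  choose v hv using hv
  have hg1 : (g : Matrix (Fin n) (Fin n) K) = 1 + vecMulVec u v := by
    rw [← sub_eq_iff_eq_add']
    ext i j
    have := congrFun (hv j) i
    rw [hT, toLin'_apply, mulVec_single_one] at this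
    rw [vecMulVec_apply, mul_comm]
    exact this.symm
  refine ⟨u, v, hg1, ?_⟩
  intro h0
  obtain ⟨k, hk, hk1⟩ := isOfFinOrder_iff_pow_eq_one.1 hfin
  -- If `v ⬝ᵥ u` vanished, `g` would be a transvection, of infinite order in characteristic zero.
  have hpow : ∀ m : ℕ, (g : Matrix (Fin n) (Fin n) K) ^ m = 1 + (m : K) • vecMulVec u v := by
    intro m
    induction m with
    | zero => simp
    | succ m ih =>
      rw [pow_succ, ih, hg1]
      have := one_add_vecMulVec_mul u v (m : K) 1
      rw [one_smul] at this
      rw [this, h0]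
      simp
  have h3 := hpow k
  rw [← Units.val_pow_eq_pow_val, hk1, Units.val_one, left_eq_add, smul_eq_zero] at h3
  have hk0 : (k : K) ≠ 0 := by exact_mod_cast hk.ne'
  have h4 := h3.resolve_left hk0
  rw [hT, hg1, h4, add_zero, sub_self, map_zero] at h2
  rw [LinearMap.range_zero, finrank_bot] at h2
  omega

theorem isReflection_of_eq {g : GL (Fin n) K} {u v : Fin n → K}
    (h : (g : Matrix (Fin n) (Fin n) K) = 1 + vecMulVec u v) (hu : u ≠ 0) (hv : v ≠ 0)
    (hfin : IsOfFinOrder g) : IsReflection g := by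
  refine ⟨hfin, ?_⟩
  rw [h, add_sub_cancel_left]
  set T := toLin' (vecMulVec u v) with hT
  have hTx : ∀ x, T x = (v ⬝ᵥ x) • u := by
    intro x
    rw [hT, toLin'_apply, vecMulVec_mulVec]
    simp
  obtain ⟨j, hj⟩ := Function.ne_iff.1 hv
  have hrange : LinearMap.range T = Submodule.span K {u} := by
    apply le_antisymm
    · rintro _ ⟨x, rfl⟩
      rw [hTx]
      exact Submodule.smul_mem _ _ (Submodule.mem_span_singleton_self u)
    · rw [Submodule.span_singleton_le_iff_mem]
      refine ⟨(v j)⁻¹ • Pi.single j 1, ?_⟩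
      have hj' : v j ≠ 0 := hj
      rw [hTx, dotProduct_smul, dotProduct_single_one, smul_eq_mul, inv_mul_cancel₀ hj', one_smul]
  have h1 := T.finrank_range_add_finrank_ker
  rw [Module.finrank_fin_fun, hrange, finrank_span_singleton hu] at h1
  omega

theorem det_one_add_vecMulVec (u v : Fin n → K) :
    (1 + vecMulVec u v : Matrix (Fin n) (Fin n) K).det = 1 + v ⬝ᵥ u := by
  rw [vecMulVec_eq Unit, det_one_add_replicateCol_mul_replicateRow]

/-- A reflection of order two has determinant `-1`. -/
theorem IsReflection.det_eq [CharZero K] {g : GL (Fin n) K} (hg : IsReflection g) (h : g * g = 1) :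
    (g : Matrix (Fin n) (Fin n) K).det = -1 := by
  obtain ⟨u, v, hg1, h0⟩ := hg.exists_eq
  rw [hg1, det_one_add_vecMulVec]
  have h1 : (g : Matrix (Fin n) (Fin n) K) * g = 1 := by rw [← Units.val_mul, h, Units.val_one]
  have h2 := congrArg Matrix.det h1
  rw [hg1, det_mul, det_one_add_vecMulVec, det_one] at h2
  have h3 : (v ⬝ᵥ u) * (v ⬝ᵥ u + 2) = 0 := by linear_combination h2
  linear_combination (mul_eq_zero.1 h3).resolve_left h0

/-- A reflection of determinant `-1` is an involution. -/
theorem IsReflection.mul_self_of_det [CharZero K] {g : GL (Fin n) K} (hg : IsReflection g)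
    (h : (g : Matrix (Fin n) (Fin n) K).det = -1) : g * g = 1 := by
  obtain ⟨u, v, hg1, h0⟩ := hg.exists_eq
  rw [hg1, det_one_add_vecMulVec] at h
  apply Units.ext
  rw [Units.val_mul, hg1, Units.val_one]
  have := one_add_vecMulVec_mul u v (1 : K) 1
  rw [one_smul] at this
  rw [this, show v ⬝ᵥ u = -2 by linear_combination h]
  norm_num

theorem IsReflection.ne_one [CharZero K] {g : GL (Fin n) K} (hg : IsReflection g) : g ≠ 1 := by
  rintro rfl
  obtain ⟨u, v, hg1, h0⟩ := hg.exists_eq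
  have h1 := congrArg Matrix.det hg1
  rw [det_one_add_vecMulVec, Units.val_one, det_one] at h1
  exact h0 (by linear_combination -h1)

theorem IsReflection.conj {g : GL (Fin n) K} (hg : IsReflection g) (c : GL (Fin n) K) :
    IsReflection (c * g * c⁻¹) := by
  refine ⟨?_, ?_⟩
  · have := (MulAut.conj c).toMonoidHom.isOfFinOrder hg.1
    simpa using this
  · have h2 := hg.2
    have : toLin' (((c * g * c⁻¹ : GL (Fin n) K) : Matrix (Fin n) (Fin n) K) - 1) =
        toLin' (c : Matrix (Fin n) (Fin n) K) ∘ₗ toLin' ((g : Matrix (Fin n) (Fin n) K) - 1) ∘ₗ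
          toLin' ((c⁻¹ : GL (Fin n) K) : Matrix (Fin n) (Fin n) K) := by
      rw [← toLin'_mul, ← toLin'_mul]
      congr 1
      rw [Units.val_mul, Units.val_mul, sub_mul, mul_sub, one_mul, Units.mul_inv, mul_assoc]
    rw [this]
    have e : LinearMap.ker (toLin' (c : Matrix (Fin n) (Fin n) K) ∘ₗ
        toLin' ((g : Matrix (Fin n) (Fin n) K) - 1) ∘ₗ
          toLin' ((c⁻¹ : GL (Fin n) K) : Matrix (Fin n) (Fin n) K)) =
        (LinearMap.ker (toLin' ((g : Matrix (Fin n) (Fin n) K) - 1))).map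
          (toLin' (c : Matrix (Fin n) (Fin n) K)) := by
      ext x
      rw [LinearMap.mem_ker, Submodule.mem_map, LinearMap.comp_apply, LinearMap.comp_apply]
      constructor
      · intro h
        refine ⟨toLin' ((c⁻¹ : GL (Fin n) K) : Matrix (Fin n) (Fin n) K) x, ?_, ?_⟩
        · rw [LinearMap.mem_ker]
          have := congrArg (toLin' ((c⁻¹ : GL (Fin n) K) : Matrix (Fin n) (Fin n) K)) h
          rwa [map_zero, ← toLin'_mul_apply, Units.inv_mul, toLin'_one, LinearMap.id_apply] at this
        · rw [← toLin'_mul_apply, Units.mul_inv, toLin'_one, LinearMap.id_apply]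
      · rintro ⟨y, hy, rfl⟩
        rw [← toLin'_mul_apply _ _ y, Units.inv_mul, toLin'_one, LinearMap.id_apply,
          LinearMap.mem_ker.1 hy, map_zero]
    have hinj : Function.Injective (toLin' (c : Matrix (Fin n) (Fin n) K)) := by
      intro x y hxy
      have := congrArg (toLin' ((c⁻¹ : GL (Fin n) K) : Matrix (Fin n) (Fin n) K)) hxy
      rwa [← toLin'_mul_apply, ← toLin'_mul_apply, Units.inv_mul, toLin'_one, LinearMap.id_apply,
        LinearMap.id_apply] at this
    rw [e, ← (Submodule.equivMapOfInjective _ hinj _).finrank_eq]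
    exact h2

/-- The matrix of the orthogonal reflection with normal vector `a`, for `a ⬝ᵥ a = 1`. -/
def reflMat (a : Fin n → K) : Matrix (Fin n) (Fin n) K := 1 + (-2 : K) • vecMulVec a a

theorem reflMat_mulVec (a v : Fin n → ℝ) : reflMat a *ᵥ v = reflVec a v := by
  rw [reflMat, add_mulVec, one_mulVec, smul_mulVec, vecMulVec_mulVec, reflVec]
  ext i
  simp
  ring

theorem reflMat_transpose (a : Fin n → K) : (reflMat a)ᵀ = reflMat a := by
  rw [reflMat, transpose_add, transpose_one, transpose_smul, transpose_vecMulVec]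

theorem reflMat_mul_self {a : Fin n → K} (ha : a ⬝ᵥ a = 1) : reflMat a * reflMat a = 1 := by
  rw [reflMat, one_add_vecMulVec_mul, ha]
  norm_num

theorem reflMat_neg (a : Fin n → K) : reflMat (-a) = reflMat a := by
  simp [reflMat, neg_vecMulVec, vecMulVec_neg]

/-- The reflection with normal vector `a` as an element of the general linear group. -/
def reflGL (a : Fin n → K) (ha : a ⬝ᵥ a = 1) : GL (Fin n) K :=
  ⟨reflMat a, reflMat a, reflMat_mul_self ha, reflMat_mul_self ha⟩

theorem reflGL_val (a : Fin n → K) (ha : a ⬝ᵥ a = 1) :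
    (reflGL a ha : Matrix (Fin n) (Fin n) K) = reflMat a := rfl

theorem reflMat_conj (c : Matrix (Fin n) (Fin n) K) (hc : cᵀ * c = 1) (a : Fin n → K) :
    c * reflMat a * cᵀ = reflMat (c *ᵥ a) := by
  have hc' : c * cᵀ = 1 := mul_eq_one_comm.1 hc
  rw [reflMat, reflMat, mul_add, add_mul, mul_one, hc', mul_smul_comm, smul_mul_assoc,
    mul_vecMulVec, vecMulVec_mul, vecMul_transpose]

theorem isReflection_of_val_eq_reflMat [CharZero K] {a : Fin n → K} (ha : a ⬝ᵥ a = 1)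
    {g : GL (Fin n) K} (hg : (g : Matrix (Fin n) (Fin n) K) = reflMat a) : IsReflection g := by
  have ha0 : a ≠ 0 := by
    rintro rfl
    simp at ha
  refine isReflection_of_eq (u := (-2 : K) • a) (v := a) ?_ ?_ ha0 ?_
  · rw [hg, reflMat, smul_vecMulVec]
  · exact smul_ne_zero (by norm_num) ha0
  · rw [isOfFinOrder_iff_pow_eq_one]
    refine ⟨2, by norm_num, Units.ext ?_⟩
    rw [Units.val_pow_eq_pow_val, hg, pow_two, reflMat_mul_self ha, Units.val_one]

/-- A reflection in the real orthogonal group is an orthogonal reflection. -/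
theorem IsReflection.exists_reflMat {g : GL (Fin n) ℝ} (hg : IsReflection g)
    (ho : (g : Matrix (Fin n) (Fin n) ℝ)ᵀ * g = 1) :
    ∃ a : Fin n → ℝ, a ⬝ᵥ a = 1 ∧ (g : Matrix (Fin n) (Fin n) ℝ) = reflMat a := by
  obtain ⟨u, v, hg1, h0⟩ := hg.exists_eq
  rw [hg1, transpose_add, transpose_one, transpose_vecMulVec, add_mul, mul_add, mul_add,
    vecMulVec_mul_vecMulVec] at ho
  simp only [one_mul, mul_one, vecMulVec_smul'] at ho
  have hv0 : v ≠ 0 := by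
    rintro rfl
    simp at h0
  have hu0 : u ≠ 0 := by
    rintro rfl
    simp at h0
  have hvv : 0 < v ⬝ᵥ v := by simpa using dotProduct_star_self_pos_iff.2 hv0
  -- Evaluating the orthogonality relation on `v` shows that `u` is a multiple of `v`; the relation
  -- then fixes the factor.
  have h1 := congrArg (fun m => m *ᵥ v) ho
  simp only [add_mulVec, one_mulVec, vecMulVec_mulVec, smul_mulVec, smul_vecMulVec] at h1
  have h2 : (v ⬝ᵥ v) • u + ((u ⬝ᵥ v) + (u ⬝ᵥ u) * (v ⬝ᵥ v)) • v = 0 := by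
    ext i
    have := congrFun h1 i
    simp at this ⊢
    linear_combination this
  obtain ⟨k, hk⟩ : ∃ k : ℝ, u = k • v := by
    refine ⟨-((u ⬝ᵥ v) + (u ⬝ᵥ u) * (v ⬝ᵥ v)) / (v ⬝ᵥ v), ?_⟩
    rw [add_eq_zero_iff_eq_neg] at h2
    rw [div_eq_inv_mul, mul_smul, neg_smul, ← h2, smul_smul, inv_mul_cancel₀ hvv.ne', one_smul]
  have hk0 : k ≠ 0 := by
    rintro rfl
    exact hu0 (by rw [hk, zero_smul])
  have h3 : k * (v ⬝ᵥ v) = -2 := by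
    rw [hk] at h2
    simp only [smul_dotProduct, dotProduct_smul, smul_eq_mul, smul_smul, ← add_smul] at h2
    have h4 := (smul_eq_zero.1 h2).resolve_right hv0
    have h5 : (k * (v ⬝ᵥ v)) * (k * (v ⬝ᵥ v) + 2) = 0 := by linear_combination h4
    linarith [(mul_eq_zero.1 h5).resolve_left (mul_ne_zero hk0 hvv.ne')]
  refine ⟨(√(v ⬝ᵥ v))⁻¹ • v, ?_, ?_⟩
  · simp only [smul_dotProduct, dotProduct_smul, smul_eq_mul]
    rw [← mul_assoc, ← mul_inv, Real.mul_self_sqrt hvv.le, inv_mul_cancel₀ hvv.ne']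
  · rw [hg1, reflMat, hk]
    simp only [smul_vecMulVec, vecMulVec_smul, smul_smul]
    rw [← mul_inv, Real.mul_self_sqrt hvv.le, ← h3, mul_inv_cancel_right₀ hvv.ne']

end ReflectionMatrices

/-! ### Groups generated by orthogonal reflections -/

section RootGroups

open Matrix Real

/-- The group generated by the reflections with normal vector in `S`. -/
def rootGroup {K : Type*} [Field K] {n : ℕ} (S : Set (Fin n → K)) : Subgroup (GL (Fin n) K) :=
  Subgroup.closure {g | ∃ a ∈ S, (g : Matrix (Fin n) (Fin n) K) = reflMat a}

variable {n r : ℕ}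

/-- Supplies the form positive on the simple roots that the faithfulness argument requires. -/
theorem exists_dual_apply_eq_one {V ι : Type*} [AddCommGroup V] [Module ℝ V] {α : ι → V}
    (h : LinearIndependent ℝ α) : ∃ f : Module.Dual ℝ V, ∀ i, f (α i) = 1 := by
  obtain ⟨f, hf⟩ := LinearMap.exists_extend ((Module.Basis.span h).constr ℝ fun _ => (1 : ℝ))
  refine ⟨f, fun i => ?_⟩
  have := LinearMap.congr_fun hf (Module.Basis.span h i)
  rw [Module.Basis.constr_basis, LinearMap.comp_apply, Submodule.subtype_apply,
    Module.Basis.span_apply] at this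
  exact this

/-- The linear form `v ↦ 2 (a, v)`. -/
def rootDual (a : Fin n → ℝ) : Module.Dual ℝ (Fin n → ℝ) where
  toFun v := 2 * (a ⬝ᵥ v)
  map_add' v w := by rw [dotProduct_add, mul_add]
  map_smul' c v := by
    rw [dotProduct_smul, RingHom.id_apply, smul_eq_mul, smul_eq_mul]
    ring

theorem rootDual_apply (a v : Fin n → ℝ) : rootDual a v = 2 * (a ⬝ᵥ v) := rfl

theorem toLin'_reflMat (a : Fin n → ℝ) :
    toLin' (reflMat a) = Module.preReflection a (rootDual a) := by
  refine LinearMap.ext fun v => ?_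
  simp only [toLin'_apply, reflMat_mulVec, reflVec, Module.preReflection_apply,
    rootDual_apply]

/-- `α` is a family of simple roots of type `M`. -/
structure IsSimpleRoots (M : CoxeterMatrix (Fin r)) (α : Fin r → Fin n → ℝ) : Prop where
  linearIndependent : LinearIndependent ℝ α
  dotProduct_eq : ∀ i j, α i ⬝ᵥ α j = -cos (π / M i j)
  ne_zero : ∀ i j, M i j ≠ 0

variable {M : CoxeterMatrix (Fin r)} {α : Fin r → Fin n → ℝ}

theorem IsSimpleRoots.unit (h : IsSimpleRoots M α) (i : Fin r) : α i ⬝ᵥ α i = 1 := by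
  rw [h.dotProduct_eq, M.diagonal]
  simp

theorem IsSimpleRoots.reflMat_pow (h : IsSimpleRoots M α) (i j : Fin r) :
    (reflMat (α i) * reflMat (α j)) ^ M i j = 1 := by
  rcases eq_or_ne i j with rfl | hij
  · rw [M.diagonal, pow_one, reflMat_mul_self (h.unit i)]
  · have h2 : 2 ≤ M i j := by
      have := h.ne_zero i j
      have := M.off_diagonal i j hij
      omega
    apply (toLin' (R := ℝ)).injective
    have hpow : toLin' ((reflMat (α i) * reflMat (α j)) ^ M i j) =
        toLin' (reflMat (α i) * reflMat (α j)) ^ M i j := map_pow (toLinAlgEquiv' (R := ℝ)) _ _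
    rw [hpow, toLin'_mul, toLin'_reflMat, toLin'_reflMat, toLin'_one]
    refine preReflection_mul_pow_eq_one h2 ?_ ?_ ?_ ?_
    · rw [rootDual_apply, h.unit, mul_one]
    · rw [rootDual_apply, h.unit, mul_one]
    · rw [rootDual_apply, h.dotProduct_eq]
      ring
    · rw [rootDual_apply, h.dotProduct_eq, M.symmetric]
      ring

/-- The group generated by the reflections in simple roots of type `M` is a Coxeter group. -/
theorem IsSimpleRoots.exists_coxeterSystem (h : IsSimpleRoots M α) :
    ∃ cs : CoxeterSystem M (rootGroup (Set.range α)),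
      ∀ i, (((cs.simple i : rootGroup (Set.range α)) : GL (Fin n) ℝ) :
        Matrix (Fin n) (Fin n) ℝ) = reflMat (α i) := by
  let s : Fin r → rootGroup (Set.range α) := fun i =>
    ⟨reflGL (α i) (h.unit i), Subgroup.subset_closure ⟨α i, ⟨i, rfl⟩, rfl⟩⟩
  have hs : ∀ i, ((s i : GL (Fin n) ℝ) : Matrix (Fin n) (Fin n) ℝ) = reflMat (α i) := fun i => rfl
  have hlift : M.IsLiftable s := by
    intro i j
    apply Subtype.ext
    apply Units.ext
    exact h.reflMat_pow i j
  let cs := M.toCoxeterSystem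
  let f : M.Group →* rootGroup (Set.range α) := cs.lift ⟨s, hlift⟩
  have hf : ∀ i, f (cs.simple i) = s i := fun i => cs.lift_apply_simple hlift i
  have hsurj : Function.Surjective f := by
    rintro ⟨g, hg⟩
    have hle : rootGroup (Set.range α) ≤ f.range.map (rootGroup (Set.range α)).subtype := by
      refine (Subgroup.closure_le _).2 ?_
      rintro g ⟨_, ⟨i, rfl⟩, hgi⟩
      refine ⟨s i, ⟨cs.simple i, hf i⟩, Units.ext ?_⟩
      rw [Subgroup.subtype_apply, hs, hgi]
    obtain ⟨⟨_, hg'⟩, ⟨w, hw⟩, rfl⟩ := hle hg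
    exact ⟨w, hw⟩
  -- The abstract Coxeter group acts through its image. This action satisfies the hypotheses of the
  -- positivity argument, so it is faithful and `f` is injective.
  let ρ : M.Group →* Module.End ℝ (Fin n → ℝ) :=
    ((toLinAlgEquiv' (R := ℝ) : Matrix (Fin n) (Fin n) ℝ ≃ₐ[ℝ] _) :
      Matrix (Fin n) (Fin n) ℝ →* Module.End ℝ (Fin n → ℝ)).comp
      ((Units.coeHom _).comp ((rootGroup (Set.range α)).subtype.comp f))
  obtain ⟨lam, hlam⟩ := exists_dual_apply_eq_one h.linearIndependent
  have hρ : Function.Injective ρ := by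
    refine injective_of_rootCone cs ρ α (fun i => rootDual (α i)) ?_ h.ne_zero ?_ lam ?_
    · intro i v
      change toLin' (((f (cs.simple i) : rootGroup (Set.range α)) : GL (Fin n) ℝ) :
        Matrix (Fin n) (Fin n) ℝ) v = _
      rw [hf, hs, toLin'_reflMat, Module.preReflection_apply]
    · intro i j
      rw [rootDual_apply, h.dotProduct_eq]
      ring
    · intro i
      rw [hlam]
      norm_num
  have hinj : Function.Injective f := by
    intro x y hxy
    apply hρ
    simp only [ρ, MonoidHom.comp_apply, hxy]
  refine ⟨cs.map (MulEquiv.ofBijective f ⟨hinj, hsurj⟩), fun i => ?_⟩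
  rw [CoxeterSystem.map_simple]
  exact congrArg (fun x : rootGroup (Set.range α) =>
    ((x : GL (Fin n) ℝ) : Matrix (Fin n) (Fin n) ℝ)) (hf i)

theorem IsSimpleRoots.hasCoxeterType (h : IsSimpleRoots M α) :
    HasCoxeterType (rootGroup (Set.range α)) M := by
  obtain ⟨cs, hcs⟩ := h.exists_coxeterSystem
  exact ⟨cs, fun i => isReflection_of_val_eq_reflMat (h.unit i) (hcs i)⟩

theorem IsSimpleRoots.rank_le (h : IsSimpleRoots M α) : r ≤ n := by
  simpa using h.linearIndependent.fintype_card_le_finrank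

/-- Orthogonal transformations conjugate root groups. -/
theorem map_conj_rootGroup {K : Type*} [Field K] (c : GL (Fin n) K)
    (hc : (c : Matrix (Fin n) (Fin n) K)ᵀ * c = 1) (S : Set (Fin n → K)) :
    (rootGroup S).map (MulAut.conj c).toMonoidHom =
      rootGroup ((fun a => (c : Matrix (Fin n) (Fin n) K) *ᵥ a) '' S) := by
  rw [rootGroup, MonoidHom.map_closure, rootGroup]
  have hinv : ((c⁻¹ : GL (Fin n) K) : Matrix (Fin n) (Fin n) K) =
      (c : Matrix (Fin n) (Fin n) K)ᵀ := by
    rw [← mul_one ((c : Matrix (Fin n) (Fin n) K)ᵀ), ← Units.val_one, ← mul_inv_cancel c,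
      Units.val_mul, ← mul_assoc, hc, one_mul]
  congr 1
  ext g
  constructor
  · rintro ⟨g, ⟨a, ha, hg⟩, rfl⟩
    refine ⟨_, ⟨a, ha, rfl⟩, ?_⟩
    rw [← reflMat_conj _ hc, ← hg, ← hinv]
    rfl
  · rintro ⟨_, ⟨a, ha, rfl⟩, hg⟩
    refine ⟨c⁻¹ * g * c, ⟨a, ha, ?_⟩, ?_⟩
    · have hc' : (c : Matrix (Fin n) (Fin n) K)ᵀ * c = 1 := hc
      rw [Units.val_mul, Units.val_mul, hinv, hg]
      dsimp only
      rw [← reflMat_conj _ hc, ← mul_assoc, ← mul_assoc, hc, one_mul, mul_assoc, hc, mul_one]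
    · simp [mul_assoc]

/-- A finite orthogonal group generated by reflections has a system of simple roots. -/
theorem exists_isSimpleRoots (Γ : Subgroup (GL (Fin n) ℝ)) [Finite Γ]
    (ho : ∀ g ∈ Γ, (g : Matrix (Fin n) (Fin n) ℝ)ᵀ * g = 1) (hΓ : GeneratedByReflections Γ) :
    ∃ (r : ℕ) (M : CoxeterMatrix (Fin r)) (α : Fin r → Fin n → ℝ), IsSimpleRoots M α ∧
      rootGroup (Set.range α) = Γ := by
  -- The roots are the unit normals of all reflections of `Γ`. Each reflection has exactly two, so
  -- finiteness of `Γ` makes this set finite.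
  let Φ : Set (Fin n → ℝ) :=
    {a | a ⬝ᵥ a = 1 ∧ ∃ g ∈ Γ, (g : Matrix (Fin n) (Fin n) ℝ) = reflMat a}
  have hsq : ∀ a b : Fin n → ℝ, a ⬝ᵥ a = 1 → b ⬝ᵥ b = 1 → reflMat a = reflMat b →
      b = a ∨ b = -a := by
    intro a b ha hb hab
    have h1 : reflVec a b = reflVec b b := by rw [← reflMat_mulVec, hab, reflMat_mulVec]
    rw [reflVec_self hb, reflVec] at h1
    have h2 : b = (a ⬝ᵥ b) • a := by
      ext i
      have := congrFun h1 i
      simp at this ⊢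
      linarith
    have h3 : (a ⬝ᵥ b) * (a ⬝ᵥ b) = 1 := by
      have h4 := hb
      rw [h2] at h4
      simp only [smul_dotProduct, dotProduct_smul, smul_eq_mul, ha, mul_one] at h4
      exact h4
    rcases mul_self_eq_one_iff.1 h3 with h | h
    · left
      rw [h2, h, one_smul]
    · right
      rw [h2, h, neg_smul, one_smul]
  have hmem : ∀ a, ∀ b ∈ Φ, (∃ g ∈ Γ, (g : Matrix (Fin n) (Fin n) ℝ) = reflMat a) →
      a ⬝ᵥ a = 1 → reflVec a b ∈ Φ := by
    rintro a b ⟨hb, h, hh, hhb⟩ ⟨g, hg, hga⟩ ha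
    have hgg := reflMat_mul_self ha
    refine ⟨?_, g * h * g, Γ.mul_mem (Γ.mul_mem hg hh) hg, ?_⟩
    · rw [← reflMat_mulVec, dotProduct_mulVec, ← mulVec_transpose, mulVec_mulVec,
        reflMat_transpose, hgg, one_mulVec, hb]
    · rw [← reflMat_mulVec, ← reflMat_conj _ (by rw [reflMat_transpose, hgg]), Units.val_mul,
        Units.val_mul, hga, hhb, reflMat_transpose]
  have hΦ : IsUnitRootSet Φ := by
    refine ⟨?_, fun a ha => ha.1, fun a ha b hb => hmem a b hb ha.2 ha.1⟩
    have hfin : (Set.range fun g : Γ => ((g : GL (Fin n) ℝ) : Matrix (Fin n) (Fin n) ℝ)).Finite :=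
      Set.finite_range _
    refine Set.Finite.of_finite_fibers (f := reflMat) (hfin.subset ?_) ?_
    · rintro _ ⟨a, ⟨-, g, hg, hga⟩, rfl⟩
      exact ⟨⟨g, hg⟩, hga⟩
    · rintro _ ⟨a, ha, rfl⟩
      refine (Set.toFinite {a, -a}).subset ?_
      rintro b ⟨hb, hba⟩
      exact hsq a b ha.1 hb.1 hba.symm
  obtain ⟨r, α, M, hα, hαΦ, hgram, hM, hgen⟩ := exists_simple_roots hΦ
  refine ⟨r, M, α, ⟨hα, hgram, hM⟩, le_antisymm ?_ ?_⟩
  · refine (Subgroup.closure_le _).2 ?_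
    rintro g ⟨_, ⟨i, rfl⟩, hgi⟩
    obtain ⟨-, h, hh, hhi⟩ := hαΦ i
    rwa [show g = h from Units.ext (hgi.trans hhi.symm)]
  -- The unit vectors whose reflection is generated by the simple reflections form a stable set
  -- containing the simple roots, hence contain all roots.
  · have hsub : Φ ⊆ {v | v ⬝ᵥ v = 1 ∧
        ∃ g ∈ rootGroup (Set.range α), (g : Matrix (Fin n) (Fin n) ℝ) = reflMat v} := by
      have hin : ∀ i, reflGL (α i) (hαΦ i).1 ∈ rootGroup (Set.range α) := fun i =>
        Subgroup.subset_closure ⟨α i, ⟨i, rfl⟩, rfl⟩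
      apply hgen
      · exact fun i => ⟨(hαΦ i).1, reflGL (α i) (hαΦ i).1, hin i, rfl⟩
      · rintro i v ⟨hv, h, hh, hhv⟩
        have hgg := reflMat_mul_self (hαΦ i).1
        refine ⟨?_, reflGL (α i) (hαΦ i).1 * h * reflGL (α i) (hαΦ i).1,
          Subgroup.mul_mem _ (Subgroup.mul_mem _ (hin i) hh) (hin i), ?_⟩
        · rw [← reflMat_mulVec, dotProduct_mulVec, ← mulVec_transpose, mulVec_mulVec,
            reflMat_transpose, hgg, one_mulVec, hv]
        · rw [← reflMat_mulVec, ← reflMat_conj _ (by rw [reflMat_transpose, hgg]), Units.val_mul,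
            Units.val_mul, reflGL_val, hhv, reflMat_transpose]
    rw [← hΓ]
    refine (Subgroup.closure_le _).2 ?_
    rintro g ⟨hg, hrefl⟩
    obtain ⟨a, ha, hga⟩ := hrefl.exists_reflMat (ho g hg)
    obtain ⟨-, h, hh, hha⟩ := hsub ⟨ha, g, hg, hga⟩
    rwa [show g = h from Units.ext (hga.trans hha.symm)]

/-- Linearly independent families with the same Gram matrix are related by an orthogonal
transformation. -/
theorem exists_orthogonal_of_gram_eq {α β : Fin r → Fin n → ℝ} (hα : LinearIndependent ℝ α)
    (h : ∀ i j, α i ⬝ᵥ α j = β i ⬝ᵥ β j) :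
    ∃ c : GL (Fin n) ℝ, (c : Matrix (Fin n) (Fin n) ℝ)ᵀ * c = 1 ∧
      ∀ i, (c : Matrix (Fin n) (Fin n) ℝ) *ᵥ α i = β i := by
  let a : Fin r → EuclideanSpace ℝ (Fin n) := fun i => WithLp.toLp 2 (α i)
  let b : Fin r → EuclideanSpace ℝ (Fin n) := fun i => WithLp.toLp 2 (β i)
  have ha : LinearIndependent ℝ a :=
    hα.map' (WithLp.linearEquiv 2 ℝ (Fin n → ℝ)).symm.toLinearMap (LinearEquiv.ker _)
  have hab : ∀ i j, inner ℝ (a i) (a j) = inner ℝ (b i) (b j) := by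
    intro i j
    have := h j i
    simpa [a, b, PiLp.inner_apply, dotProduct] using this
  let e := Module.Basis.span ha
  let T : Submodule.span ℝ (Set.range a) →ₗ[ℝ] EuclideanSpace ℝ (Fin n) := e.constr ℝ b
  have hT : ∀ x y, inner ℝ (T x) (T y) = inner ℝ x y := by
    have hT' : (innerₗ (EuclideanSpace ℝ (Fin n))).compl₁₂ T T =
        innerₗ (Submodule.span ℝ (Set.range a)) := by
      refine e.ext fun i => e.ext fun j => ?_
      simp only [LinearMap.compl₁₂_apply, innerₗ_apply_apply, T, Module.Basis.constr_basis]
      rw [Submodule.coe_inner, Module.Basis.span_apply, Module.Basis.span_apply, hab]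
    intro x y
    exact LinearMap.congr_fun (LinearMap.congr_fun hT' x) y
  -- Equality of Gram matrices makes `T` an isometry of the span, and an isometry of a subspace
  -- extends to the whole Euclidean space.
  let L := (T.isometryOfInner hT).extend
  have hL : ∀ i, L (a i) = b i := by
    intro i
    have h1 := LinearIsometry.extend_apply (T.isometryOfInner hT) (e i)
    have h2 : ((e i : Submodule.span ℝ (Set.range a)) : EuclideanSpace ℝ (Fin n)) = a i :=
      congrArg Subtype.val (Module.Basis.span_apply ha i)
    rw [h2] at h1
    rw [h1]
    exact e.constr_basis ℝ b i
  let c : Matrix (Fin n) (Fin n) ℝ := LinearMap.toMatrix' ((WithLp.linearEquiv 2 ℝ (Fin n → ℝ)).toLinearMap ∘ₗ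
    L.toLinearMap ∘ₗ (WithLp.linearEquiv 2 ℝ (Fin n → ℝ)).symm.toLinearMap)
  have hc : ∀ v, c *ᵥ v = WithLp.ofLp (L (WithLp.toLp 2 v)) := by
    intro v
    rw [← toLin'_apply, toLin'_toMatrix']
    rfl
  have hcc : cᵀ * c = 1 := by
    apply Matrix.ext_of_mulVec_single
    intro j
    ext i
    rw [← mulVec_mulVec, one_mulVec]
    have h1 : ∀ v w : Fin n → ℝ, v ⬝ᵥ (cᵀ *ᵥ (c *ᵥ w)) = v ⬝ᵥ w := by
      intro v w
      rw [dotProduct_mulVec, vecMul_transpose, hc, hc]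
      have := L.inner_map_map (WithLp.toLp 2 w) (WithLp.toLp 2 v)
      rw [PiLp.inner_apply, PiLp.inner_apply] at this
      simpa only [dotProduct, RCLike.inner_apply, conj_trivial] using this
    have := h1 (Pi.single i 1) (Pi.single j 1)
    rwa [single_one_dotProduct, single_one_dotProduct] at this
  refine ⟨⟨c, cᵀ, mul_eq_one_comm.1 hcc, hcc⟩, hcc, fun i => ?_⟩
  change c *ᵥ α i = β i
  rw [hc]
  exact congrArg WithLp.ofLp (hL i)

end RootGroups

/-! ### Finite groups are unitarizable -/

section Unitarize

open Matrix

open scoped MatrixOrder ComplexOrder Matrix.Norms.L2Operator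

variable {𝕜 : Type*} [RCLike 𝕜] {n : ℕ}

theorem exists_gl_of_posDef {H : Matrix (Fin n) (Fin n) 𝕜} (hH : H.PosDef) :
    ∃ P : GL (Fin n) 𝕜, H = (P : Matrix (Fin n) (Fin n) 𝕜)ᴴ * P := by
  obtain ⟨y, hy, h⟩ :=
    CStarAlgebra.isStrictlyPositive_iff_eq_star_mul_self.1 hH.isStrictlyPositive
  obtain ⟨P, rfl⟩ := hy
  exact ⟨P, h⟩

/-- A finite linear group is conjugate to a unitary group. -/
theorem exists_conj_unitary (Γ : Subgroup (GL (Fin n) 𝕜)) [Finite Γ] :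
    ∃ P : GL (Fin n) 𝕜, ∀ g ∈ Γ.map (MulAut.conj P).toMonoidHom,
      (g : Matrix (Fin n) (Fin n) 𝕜)ᴴ * g = 1 := by
  have := Fintype.ofFinite Γ
  -- The averaged Hermitian form is invariant and positive definite; a factorization of it as a
  -- conjugate transpose times a matrix `P` gives the change of basis.
  let H : Matrix (Fin n) (Fin n) 𝕜 :=
    ∑ g : Γ, ((g : GL (Fin n) 𝕜) : Matrix (Fin n) (Fin n) 𝕜)ᴴ * (g : GL (Fin n) 𝕜)
  have hpd : ∀ g : GL (Fin n) 𝕜,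
      ((g : Matrix (Fin n) (Fin n) 𝕜)ᴴ * (g : Matrix (Fin n) (Fin n) 𝕜)).PosDef := by
    intro g
    have := CStarAlgebra.isStrictlyPositive_iff_eq_star_mul_self.2
      ⟨(g : Matrix (Fin n) (Fin n) 𝕜), g.isUnit, rfl⟩
    exact this.posDef
  have hH : H.PosDef := by
    apply _root_.Matrix.posDef_sum Finset.univ_nonempty
    exact fun g _ => hpd g
  have hinv : ∀ g ∈ Γ, (g : Matrix (Fin n) (Fin n) 𝕜)ᴴ * H * g = H := by
    intro g hg
    simp only [H, Finset.mul_sum, Finset.sum_mul]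
    refine Fintype.sum_equiv (Equiv.mulRight (⟨g, hg⟩ : Γ)) _ _ fun x => ?_
    rw [Equiv.coe_mulRight, Subgroup.coe_mul, Units.val_mul, conjTranspose_mul]
    simp only [mul_assoc]
  obtain ⟨P, hP⟩ := exists_gl_of_posDef hH
  refine ⟨P, ?_⟩
  rintro _ ⟨g, hg, rfl⟩
  have h1 := hinv g hg
  have hPP : (P : Matrix (Fin n) (Fin n) 𝕜) * ((P⁻¹ : GL (Fin n) 𝕜) : Matrix (Fin n) (Fin n) 𝕜) = 1 :=
    P.mul_inv
  have hPP' : ((P⁻¹ : GL (Fin n) 𝕜) : Matrix (Fin n) (Fin n) 𝕜)ᴴ *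
      (P : Matrix (Fin n) (Fin n) 𝕜)ᴴ = 1 := by
    rw [← conjTranspose_mul, hPP, conjTranspose_one]
  change ((P : Matrix (Fin n) (Fin n) 𝕜) * (g : Matrix (Fin n) (Fin n) 𝕜) *
    ((P⁻¹ : GL (Fin n) 𝕜) : Matrix (Fin n) (Fin n) 𝕜))ᴴ * (P * (g : Matrix (Fin n) (Fin n) 𝕜) *
    ((P⁻¹ : GL (Fin n) 𝕜) : Matrix (Fin n) (Fin n) 𝕜)) = 1
  calc _ = ((P⁻¹ : GL (Fin n) 𝕜) : Matrix (Fin n) (Fin n) 𝕜)ᴴ *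
        ((g : Matrix (Fin n) (Fin n) 𝕜)ᴴ * ((P : Matrix (Fin n) (Fin n) 𝕜)ᴴ * (P : Matrix (Fin n) (Fin n) 𝕜)) * (g : Matrix (Fin n) (Fin n) 𝕜)) *
        ((P⁻¹ : GL (Fin n) 𝕜) : Matrix (Fin n) (Fin n) 𝕜) := by
        simp only [conjTranspose_mul, mul_assoc]
    _ = 1 := by rw [← hP, h1, hP, ← mul_assoc, hPP', one_mul, hPP]

end Unitarize

/-! ### Coxeter types of linear groups -/

section CoxeterTypes

open Matrix Real

theorem HasCoxeterType.map {K L : Type*} [Field K] [Field L] {n m r : ℕ}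
    {W : Subgroup (GL (Fin n) K)} {M : CoxeterMatrix (Fin r)} (h : HasCoxeterType W M)
    (f : GL (Fin n) K →* GL (Fin m) L) (hf : Function.Injective f)
    (hr : ∀ g, IsReflection g → IsReflection (f g)) : HasCoxeterType (W.map f) M := by
  obtain ⟨cs, hcs⟩ := h
  refine ⟨cs.map (W.equivMapOfInjective f hf), fun i => ?_⟩
  rw [CoxeterSystem.map_simple, Subgroup.coe_equivMapOfInjective_apply]
  exact hr _ (hcs i)

theorem HasCoxeterType.conj {K : Type*} [Field K] {n r : ℕ} {W : Subgroup (GL (Fin n) K)}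
    {M : CoxeterMatrix (Fin r)} (h : HasCoxeterType W M) (c : GL (Fin n) K) :
    HasCoxeterType (W.map (MulAut.conj c).toMonoidHom) M :=
  h.map _ (MulAut.conj c).injective fun _ hg => hg.conj c

theorem HasCoxeterType.of_conjBy {K : Type*} [Field K] {n r : ℕ} {W W' Γ : Subgroup (GL (Fin n) K)}
    {M : CoxeterMatrix (Fin r)} (h : HasCoxeterType W M) (hc : ConjBy Γ W W') :
    HasCoxeterType W' M := by
  obtain ⟨c, -, rfl⟩ := hc
  exact h.conj c

theorem HasCoxeterType.reindex {K : Type*} [Field K] {n r r' : ℕ} {W : Subgroup (GL (Fin n) K)}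
    {M : CoxeterMatrix (Fin r)} (h : HasCoxeterType W M) (e : Fin r ≃ Fin r') :
    HasCoxeterType W (M.reindex e) := by
  obtain ⟨cs, hcs⟩ := h
  exact ⟨cs.reindex e, fun i => hcs _⟩

/-- The Coxeter type of a finite linear group is unique, in rank at most three. -/
theorem HasCoxeterType.exists_reindex_eq {K : Type*} [Field K] [CharZero K] {n r r' : ℕ}
    {W : Subgroup (GL (Fin n) K)} [Finite W] {M : CoxeterMatrix (Fin r)}
    {N : CoxeterMatrix (Fin r')} (h : HasCoxeterType W M) (h' : HasCoxeterType W N)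
    (h1 : 1 ≤ r) (h3 : r ≤ 3) (h1' : 1 ≤ r') (h3' : r' ≤ 3) :
    ∃ e : Fin r ≃ Fin r', M.reindex e = N := by
  obtain ⟨cs, hcs⟩ := h
  obtain ⟨cs', hcs'⟩ := h'
  have hlift : M.IsLiftable (fun _ => (-1 : ℤˣ)) := fun i j => by norm_num
  let ε : W →* ℤˣ := cs.lift ⟨_, hlift⟩
  have hε : ∀ i, ε (cs.simple i) = -1 := fun i => cs.lift_apply_simple hlift i
  -- The sign character is the determinant, since a reflection of order two has determinant -1.
  -- Being independent of the Coxeter system, it is also -1 on the generators of the second one.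
  have hdet : ((Int.castRingHom K : ℤ →* K).comp ((Units.coeHom ℤ).comp ε)) =
      (detMonoidHom : Matrix (Fin n) (Fin n) K →* K).comp
        ((Units.coeHom _).comp W.subtype) := by
    refine cs.ext_simple fun i => ?_
    have h1 : ((cs.simple i : W) : GL (Fin n) K) * (cs.simple i : W) = 1 := by
      rw [← Subgroup.coe_mul, cs.simple_mul_simple_self, Subgroup.coe_one]
    have h2 := (hcs i).det_eq h1
    simp only [MonoidHom.comp_apply, hε]
    rw [coe_detMonoidHom, Units.coeHom_apply, Units.coeHom_apply, Subgroup.subtype_apply, h2]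
    simp
  refine coxeterMatrix_unique ε h1 h3 h1' h3' cs cs' hε fun i => ?_
  have h1 : ((cs'.simple i : W) : GL (Fin n) K) * (cs'.simple i : W) = 1 := by
    rw [← Subgroup.coe_mul, cs'.simple_mul_simple_self, Subgroup.coe_one]
  have h2 := (hcs' i).det_eq h1
  have h3 := DFunLike.congr_fun hdet (cs'.simple i)
  simp only [MonoidHom.comp_apply] at h3
  rw [coe_detMonoidHom, Units.coeHom_apply, Units.coeHom_apply, Subgroup.subtype_apply, h2] at h3
  refine (Int.units_eq_one_or _).resolve_left fun h4 => ?_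
  rw [h4] at h3
  norm_num at h3

theorem complexification_val (g : GL (Fin 3) ℝ) :
    (complexification g : Matrix (Fin 3) (Fin 3) ℂ) =
      (g : Matrix (Fin 3) (Fin 3) ℝ).map (algebraMap ℝ ℂ) := rfl

theorem complexification_injective : Function.Injective complexification := by
  intro g h hgh
  apply Units.ext
  have := congrArg (fun x : GL (Fin 3) ℂ => (x : Matrix (Fin 3) (Fin 3) ℂ)) hgh
  exact Matrix.map_injective (algebraMap ℝ ℂ).injective this

theorem IsReflection.complexification {g : GL (Fin 3) ℝ} (hg : IsReflection g) :
    IsReflection (complexification g) := by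
  obtain ⟨u, v, huv, h0⟩ := hg.exists_eq
  have hinj : Function.Injective (algebraMap ℝ ℂ) := (algebraMap ℝ ℂ).injective
  refine isReflection_of_eq (u := algebraMap ℝ ℂ ∘ u) (v := algebraMap ℝ ℂ ∘ v) ?_ ?_ ?_
    ((ReflQuot.complexification).isOfFinOrder hg.1)
  · rw [complexification_val, huv]
    ext i j
    simp [vecMulVec_apply, Matrix.one_apply]
    split_ifs <;> simp
  · intro h
    apply h0
    have : u = 0 := by
      ext i
      exact hinj (by simpa using congrFun h i)
    rw [this, dotProduct_zero]
  · intro h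
    apply h0
    have : v = 0 := by
      ext i
      exact hinj (by simpa using congrFun h i)
    rw [this, zero_dotProduct]

theorem HasCoxeterType.complexification {r : ℕ} {W : Subgroup (GL (Fin 3) ℝ)}
    {M : CoxeterMatrix (Fin r)} (h : HasCoxeterType W M) :
    HasCoxeterType (W.map complexification) M :=
  h.map _ complexification_injective fun _ hg => hg.complexification

/-- Every finite Coxeter group has simple roots in a Euclidean space of large enough dimension. -/
theorem exists_isSimpleRoots_of_finite {r n : ℕ} (hr : r ≤ n) (M : CoxeterMatrix (Fin r))
    [Finite M.Group] : ∃ α : Fin r → Fin n → ℝ, IsSimpleRoots M α := by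
  have hpd := posDef_cosMatrix M.toCoxeterSystem
  obtain ⟨P, hP⟩ := exists_gl_of_posDef hpd
  rw [conjTranspose_eq_transpose_of_trivial] at hP
  -- Padding with zeros, which is isometric.
  let f : (Fin r → ℝ) →ₗ[ℝ] (Fin n → ℝ) := 
    ∑ k : Fin r, (LinearMap.single ℝ (fun _ : Fin n => ℝ) (Fin.castLE hr k)) ∘ₗ LinearMap.proj k
  have hf : ∀ v w, f v ⬝ᵥ f w = v ⬝ᵥ w := by
    intro v w
    have h1 : ∀ v, f v = ∑ k, v k • Pi.single (Fin.castLE hr k) 1 := by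
      intro v
      simp only [f, LinearMap.sum_apply, LinearMap.comp_apply, LinearMap.proj_apply,
        LinearMap.single_apply]
      refine Finset.sum_congr rfl fun k _ => ?_
      rw [← Pi.single_smul, smul_eq_mul, mul_one]
    have hne : ∀ k l, Fin.castLE hr k = Fin.castLE hr l ↔ k = l :=
      fun k l => (Fin.castLE_injective hr).eq_iff
    rw [h1, h1]
    simp only [sum_dotProduct, dotProduct_sum, smul_dotProduct, dotProduct_smul,
      single_one_dotProduct, Pi.single_apply, smul_eq_mul, hne]
    simp [dotProduct, mul_comm]
  -- The columns of a factor `P` of the positive definite Gram matrix have the required products.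
  let α : Fin r → Fin n → ℝ := fun i => f (fun k => (P : Matrix (Fin r) (Fin r) ℝ) k i)
  have hgram : ∀ i j, α i ⬝ᵥ α j = -cos (π / M i j) := by
    intro i j
    rw [hf, ← cosMatrix_apply, hP, Matrix.mul_apply]
    rfl
  refine ⟨α, ?_, hgram, entry_ne_zero_of_finite M.toCoxeterSystem⟩
  rw [Fintype.linearIndependent_iff]
  intro g hg
  have h1 : g ⬝ᵥ (cosMatrix M *ᵥ g) = 0 := by
    have h2 : (∑ i, g i • α i) ⬝ᵥ (∑ i, g i • α i) = 0 := by rw [hg, zero_dotProduct]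
    rw [← h2]
    simp only [sum_dotProduct, dotProduct_sum, smul_dotProduct, dotProduct_smul, smul_eq_mul,
      hgram]
    simp only [dotProduct, mulVec, cosMatrix_apply, Finset.mul_sum]
    exact Finset.sum_congr rfl fun i _ => Finset.sum_congr rfl fun j _ => by
      rw [M.symmetric j i]
      ring
  by_contra hne
  push Not at hne
  obtain ⟨i, hi⟩ := hne
  have h3 := hpd.dotProduct_mulVec_pos (x := g) (fun h => hi (congrFun h i))
  rw [star_trivial, h1] at h3
  exact lt_irrefl _ h3

theorem IsSimpleRoots.finite {r n : ℕ} {M : CoxeterMatrix (Fin r)} {α : Fin r → Fin n → ℝ}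
    (h : IsSimpleRoots M α) [Finite M.Group] : Finite (rootGroup (Set.range α)) := by
  obtain ⟨cs, -⟩ := h.exists_coxeterSystem
  exact Finite.of_equiv _ cs.mulEquiv.symm.toEquiv

theorem generatedByReflections_closure {K : Type*} [Field K] {n : ℕ} {S : Set (GL (Fin n) K)}
    (hS : ∀ g ∈ S, IsReflection g) : GeneratedByReflections (Subgroup.closure S) := by
  refine le_antisymm ((Subgroup.closure_le _).2 fun g hg => hg.1) ?_
  exact Subgroup.closure_mono fun g hg => ⟨Subgroup.subset_closure hg, hS g hg⟩

theorem IsSimpleRoots.realReflectionGroup {r : ℕ} {M : CoxeterMatrix (Fin r)}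
    {α : Fin r → Fin 3 → ℝ} (h : IsSimpleRoots M α) [Finite M.Group] (hr : 1 ≤ r) :
    RealReflectionGroup (rootGroup (Set.range α)) := by
  refine ⟨h.finite, ?_, generatedByReflections_closure ?_⟩
  · intro hbot
    have h1 : reflGL (α ⟨0, hr⟩) (h.unit _) ∈ rootGroup (Set.range α) :=
      Subgroup.subset_closure ⟨_, ⟨_, rfl⟩, rfl⟩
    rw [hbot, Subgroup.mem_bot] at h1
    exact (isReflection_of_val_eq_reflMat (h.unit ⟨0, hr⟩) (reflGL_val _ _)).ne_one h1
  · rintro g ⟨_, ⟨i, rfl⟩, hg⟩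
    exact isReflection_of_val_eq_reflMat (h.unit i) hg

theorem GeneratedByReflections.conj {K : Type*} [Field K] {n : ℕ} {W : Subgroup (GL (Fin n) K)}
    (h : GeneratedByReflections W) (c : GL (Fin n) K) :
    GeneratedByReflections (W.map (MulAut.conj c).toMonoidHom) := by
  rw [← h, MonoidHom.map_closure]
  apply generatedByReflections_closure
  rintro _ ⟨g, hg, rfl⟩
  exact hg.2.conj c

theorem one_le_of_rootGroup_ne_bot {r n : ℕ} {α : Fin r → Fin n → ℝ}
    (h : rootGroup (Set.range α) ≠ ⊥) : 1 ≤ r := by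
  by_contra h0
  obtain rfl : r = 0 := by omega
  apply h
  rw [rootGroup, Set.range_eq_empty, Subgroup.closure_eq_bot_iff]
  simp

/-- Every finite real reflection group is conjugate to a root group. -/
theorem RealReflectionGroup.exists_isSimpleRoots {Γ : Subgroup (GL (Fin 3) ℝ)}
    (h : RealReflectionGroup Γ) :
    ∃ (r : ℕ) (M : CoxeterMatrix (Fin r)) (α : Fin r → Fin 3 → ℝ), 1 ≤ r ∧ r ≤ 3 ∧
      IsSimpleRoots M α ∧ ConjBy ⊤ Γ (rootGroup (Set.range α)) := by
  obtain ⟨hfin, hne, hgen⟩ := h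
  obtain ⟨P, hP⟩ := exists_conj_unitary Γ
  have hfin' : Finite (Γ.map (MulAut.conj P).toMonoidHom) :=
    Finite.of_equiv _ (Γ.equivMapOfInjective _ (MulAut.conj P).injective).toEquiv
  obtain ⟨r, M, α, hα, hαΓ⟩ := ReflQuot.exists_isSimpleRoots (Γ.map (MulAut.conj P).toMonoidHom)
    (by simpa only [conjTranspose_eq_transpose_of_trivial] using hP) (hgen.conj P)
  refine ⟨r, M, α, ?_, hα.rank_le, hα, P, trivial, hαΓ.symm⟩
  apply one_le_of_rootGroup_ne_bot
  rw [hαΓ]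
  intro h
  exact hne ((Subgroup.map_eq_bot_iff_of_injective _ (MulAut.conj P).injective).1 h)

/-- Systems of simple roots of the same type are related by an orthogonal transformation. -/
theorem IsSimpleRoots.exists_conj {r r' n : ℕ} {M : CoxeterMatrix (Fin r)}
    {N : CoxeterMatrix (Fin r')} {α : Fin r → Fin n → ℝ} {β : Fin r' → Fin n → ℝ}
    (hα : IsSimpleRoots M α) (hβ : IsSimpleRoots N β) {e : Fin r ≃ Fin r'} (he : M.reindex e = N) :
    ∃ c : GL (Fin n) ℝ, (c : Matrix (Fin n) (Fin n) ℝ)ᵀ * c = 1 ∧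
      (rootGroup (Set.range α)).map (MulAut.conj c).toMonoidHom = rootGroup (Set.range β) := by
  obtain ⟨c, hc, hcα⟩ := exists_orthogonal_of_gram_eq (β := β ∘ e) hα.linearIndependent (by
    intro i j
    rw [Function.comp_apply, Function.comp_apply, hα.dotProduct_eq, hβ.dotProduct_eq, ← he,
      CoxeterMatrix.reindex_apply, e.symm_apply_apply, e.symm_apply_apply])
  refine ⟨c, hc, ?_⟩
  rw [map_conj_rootGroup c hc, ← Set.range_comp]
  congr 1
  rw [show (fun a => (c : Matrix (Fin n) (Fin n) ℝ) *ᵥ a) ∘ α = β ∘ e from funext hcα,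
    e.surjective.range_comp]

end CoxeterTypes

/-! ### The morphism `φ` and the orthogonal group of `R` -/

section Phi

open Matrix

/-- The quadratic form `R` as a function. -/
def evalR (x : Fin 3 → ℂ) : ℂ := x 0 ^ 2 - x 1 * x 2

theorem eval_quadForm (x : Fin 3 → ℂ) : eval x quadForm = evalR x := by
  simp [quadForm, evalR]

theorem eval_pullback {n : ℕ} (g : Matrix (Fin n) (Fin n) ℂ) (x : Fin n → ℂ)
    (f : MvPolynomial (Fin n) ℂ) : eval x (pullback g f) = eval (g *ᵥ x) f := by
  have : (aeval x : MvPolynomial (Fin n) ℂ →ₐ[ℂ] ℂ).comp (pullback g) = aeval (g *ᵥ x) := by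
    apply algHom_ext
    intro i
    simp [pullback, mulVec, dotProduct]
  exact DFunLike.congr_fun this f

theorem mem_orthogonalR_iff {g : GL (Fin 3) ℂ} : g ∈ orthogonalR ↔
    ∀ x, evalR ((g : Matrix (Fin 3) (Fin 3) ℂ) *ᵥ x) = evalR x := by
  constructor
  · intro h x
    rw [← eval_quadForm, ← eval_pullback, show pullback (g : Matrix (Fin 3) (Fin 3) ℂ) quadForm =
      quadForm from h, eval_quadForm]
  · intro h
    refine MvPolynomial.funext fun x => ?_
    rw [eval_pullback, eval_quadForm, eval_quadForm, h]

theorem phi_val (g : GL (Fin 2) ℂ) :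
    (phi g : Matrix (Fin 3) (Fin 3) ℂ) = symSq (g : Matrix (Fin 2) (Fin 2) ℂ) := rfl

theorem symSq_apply (g : Matrix (Fin 2) (Fin 2) ℂ) : symSq g =
    !![g 0 0 * g 1 1 + g 0 1 * g 1 0, g 0 0 * g 1 0, g 0 1 * g 1 1;
       2 * g 0 0 * g 0 1, g 0 0 ^ 2, g 0 1 ^ 2;
       2 * g 1 0 * g 1 1, g 1 0 ^ 2, g 1 1 ^ 2] := rfl

theorem evalR_symSq (g : Matrix (Fin 2) (Fin 2) ℂ) (x : Fin 3 → ℂ) :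
    evalR (symSq g *ᵥ x) = g.det ^ 2 * evalR x := by
  simp only [evalR, symSq_apply, mulVec, dotProduct, Fin.sum_univ_succ, det_fin_two, of_apply,
    cons_val_zero, cons_val_one, cons_val_succ, Fin.succ_zero_eq_one, Fin.succ_one_eq_two,
    Finset.univ_eq_empty, Finset.sum_empty, cons_val]
  ring

theorem phi_mem_orthogonalR_iff {g : GL (Fin 2) ℂ} :
    phi g ∈ orthogonalR ↔ (g : Matrix (Fin 2) (Fin 2) ℂ).det ^ 2 = 1 := by
  rw [mem_orthogonalR_iff]
  constructor
  · intro h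
    have := h ![1, 0, 0]
    rw [phi_val, evalR_symSq] at this
    simpa [evalR] using this
  · intro h x
    rw [phi_val, evalR_symSq, h, one_mul]

theorem phi_eq_one_iff {g : GL (Fin 2) ℂ} : phi g = 1 ↔ g = 1 ∨ g = -1 := by
  constructor
  · intro h
    have h' : symSq (g : Matrix (Fin 2) (Fin 2) ℂ) = 1 :=
      congrArg (fun x : GL (Fin 3) ℂ => (x : Matrix (Fin 3) (Fin 3) ℂ)) h
    set m : Matrix (Fin 2) (Fin 2) ℂ := (g : Matrix (Fin 2) (Fin 2) ℂ) with hm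
    rw [symSq_apply] at h'
    have h00 := congrFun (congrFun h' 0) 0
    have h01 := congrFun (congrFun h' 0) 1
    have h02 := congrFun (congrFun h' 0) 2
    have h11 := congrFun (congrFun h' 1) 1
    have h22 := congrFun (congrFun h' 2) 2
    simp at h00 h01 h02 h11 h22
    have a0 : m 0 0 ≠ 0 := by rintro h; rcases h11 with h1 | h1 <;> simp [h] at h1
    have a1 : m 1 1 ≠ 0 := by rintro h; rcases h22 with h1 | h1 <;> simp [h] at h1
    have b0 : m 1 0 = 0 := h01.resolve_left a0
    have b1 : m 0 1 = 0 := h02.resolve_right a1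
    rw [b0, mul_zero, add_zero] at h00
    rcases h11 with h1 | h1
    · left
      rw [h1, one_mul] at h00
      apply Units.ext
      rw [← hm]
      ext i j
      fin_cases i <;> fin_cases j <;> simp [b0, b1, h1, h00]
    · right
      have h2 : m 1 1 = -1 := by
        rw [h1] at h00
        linear_combination -h00
      apply Units.ext
      rw [← hm]
      ext i j
      fin_cases i <;> fin_cases j <;> simp [b0, b1, h1, h2]
  · rintro (rfl | rfl)
    · exact map_one _
    · apply Units.ext
      rw [phi_val, symSq_apply]
      ext i j
      fin_cases i <;> fin_cases j <;> simp

theorem mem_muTwo_iff {g : GL (Fin 2) ℂ} : g ∈ muTwo ↔ g = 1 ∨ g = -1 := by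
  rw [muTwo, Subgroup.mem_zpowers_iff]
  constructor
  · rintro ⟨k, rfl⟩
    rcases Int.even_or_odd k with h | h
    · exact Or.inl h.neg_one_zpow
    · exact Or.inr h.neg_one_zpow
  · rintro (rfl | rfl)
    · exact ⟨0, zpow_zero _⟩
    · exact ⟨1, zpow_one _⟩

theorem ker_phi : MonoidHom.ker phi = muTwo := by
  ext g
  rw [MonoidHom.mem_ker, phi_eq_one_iff, mem_muTwo_iff]

theorem ker_phi_le {W : Subgroup (GL (Fin 2) ℂ)} (h : -1 ∈ W) : MonoidHom.ker phi ≤ W := by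
  rw [ker_phi, muTwo, Subgroup.zpowers_le]
  exact h

theorem phi_neg (g : GL (Fin 2) ℂ) : phi (-g) = phi g := by
  rw [show -g = -1 * g by rw [neg_one_mul], map_mul, phi_eq_one_iff.2 (Or.inr rfl), one_mul]

theorem eq_or_eq_neg_of_phi_eq {g h : GL (Fin 2) ℂ} (hgh : phi g = phi h) : g = h ∨ g = -h := by
  have h1 : phi (g * h⁻¹) = 1 := by rw [map_mul, map_inv, hgh, mul_inv_cancel]
  rcases phi_eq_one_iff.1 h1 with h2 | h2
  · exact Or.inl (mul_inv_eq_one.1 h2)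
  · right
    rw [mul_inv_eq_iff_eq_mul] at h2
    rw [h2, neg_one_mul]

/-- The orthogonal group of `R` is contained in the image of `φ`. -/
theorem exists_phi_eq {g : GL (Fin 3) ℂ} (hg : g ∈ orthogonalR) : ∃ c, phi c = g := by
  have polar : ∀ {h : GL (Fin 3) ℂ}, h ∈ orthogonalR → ∀ x y,
      evalR ((h : Matrix (Fin 3) (Fin 3) ℂ) *ᵥ x + (h : Matrix (Fin 3) (Fin 3) ℂ) *ᵥ y) =
        evalR (x + y) := by
    intro h hh x y
    rw [← mulVec_add, mem_orthogonalR_iff.1 hh]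
  set m : Matrix (Fin 3) (Fin 3) ℂ := (g : Matrix (Fin 3) (Fin 3) ℂ) with hm
  -- The isotropic cone of R is the image of ℂ² under (a, c) ↦ (ac, a², c²).
  have sq : ∀ z p q : ℂ, z ^ 2 - p * q = 0 → ∃ a c : ℂ, a * c = z ∧ a ^ 2 = p ∧ c ^ 2 = q := by
    intro z p q h
    obtain ⟨a, ha⟩ := IsAlgClosed.exists_pow_nat_eq p (n := 2) (by norm_num)
    obtain ⟨c, hc⟩ := IsAlgClosed.exists_pow_nat_eq q (n := 2) (by norm_num)
    have h1 : (a * c) ^ 2 = z ^ 2 := by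
      rw [mul_pow, ha, hc]
      linear_combination -h
    rcases sq_eq_sq_iff_eq_or_eq_neg.1 h1 with h2 | h2
    · exact ⟨a, c, h2, ha, hc⟩
    · exact ⟨-a, c, by linear_combination -h2, by rw [neg_sq, ha], hc⟩
  have hR := mem_orthogonalR_iff.1 hg
  have hcol : ∀ j, m *ᵥ Pi.single j 1 = fun i => m i j := fun j => by
    rw [mulVec_single_one]
    rfl
  have e1 := hR (Pi.single 1 1)
  have e2 := hR (Pi.single 2 1)
  have e12 := polar hg (Pi.single 1 1) (Pi.single 2 1)
  rw [← hm, hcol] at e1 e2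
  rw [← hm, hcol, hcol] at e12
  simp [evalR] at e1 e2 e12
  -- The last two basis vectors are isotropic, so their images yield the columns of a matrix of size
  -- two. Preservation of their polar product says that its determinant has square 1.
  obtain ⟨a, c, h1, h2, h3⟩ := sq _ _ _ e1
  obtain ⟨b, d, h4, h5, h6⟩ := sq _ _ _ e2
  rw [← h1, ← h2, ← h3, ← h4, ← h5, ← h6] at e12
  have hdet : (!![a, b; c, d] : Matrix (Fin 2) (Fin 2) ℂ).det ^ 2 = 1 := by
    rw [det_fin_two_of]
    linear_combination -e12
  have hunit : IsUnit (!![a, b; c, d] : Matrix (Fin 2) (Fin 2) ℂ) := by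
    rw [isUnit_iff_isUnit_det, isUnit_iff_ne_zero]
    intro h0
    rw [h0] at hdet
    norm_num at hdet
  obtain ⟨u, hu⟩ := hunit
  rw [← hu] at hdet
  -- The quotient `k` fixes these two isotropic vectors, hence maps the first basis vector,
  -- orthogonal to both, to itself or its opposite. The second case is the image of diag(1, -1).
  have hk : (phi u)⁻¹ * g ∈ orthogonalR :=
    orthogonalR.mul_mem (orthogonalR.inv_mem (phi_mem_orthogonalR_iff.2 hdet)) hg
  set k := (phi u)⁻¹ * g with hkdef
  have hg' : g = phi u * k := by rw [hkdef, mul_inv_cancel_left]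
  have hku : ∀ j : Fin 3, j ≠ 0 →
      (k : Matrix (Fin 3) (Fin 3) ℂ) *ᵥ Pi.single j 1 = Pi.single j 1 := by
    intro j hj
    have h7 : (phi u : Matrix (Fin 3) (Fin 3) ℂ) *ᵥ Pi.single j 1 = m *ᵥ Pi.single j 1 := by
      rw [hcol, mulVec_single_one, phi_val, symSq_apply, hu]
      ext i
      fin_cases j
      · exact absurd rfl hj
      · fin_cases i <;> simp [Matrix.col, h1, h2, h3]
      · fin_cases i <;> simp [Matrix.col, h4, h5, h6]
    rw [hkdef, Units.val_mul, ← mulVec_mulVec, ← hm, ← h7, mulVec_mulVec, Units.inv_mul, one_mulVec]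
  have k0 := mem_orthogonalR_iff.1 hk (Pi.single 0 1)
  have k1 := polar hk (Pi.single 0 1) (Pi.single 1 1)
  have k2 := polar hk (Pi.single 0 1) (Pi.single 2 1)
  rw [hku 1 (by decide)] at k1
  rw [hku 2 (by decide)] at k2
  rw [mulVec_single_one] at k0 k1 k2
  simp [evalR] at k0 k1 k2
  set K : Matrix (Fin 3) (Fin 3) ℂ := (k : Matrix (Fin 3) (Fin 3) ℂ) with hK
  have k3 : K 2 0 = 0 := by linear_combination k0 - k1
  have k4 : K 1 0 = 0 := by linear_combination k0 - k2
  rw [k3, mul_zero, sub_zero] at k0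
  have hKcol : ∀ i j, j ≠ 0 → K i j = Pi.single (M := fun _ => ℂ) j 1 i := by
    intro i j hj
    have := congrFun (hku j hj) i
    rwa [mulVec_single_one] at this
  have hc : ∃ c, phi c = k := by
    rcases sq_eq_one_iff.1 k0 with h7 | h7
    · refine ⟨1, ?_⟩
      rw [map_one]
      apply Units.ext
      rw [← hK]
      ext i j
      by_cases hj : j = 0
      · subst hj
        fin_cases i <;> simp [h7, k3, k4]
      · rw [hKcol i j hj]
        simp [Matrix.one_apply, Pi.single_apply]
    · have hd : (!![1, 0; 0, -1] : Matrix (Fin 2) (Fin 2) ℂ) * !![1, 0; 0, -1] = 1 := by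
        ext i j
        fin_cases i <;> fin_cases j <;> simp
      refine ⟨⟨_, _, hd, hd⟩, ?_⟩
      apply Units.ext
      rw [← hK, phi_val, symSq_apply]
      ext i j
      by_cases hj : j = 0
      · subst hj
        fin_cases i <;> simp [h7, k3, k4]
      · rw [hKcol i j hj]
        fin_cases j
        · exact absurd rfl hj
        all_goals fin_cases i <;> simp
  obtain ⟨c, hc⟩ := hc
  exact ⟨u * c, by rw [map_mul, hc, ← hg']⟩

/-! ### Reflections of order two in rank two -/

/-- Both sides say that the eigenvalues are 1 and -1. This replaces the geometric condition by two
polynomial equations. -/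
theorem isReflection_orderOf_eq_two_iff {g : GL (Fin 2) ℂ} :
    IsReflection g ∧ orderOf g = 2 ↔ (g : Matrix (Fin 2) (Fin 2) ℂ).trace = 0 ∧
      (g : Matrix (Fin 2) (Fin 2) ℂ).det = -1 := by
  constructor
  · rintro ⟨hg, ho⟩
    have hdet := hg.det_eq (by rw [← pow_two]; exact orderOf_dvd_iff_pow_eq_one.1 ho.dvd)
    refine ⟨?_, hdet⟩
    obtain ⟨u, v, huv, -⟩ := hg.exists_eq
    rw [huv, det_one_add_vecMulVec] at hdet
    rw [huv, trace_add, trace_one, trace_vecMulVec, dotProduct_comm]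
    simp only [Fintype.card_fin]
    push_cast
    linear_combination hdet
  · rintro ⟨ht, hd⟩
    set m : Matrix (Fin 2) (Fin 2) ℂ := (g : Matrix (Fin 2) (Fin 2) ℂ) with hm
    rw [trace_fin_two] at ht
    rw [det_fin_two] at hd
    have h11 : m 1 1 = -m 0 0 := by linear_combination ht
    have hne : m ≠ 1 := by
      intro h
      rw [h] at h11
      norm_num at h11
    have hsq : g ^ 2 = 1 := by
      apply Units.ext
      rw [Units.val_pow_eq_pow_val, ← hm, pow_two]
      rw [h11] at hd
      ext i j
      fin_cases i <;> fin_cases j <;> simp [Matrix.mul_apply, h11] <;> first | linear_combination -hd | ring1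
    have hg1 : g ≠ 1 := by
      rintro rfl
      exact hne Units.val_one
    refine ⟨⟨isOfFinOrder_iff_pow_eq_one.2 ⟨2, by norm_num, hsq⟩, ?_⟩, orderOf_eq_prime hsq hg1⟩
    rw [← hm]
    have h1 : LinearMap.ker (toLin' (m - 1)) ≠ ⊤ := by
      intro h
      rw [LinearMap.ker_eq_top, LinearEquiv.map_eq_zero_iff, sub_eq_zero] at h
      exact hne h
    have h2 : LinearMap.ker (toLin' (m - 1)) ≠ ⊥ := by
      intro h
      have hdet : (m - 1).det = 0 := by
        rw [det_fin_two]
        simp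
        rw [h11] at hd ⊢
        linear_combination hd
      obtain ⟨v, hv, hv0⟩ := exists_mulVec_eq_zero_iff.2 hdet
      have : v ∈ LinearMap.ker (toLin' (m - 1)) := by rwa [LinearMap.mem_ker, toLin'_apply]
      rw [h, Submodule.mem_bot] at this
      exact hv this
    have h3 := Submodule.finrank_lt h1
    rw [Module.finrank_fin_fun] at h3
    have h4 : Module.finrank ℂ (LinearMap.ker (toLin' (m - 1))) ≠ 0 := by
      rwa [Ne, Submodule.finrank_eq_zero]
    omega

/-- The linear form polar to `e` for the quadratic form `R`. -/
def polarR (e : Fin 3 → ℂ) : Fin 3 → ℂ := ![e 0, -(e 2) / 2, -(e 1) / 2]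

/-- The involution of trace zero with coordinates `e`. -/
def involution (e : Fin 3 → ℂ) : Matrix (Fin 2) (Fin 2) ℂ := !![e 0, -e 1; e 2, -e 0]

/-- The determinant of `involution e` is -R(e). The right-hand side is the orthogonal reflection for
R that negates `e`; this is the bridge between the two kinds of reflections. -/
theorem symSq_involution {e : Fin 3 → ℂ} (he : evalR e = 1) :
    symSq (involution e) = 1 + vecMulVec ((-2 : ℂ) • e) (polarR e) := by
  rw [evalR] at he
  rw [symSq_apply]
  ext i j
  fin_cases i <;> fin_cases j <;>
    simp [involution, polarR] <;> first | ring1 | linear_combination he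

theorem involution_mul_self {e : Fin 3 → ℂ} (he : evalR e = 1) :
    involution e * involution e = 1 := by
  rw [evalR] at he
  ext i j
  fin_cases i <;> fin_cases j <;> simp [involution, Matrix.mul_apply] <;>
    first | ring1 | linear_combination he

/-- The involution of trace zero with coordinates `e`, as an element of the general linear group. -/
def involutionGL (e : Fin 3 → ℂ) (he : evalR e = 1) : GL (Fin 2) ℂ :=
  ⟨involution e, involution e, involution_mul_self he, involution_mul_self he⟩

theorem involutionGL_val (e : Fin 3 → ℂ) (he : evalR e = 1) :
    (involutionGL e he : Matrix (Fin 2) (Fin 2) ℂ) = involution e := rfl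

theorem trace_involution (e : Fin 3 → ℂ) : (involution e).trace = 0 := by
  simp [involution, trace_fin_two]

theorem det_involution {e : Fin 3 → ℂ} (he : evalR e = 1) : (involution e).det = -1 := by
  rw [evalR] at he
  rw [involution, det_fin_two_of]
  linear_combination -he

theorem exists_eq_involution {g : GL (Fin 2) ℂ} (hg : IsReflection g ∧ orderOf g = 2) :
    ∃ e : Fin 3 → ℂ, ∃ he : evalR e = 1, g = involutionGL e he := by
  obtain ⟨ht, hd⟩ := isReflection_orderOf_eq_two_iff.1 hg
  rw [trace_fin_two] at ht
  rw [det_fin_two] at hd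
  have h11 : (g : Matrix (Fin 2) (Fin 2) ℂ) 1 1 = -(g : Matrix (Fin 2) (Fin 2) ℂ) 0 0 := by
    linear_combination ht
  rw [h11] at hd
  refine ⟨![(g : Matrix (Fin 2) (Fin 2) ℂ) 0 0, -(g : Matrix (Fin 2) (Fin 2) ℂ) 0 1,
    (g : Matrix (Fin 2) (Fin 2) ℂ) 1 0], ?_, ?_⟩
  · simp [evalR]
    linear_combination -hd
  · apply Units.ext
    rw [involutionGL_val]
    ext i j
    fin_cases i <;> fin_cases j <;> simp [involution, h11]

theorem involutionGL_spec (e : Fin 3 → ℂ) (he : evalR e = 1) :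
    IsReflection (involutionGL e he) ∧ orderOf (involutionGL e he) = 2 :=
  isReflection_orderOf_eq_two_iff.2 ⟨trace_involution e, det_involution he⟩

theorem isReflection_phi {g : GL (Fin 2) ℂ} (hg : IsReflection g ∧ orderOf g = 2) :
    IsReflection (phi g) := by
  obtain ⟨e, he, rfl⟩ := exists_eq_involution hg
  have he0 : e ≠ 0 := by
    rintro rfl
    simp [evalR] at he
  refine isReflection_of_eq (symSq_involution he) (smul_ne_zero (by norm_num) he0) ?_
    (phi.isOfFinOrder hg.1.1)
  intro h
  apply he0
  have h0 := congrFun h 0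
  have h1 := congrFun h 1
  have h2 := congrFun h 2
  simp [polarR] at h0 h1 h2
  ext i
  fin_cases i <;> simp [h0, h1, h2]

/-- Every reflection in the orthogonal group of `R` is the image of a reflection of order two. -/
theorem IsReflection.exists_involution {g : GL (Fin 3) ℂ} (hg : IsReflection g)
    (ho : g ∈ orthogonalR) : ∃ e : Fin 3 → ℂ, ∃ he : evalR e = 1, phi (involutionGL e he) = g := by
  obtain ⟨u, v, huv, h0⟩ := hg.exists_eq
  have hmul : ∀ x, (g : Matrix (Fin 3) (Fin 3) ℂ) *ᵥ x = x + (v ⬝ᵥ x) • u := by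
    intro x
    rw [huv, add_mulVec, one_mulVec, vecMulVec_mulVec]
    simp
  -- R(gx) - R(x) is the product of the linear forms `v ⬝ᵥ x` and `L x`. The first is nonzero at
  -- `u`, so `L` vanishes identically, and this makes `v` proportional to the polar form of `u`.
  let L : (Fin 3 → ℂ) → ℂ := fun x =>
    2 * (x 0 * u 0) - x 1 * u 2 - x 2 * u 1 + (v ⬝ᵥ x) * evalR u
  have hL : ∀ x, (v ⬝ᵥ x) * L x = 0 := by
    intro x
    have h1 := mem_orthogonalR_iff.1 ho x
    rw [hmul] at h1
    simp only [L, evalR, Pi.add_apply, Pi.smul_apply, smul_eq_mul] at h1 ⊢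
    linear_combination h1
  have hLadd : ∀ x y, L (x + y) = L x + L y := by
    intro x y
    simp only [L, Pi.add_apply, dotProduct_add]
    ring
  have hLu : L u = 0 := (mul_eq_zero.1 (hL u)).resolve_left h0
  have hL0 : ∀ x, L x = 0 := by
    intro x
    by_cases hx : v ⬝ᵥ x = 0
    · have h1 := hL (u + x)
      rw [dotProduct_add, hx, add_zero, hLadd, hLu, zero_add] at h1
      exact (mul_eq_zero.1 h1).resolve_left h0
    · exact (mul_eq_zero.1 (hL x)).resolve_left hx
  have l0 := hL0 (Pi.single 0 1)
  have l1 := hL0 (Pi.single 1 1)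
  have l2 := hL0 (Pi.single 2 1)
  simp [L] at l0 l1 l2
  -- If `u` were isotropic, vanishing of `L` would read off `u = 0`.
  have hRu : evalR u ≠ 0 := by
    intro h
    rw [h] at l0 l1 l2
    simp at l0 l1 l2
    apply h0
    have : u = 0 := by
      ext i
      fin_cases i
      · exact l0
      · exact l2
      · exact l1
    rw [this, dotProduct_zero]
  obtain ⟨s, hs⟩ := IsAlgClosed.exists_pow_nat_eq (evalR u) (n := 2) (by norm_num)
  have hs0 : s ≠ 0 := by
    rintro rfl
    rw [zero_pow two_ne_zero] at hs
    exact hRu hs.symm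
  have he : evalR (s⁻¹ • u) = 1 := by
    have : evalR (s⁻¹ • u) = (s⁻¹) ^ 2 * evalR u := by
      simp only [evalR, Pi.smul_apply, smul_eq_mul]
      ring
    rw [this, ← hs, inv_pow, inv_mul_cancel₀ (pow_ne_zero 2 hs0)]
  refine ⟨s⁻¹ • u, he, Units.ext ?_⟩
  rw [phi_val, involutionGL_val, symSq_involution he, huv]
  congr 1
  have hv : v = (-2 * s⁻¹ * s⁻¹) • polarR u := by
    have : ∀ i, v i * evalR u = -2 * polarR u i := by
      intro i
      fin_cases i
      · simp [polarR]
        linear_combination l0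
      · simp [polarR]
        linear_combination l1
      · simp [polarR]
        linear_combination l2
    ext i
    have h1 := this i
    rw [← hs] at h1
    rw [Pi.smul_apply, smul_eq_mul]
    field_simp
    linear_combination h1
  have hp : polarR (s⁻¹ • u) = s⁻¹ • polarR u := by
    ext i
    fin_cases i <;> simp [polarR] <;> ring
  rw [hv, hp]
  simp only [smul_vecMulVec, vecMulVec_smul, smul_smul]
  congr 1
  ring

end Phi

/-! ### Groups generated by Pauli reflections -/

section PauliGroups

open Matrix

/-- The change of coordinates from the standard quadratic form to `R`. -/
def toR : GL (Fin 3) ℂ where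
  val := !![0, 0, 1; -1, Complex.I, 0; 1, Complex.I, 0]
  inv := !![0, -1 / 2, 1 / 2; 0, -Complex.I / 2, -Complex.I / 2; 1, 0, 0]
  val_inv := by
    ext i j
    fin_cases i <;> fin_cases j <;> simp [Matrix.mul_apply, Fin.sum_univ_succ] <;>
      ring_nf
    all_goals norm_num
  inv_val := by
    ext i j
    fin_cases i <;> fin_cases j <;> simp [Matrix.mul_apply, Fin.sum_univ_succ] <;>
      ring_nf
    all_goals norm_num

theorem toR_mulVec (x : Fin 3 → ℂ) : (toR : Matrix (Fin 3) (Fin 3) ℂ) *ᵥ x =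
    ![x 2, -x 0 + Complex.I * x 1, x 0 + Complex.I * x 1] := by
  ext i
  fin_cases i <;> simp [toR, mulVec, dotProduct, Fin.sum_univ_succ]

theorem evalR_toR (x : Fin 3 → ℂ) :
    evalR ((toR : Matrix (Fin 3) (Fin 3) ℂ) *ᵥ x) = x ⬝ᵥ x := by
  rw [toR_mulVec]
  simp [evalR, dotProduct, Fin.sum_univ_succ]
  linear_combination (-(x 1) ^ 2) * Complex.I_sq

theorem polarR_vecMul_toR (x : Fin 3 → ℂ) :
    polarR ((toR : Matrix (Fin 3) (Fin 3) ℂ) *ᵥ x) ᵥ* (toR : Matrix (Fin 3) (Fin 3) ℂ) = x := by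
  rw [toR_mulVec]
  ext i
  fin_cases i
  · simp [toR, polarR, vecMul, dotProduct, Fin.sum_univ_succ]
    ring
  · simp [toR, polarR, vecMul, dotProduct, Fin.sum_univ_succ]
    linear_combination (-(x 1)) * Complex.I_sq
  · simp [toR, polarR, vecMul, dotProduct, Fin.sum_univ_succ]

/-- A real vector as a complex vector. -/
def complexVec {n : ℕ} (a : Fin n → ℝ) : Fin n → ℂ := fun i => (a i : ℂ)

theorem complexVec_dotProduct {n : ℕ} (a b : Fin n → ℝ) :
    complexVec a ⬝ᵥ complexVec b = ((a ⬝ᵥ b : ℝ) : ℂ) := by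
  simp [complexVec, dotProduct]

theorem map_reflMat (a : Fin 3 → ℝ) :
    (reflMat a).map (algebraMap ℝ ℂ) = reflMat (complexVec a) := by
  ext i j
  simp [reflMat, complexVec, vecMulVec_apply, Matrix.one_apply]
  split_ifs <;> simp

theorem pauli_eq_involution (a : Fin 3 → ℝ) : pauli (a 0) (a 1) (a 2) =
    involution ((toR : Matrix (Fin 3) (Fin 3) ℂ) *ᵥ complexVec a) := by
  rw [toR_mulVec]
  ext i j
  fin_cases i <;> fin_cases j <;> simp [pauli, involution, complexVec] <;> ring

variable {a : Fin 3 → ℝ}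

theorem evalR_toR_complexVec (ha : a ⬝ᵥ a = 1) :
    evalR ((toR : Matrix (Fin 3) (Fin 3) ℂ) *ᵥ complexVec a) = 1 := by
  rw [evalR_toR, complexVec_dotProduct, ha, Complex.ofReal_one]

/-- The Pauli reflection attached to a unit vector. -/
def pauliGL (a : Fin 3 → ℝ) (ha : a ⬝ᵥ a = 1) : GL (Fin 2) ℂ :=
  involutionGL _ (evalR_toR_complexVec ha)

theorem pauliGL_val (a : Fin 3 → ℝ) (ha : a ⬝ᵥ a = 1) :
    (pauliGL a ha : Matrix (Fin 2) (Fin 2) ℂ) = pauli (a 0) (a 1) (a 2) :=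
  (pauli_eq_involution a).symm

/-- Both sides are the reflection negating the same vector, as `toR` carries the sum of squares to
R. -/
theorem phi_pauliGL (ha : a ⬝ᵥ a = 1) :
    phi (pauliGL a ha) = MulAut.conj toR (complexification (reflGL a ha)) := by
  rw [MulAut.conj_apply, eq_mul_inv_iff_mul_eq]
  apply Units.ext
  rw [Units.val_mul, Units.val_mul, phi_val, complexification_val, reflGL_val, map_reflMat,
    pauliGL, involutionGL_val, symSq_involution (evalR_toR_complexVec ha), add_mul, one_mul,
    smul_vecMulVec, smul_mul_assoc, vecMulVec_mul, polarR_vecMul_toR, reflMat, mul_add, mul_one,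
    mul_smul_comm, mul_vecMulVec]

/-- The group generated by the Pauli reflections attached to the vectors in `S`. -/
def pauliGroup (S : Set (Fin 3 → ℝ)) : Subgroup (GL (Fin 2) ℂ) :=
  Subgroup.closure {g | ∃ a ∈ S, (g : Matrix (Fin 2) (Fin 2) ℂ) = pauli (a 0) (a 1) (a 2)}

theorem map_phi_pauliGroup {S : Set (Fin 3 → ℝ)} (hS : ∀ a ∈ S, a ⬝ᵥ a = 1) :
    (pauliGroup S).map phi =
      ((rootGroup S).map complexification).map (MulAut.conj toR).toMonoidHom := by
  rw [pauliGroup, rootGroup, MonoidHom.map_closure, MonoidHom.map_closure, MonoidHom.map_closure]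
  congr 1
  ext g
  constructor
  · rintro ⟨g, ⟨a, ha, hg⟩, rfl⟩
    obtain rfl : g = pauliGL a (hS a ha) := Units.ext (hg.trans (pauliGL_val a _).symm)
    exact ⟨_, ⟨_, ⟨a, ha, rfl⟩, rfl⟩, (phi_pauliGL (hS a ha)).symm⟩
  · rintro ⟨_, ⟨g, ⟨a, ha, hg⟩, rfl⟩, rfl⟩
    obtain rfl : g = reflGL a (hS a ha) := Units.ext hg
    exact ⟨pauliGL a (hS a ha), ⟨a, ha, pauliGL_val a _⟩, phi_pauliGL (hS a ha)⟩

/-- A unitary reflection of order two is a Pauli reflection. -/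
theorem exists_eq_pauliGL {g : GL (Fin 2) ℂ} (hg : IsReflection g ∧ orderOf g = 2)
    (hu : (g : Matrix (Fin 2) (Fin 2) ℂ)ᴴ * g = 1) :
    ∃ a : Fin 3 → ℝ, ∃ ha : a ⬝ᵥ a = 1, g = pauliGL a ha := by
  obtain ⟨ht, hd⟩ := isReflection_orderOf_eq_two_iff.1 hg
  have hsq : (g : Matrix (Fin 2) (Fin 2) ℂ) * g = 1 := by
    rw [← Units.val_mul, ← pow_two, orderOf_dvd_iff_pow_eq_one.1 hg.2.dvd, Units.val_one]
  set m : Matrix (Fin 2) (Fin 2) ℂ := (g : Matrix (Fin 2) (Fin 2) ℂ) with hm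
  -- A unitary involution is Hermitian; with trace 0 its entries are given by three real numbers.
  have hH : mᴴ = m := by
    rw [← mul_one mᴴ, ← hsq, ← mul_assoc, hu, one_mul]
  rw [trace_fin_two] at ht
  rw [det_fin_two] at hd
  have h00 := congrFun (congrFun hH 0) 0
  have h01 := congrFun (congrFun hH 0) 1
  rw [conjTranspose_apply] at h00 h01
  have hre : ((m 0 0).re : ℂ) = m 0 0 := Complex.conj_eq_iff_re.1 h00
  have h11 : m 1 1 = -m 0 0 := by linear_combination ht
  let a : Fin 3 → ℝ := ![(m 1 0).re, (m 1 0).im, (m 0 0).re]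
  have h10 : m 1 0 = (a 0 : ℂ) + (a 1 : ℂ) * Complex.I := (Complex.re_add_im (m 1 0)).symm
  have h01' : m 0 1 = (a 0 : ℂ) - (a 1 : ℂ) * Complex.I := by
    rw [← h01, h10]
    simp [sub_eq_add_neg]
  have h2 : (a 2 : ℂ) = m 0 0 := hre
  clear_value a
  have ha : a ⬝ᵥ a = 1 := by
    have : ((a ⬝ᵥ a : ℝ) : ℂ) = 1 := by
      rw [h11, h10, h01', ← h2] at hd
      simp only [dotProduct, Fin.sum_univ_three]
      push_cast
      linear_combination -hd + (a 1 : ℂ) ^ 2 * Complex.I_sq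
    exact_mod_cast this
  refine ⟨a, ha, Units.ext ?_⟩
  rw [pauliGL_val, ← hm]
  ext i j
  fin_cases i <;> fin_cases j <;> simp only [pauli, Fin.mk_zero, Fin.mk_one, of_apply,
    cons_val', cons_val_zero, cons_val_one, cons_val_fin_one, h2, h11, h10, h01']

end PauliGroups

/-! ### Upstairs groups and their images -/

section Correspondence

open Matrix

theorem isReflection_conj_iff_order_two {g : GL (Fin 2) ℂ} (hg : IsReflection g ∧ orderOf g = 2)
    (c : GL (Fin 2) ℂ) : IsReflection (c * g * c⁻¹) ∧ orderOf (c * g * c⁻¹) = 2 :=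
  ⟨hg.1.conj c, ((MulAut.conj c).orderOf_eq g).trans hg.2⟩

theorem generatedByOrderTwoReflections_closure {S : Set (GL (Fin 2) ℂ)}
    (hS : ∀ g ∈ S, IsReflection g ∧ orderOf g = 2) :
    GeneratedByOrderTwoReflections (Subgroup.closure S) := by
  refine le_antisymm ((Subgroup.closure_le _).2 fun g hg => hg.1) ?_
  exact Subgroup.closure_mono fun g hg => ⟨Subgroup.subset_closure hg, hS g hg⟩

theorem UpstairsGroup.conj {W : Subgroup (GL (Fin 2) ℂ)} (h : UpstairsGroup W) (c : GL (Fin 2) ℂ) :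
    UpstairsGroup (W.map (MulAut.conj c).toMonoidHom) := by
  refine ⟨?_, -1, h.2, by simp⟩
  rw [← h.1, MonoidHom.map_closure]
  apply generatedByOrderTwoReflections_closure
  rintro _ ⟨g, hg, rfl⟩
  exact isReflection_conj_iff_order_two hg.2 c

theorem finite_map {M N : Type*} [Group M] [Group N] (f : M →* N) (W : Subgroup M) [Finite W] :
    Finite (W.map f) :=
  Set.Finite.to_subtype ((Set.toFinite (W : Set M)).image f)

theorem UpstairsGroup.det_sq {W : Subgroup (GL (Fin 2) ℂ)} (h : UpstairsGroup W)
    {g : GL (Fin 2) ℂ} (hg : g ∈ W) : (g : Matrix (Fin 2) (Fin 2) ℂ).det ^ 2 = 1 := by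
  rw [← phi_mem_orthogonalR_iff]
  have : W ≤ orthogonalR.comap phi := by
    rw [← h.1]
    refine (Subgroup.closure_le _).2 fun x hx => ?_
    change phi x ∈ orthogonalR
    rw [phi_mem_orthogonalR_iff, (isReflection_orderOf_eq_two_iff.1 hx.2).2]
    norm_num
  exact this hg

theorem UpstairsGroup.exists_reflection {W : Subgroup (GL (Fin 2) ℂ)} (h : UpstairsGroup W) :
    ∃ g ∈ W, IsReflection g ∧ orderOf g = 2 := by
  by_contra hne
  push Not at hne
  have h1 : W = ⊥ := by
    rw [← h.1, Subgroup.closure_eq_bot_iff]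
    rintro g ⟨hg, h2, h3⟩
    exact absurd h3 (hne g hg h2)
  have h2 := h.2
  rw [h1, Subgroup.mem_bot] at h2
  have h3 := congrArg (fun x : GL (Fin 2) ℂ => (x : Matrix (Fin 2) (Fin 2) ℂ) 0 0) h2
  norm_num at h3

theorem UpstairsGroup.map_phi {W : Subgroup (GL (Fin 2) ℂ)} (h : UpstairsGroup W) :
    OrthogonalReflectionSubgroup (W.map phi) := by
  refine ⟨?_, ?_, ?_⟩
  · rintro _ ⟨g, hg, rfl⟩
    exact phi_mem_orthogonalR_iff.2 (h.det_sq hg)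
  · intro hbot
    obtain ⟨g, hg, hr⟩ := h.exists_reflection
    have h1 : phi g ∈ W.map phi := ⟨g, hg, rfl⟩
    rw [hbot, Subgroup.mem_bot] at h1
    exact (isReflection_phi hr).ne_one h1
  · rw [← h.1, MonoidHom.map_closure]
    apply generatedByReflections_closure
    rintro _ ⟨g, hg, rfl⟩
    exact isReflection_phi hg.2

/-- Every nontrivial reflection subgroup of the orthogonal group lifts. -/
theorem OrthogonalReflectionSubgroup.exists_upstairs {Γ : Subgroup (GL (Fin 3) ℂ)}
    (h : OrthogonalReflectionSubgroup Γ) :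
    ∃ W : Subgroup (GL (Fin 2) ℂ), UpstairsGroup W ∧ W.map phi = Γ := by
  obtain ⟨hle, hne, hgen⟩ := h
  let S : Set (GL (Fin 2) ℂ) := {g | (IsReflection g ∧ orderOf g = 2) ∧ phi g ∈ Γ}
  have hmap : (Subgroup.closure S).map phi = Γ := by
    refine le_antisymm ?_ ?_
    · rw [MonoidHom.map_closure, Subgroup.closure_le]
      rintro _ ⟨g, hg, rfl⟩
      exact hg.2
    · rw [← hgen, Subgroup.closure_le]
      rintro g ⟨hg, hr⟩
      obtain ⟨e, he, rfl⟩ := hr.exists_involution (hle hg)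
      exact ⟨_, Subgroup.subset_closure ⟨involutionGL_spec e he, hg⟩, rfl⟩
  refine ⟨Subgroup.closure S, ⟨generatedByOrderTwoReflections_closure fun g hg => hg.1, ?_⟩, hmap⟩
  have hex : ∃ g, g ∈ S := by
    by_contra hno
    push Not at hno
    apply hne
    rw [← hmap, Set.eq_empty_of_forall_notMem hno, Subgroup.closure_empty, Subgroup.map_bot]
  obtain ⟨g, hg⟩ := hex
  -- The opposite of a reflection of order two of the plane is another one, with the same image;
  -- their product is -1.
  have hneg : -g ∈ S := by
    refine ⟨isReflection_orderOf_eq_two_iff.2 ?_, by rw [phi_neg]; exact hg.2⟩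
    obtain ⟨h1, h2⟩ := isReflection_orderOf_eq_two_iff.1 hg.1
    rw [Units.val_neg, trace_neg, h1, neg_zero, det_neg, h2]
    simp
  have hsq : g * g = 1 := by rw [← pow_two, orderOf_dvd_iff_pow_eq_one.1 hg.1.2.dvd]
  have := Subgroup.mul_mem _ (Subgroup.subset_closure hg) (Subgroup.subset_closure hneg)
  rwa [mul_neg, hsq] at this

theorem finite_of_finite_map_phi {W : Subgroup (GL (Fin 2) ℂ)} (h : Finite (W.map phi)) :
    Finite W := by
  have hfin : (phi '' (W : Set (GL (Fin 2) ℂ))).Finite :=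
    Set.toFinite ((W.map phi : Subgroup _) : Set (GL (Fin 3) ℂ))
  refine Set.Finite.to_subtype (Set.Finite.of_finite_fibers (f := phi) hfin ?_)
  rintro _ ⟨g, hg, rfl⟩
  refine (Set.toFinite {g, -g}).subset ?_
  rintro x ⟨-, hx⟩
  exact eq_or_eq_neg_of_phi_eq hx

theorem map_map_conj {M N : Type*} [Group M] [Group N] (f : M →* N) (W : Subgroup M) (c : M) :
    (W.map (MulAut.conj c).toMonoidHom).map f = (W.map f).map (MulAut.conj (f c)).toMonoidHom := by
  rw [Subgroup.map_map, Subgroup.map_map]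
  congr 1
  ext x
  simp

/-- Upstairs groups are determined by their images. -/
theorem UpstairsGroup.conjBy_of_map_phi {W W' : Subgroup (GL (Fin 2) ℂ)} (h : UpstairsGroup W)
    (h' : UpstairsGroup W') {c : GL (Fin 2) ℂ}
    (hc : (W.map phi).map (MulAut.conj (phi c)).toMonoidHom = W'.map phi) : ConjBy ⊤ W W' := by
  refine ⟨c, trivial, ?_⟩
  rw [← map_map_conj] at hc
  rw [← Subgroup.comap_map_eq_self (ker_phi_le (h.conj c).2), hc,
    Subgroup.comap_map_eq_self (ker_phi_le h'.2)]

/-- Dividing the conjugating matrix by a square root of its determinant does not change the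
conjugation, and puts its image in O(R). -/
theorem ConjBy.map_phi {W W' : Subgroup (GL (Fin 2) ℂ)} (h : ConjBy ⊤ W W') :
    ConjBy orthogonalR (W.map phi) (W'.map phi) := by
  obtain ⟨c, -, rfl⟩ := h
  obtain ⟨s, hs⟩ := IsAlgClosed.exists_pow_nat_eq (c : Matrix (Fin 2) (Fin 2) ℂ).det (n := 2)
    (by norm_num)
  have hdet : (c : Matrix (Fin 2) (Fin 2) ℂ).det ≠ 0 :=
    ((isUnit_iff_isUnit_det _).1 c.isUnit).ne_zero
  have hs0 : s ≠ 0 := by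
    rintro rfl
    rw [zero_pow two_ne_zero] at hs
    exact hdet hs.symm
  let t : GL (Fin 2) ℂ := Units.map (scalar (Fin 2)).toMonoidHom (Units.mk0 s hs0)⁻¹
  have ht : (t : Matrix (Fin 2) (Fin 2) ℂ) = scalar (Fin 2) s⁻¹ := rfl
  have hcomm : ∀ g : GL (Fin 2) ℂ, t * g = g * t := by
    intro g
    apply Units.ext
    rw [Units.val_mul, Units.val_mul, ht]
    exact (scalar_commute s⁻¹ (fun r => mul_comm _ _) _).eq
  refine ⟨phi (t * c), ?_, ?_⟩
  · rw [phi_mem_orthogonalR_iff, Units.val_mul, det_mul, ht, scalar_apply, det_diagonal, ← hs]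
    rw [Finset.prod_const, Finset.card_univ, Fintype.card_fin, ← mul_pow, inv_mul_cancel₀ hs0]
    simp
  · rw [← map_map_conj]
    congr 2
    ext1 g
    simp only [MulEquiv.toMonoidHom_eq_coe, MonoidHom.coe_coe, MulAut.conj_apply]
    rw [hcomm, _root_.mul_inv_rev, mul_assoc c t g, hcomm]
    simp [mul_assoc]

theorem ConjBy.refl {M : Type*} [Group M] (Γ W : Subgroup M) : ConjBy Γ W W :=
  ⟨1, Γ.one_mem, by ext x; simp⟩

theorem ConjBy.symm {M : Type*} [Group M] {Γ W W' : Subgroup M} (h : ConjBy Γ W W') :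
    ConjBy Γ W' W :=
  (conjSetoid Γ fun _ => True).symm (a := ⟨W, trivial⟩) (b := ⟨W', trivial⟩) h

theorem ConjBy.trans {M : Type*} [Group M] {Γ W W' W'' : Subgroup M} (h : ConjBy Γ W W')
    (h' : ConjBy Γ W' W'') : ConjBy Γ W W'' :=
  (conjSetoid Γ fun _ => True).trans (a := ⟨W, trivial⟩) (b := ⟨W', trivial⟩) (c := ⟨W'', trivial⟩)
    h h'

theorem ConjBy.mono {M : Type*} [Group M] {Γ Γ' W W' : Subgroup M} (h : ConjBy Γ W W')
    (hle : Γ ≤ Γ') : ConjBy Γ' W W' := by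
  obtain ⟨c, hc, h⟩ := h
  exact ⟨c, hle hc, h⟩

/-- The nontrivial direction lifts the conjugating element through `phi`; both groups contain the
kernel, so they are recovered from their images. -/
theorem UpstairsGroup.conjBy_iff {W W' : Subgroup (GL (Fin 2) ℂ)} (h : UpstairsGroup W)
    (h' : UpstairsGroup W') :
    ConjBy ⊤ W W' ↔ ConjBy orthogonalR (W.map phi) (W'.map phi) := by
  refine ⟨ConjBy.map_phi, ?_⟩
  rintro ⟨k, hk, hkW⟩
  obtain ⟨c, rfl⟩ := exists_phi_eq hk
  exact h.conjBy_of_map_phi h' hkW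

/-- A relation which is total and unique on both sides induces a bijection of quotients. -/
theorem exists_equiv_of_rel {X Y : Type*} {s : Setoid X} {t : Setoid Y} (rel : X → Y → Prop)
    (h1 : ∀ x, ∃ y, rel x y) (h2 : ∀ y, ∃ x, rel x y)
    (h3 : ∀ x x' y y', rel x y → rel x' y' → (s x x' ↔ t y y'))
    (h4 : ∀ x y y', rel x y → t y y' → rel x y') :
    ∃ Φ : Quotient s ≃ Quotient t, ∀ x y, Φ (Quotient.mk s x) = Quotient.mk t y ↔ rel x y := by
  choose f hf using h1
  let Φ : Quotient s → Quotient t := Quotient.map f fun x x' hx =>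
    (h3 x x' _ _ (hf x) (hf x')).1 hx
  have hΦ : ∀ x y, Φ (Quotient.mk s x) = Quotient.mk t y ↔ rel x y := by
    intro x y
    refine Quotient.eq.trans ⟨fun h => h4 _ _ _ (hf x) h, fun h => ?_⟩
    exact (h3 x x _ _ (hf x) h).1 (s.refl x)
  have hbij : Function.Bijective Φ := by
    constructor
    · intro q q'
      refine Quotient.inductionOn₂ q q' fun x x' h => ?_
      exact Quotient.sound ((h3 x x' _ _ (hf x) ((hΦ x' (f x')).1 rfl)).2 (Quotient.exact h))
    · intro q
      refine Quotient.inductionOn q fun y => ?_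
      obtain ⟨x, hx⟩ := h2 y
      exact ⟨Quotient.mk s x, (hΦ x y).2 hx⟩
  exact ⟨Equiv.ofBijective Φ hbij, hΦ⟩

theorem exists_equiv_orthogonalReflectionSubgroup :
    ∃ Φ : SubgroupClasses ⊤ UpstairsGroup ≃
        SubgroupClasses orthogonalR OrthogonalReflectionSubgroup,
      ∀ W hW Γ hΓ, Φ (classOf ⊤ UpstairsGroup W hW) =
          classOf orthogonalR OrthogonalReflectionSubgroup Γ hΓ ↔
        ConjBy orthogonalR (W.map phi) Γ := by
  obtain ⟨Φ, hΦ⟩ := exists_equiv_of_rel (s := conjSetoid ⊤ UpstairsGroup)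
    (t := conjSetoid orthogonalR OrthogonalReflectionSubgroup)
    (fun W Γ => ConjBy orthogonalR (W.1.map phi) Γ.1)
    (fun W => ⟨⟨W.1.map phi, W.2.map_phi⟩, ConjBy.refl _ _⟩)
    (fun Γ => by
      obtain ⟨W, hW, h⟩ := Γ.2.exists_upstairs
      refine ⟨⟨W, hW⟩, ?_⟩
      rw [h]
      exact ConjBy.refl _ _)
    (fun W W' Γ Γ' h h' => by
      refine (W.2.conjBy_iff W'.2).trans ⟨fun h1 => (h.symm.trans h1).trans h', fun h1 => ?_⟩
      exact (h.trans h1).trans h'.symm)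
    (fun W Γ Γ' h h' => h.trans h')
  exact ⟨Φ, fun W hW Γ hΓ => hΦ ⟨W, hW⟩ ⟨Γ, hΓ⟩⟩

end Correspondence

/-! ### Classification of finite groups -/

section Classification

open Matrix

/-- The complex form, preserving `R`, of the group generated by the reflections in the real
vectors `α i`. -/
def complexRootGroup {r : ℕ} (α : Fin r → Fin 3 → ℝ) : Subgroup (GL (Fin 3) ℂ) :=
  ((rootGroup (Set.range α)).map complexification).map (MulAut.conj toR).toMonoidHom

variable {r r' : ℕ} {M : CoxeterMatrix (Fin r)} {N : CoxeterMatrix (Fin r')}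
  {α : Fin r → Fin 3 → ℝ} {β : Fin r' → Fin 3 → ℝ}

theorem IsSimpleRoots.hasCoxeterType_complexRootGroup (h : IsSimpleRoots M α) :
    HasCoxeterType (complexRootGroup α) M :=
  h.hasCoxeterType.complexification.conj toR

theorem conj_toR_mem_orthogonalR {c : GL (Fin 3) ℝ}
    (hc : (c : Matrix (Fin 3) (Fin 3) ℝ)ᵀ * c = 1) :
    toR * complexification c * toR⁻¹ ∈ orthogonalR := by
  have hc' : (complexification c : Matrix (Fin 3) (Fin 3) ℂ)ᵀ * complexification c = 1 := by
    rw [complexification_val, ← transpose_map, ← Matrix.map_mul, hc,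
      Matrix.map_one _ (map_zero _) (map_one _)]
  rw [mem_orthogonalR_iff]
  intro x
  set y := ((toR⁻¹ : GL (Fin 3) ℂ) : Matrix (Fin 3) (Fin 3) ℂ) *ᵥ x with hy
  have hx : x = (toR : Matrix (Fin 3) (Fin 3) ℂ) *ᵥ y := by
    rw [hy, mulVec_mulVec, Units.mul_inv, one_mulVec]
  rw [Units.val_mul, Units.val_mul, ← mulVec_mulVec, ← hy, ← mulVec_mulVec, evalR_toR, hx,
    evalR_toR, dotProduct_mulVec, ← mulVec_transpose, mulVec_mulVec, hc', one_mulVec]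

theorem IsSimpleRoots.conjBy_complexRootGroup (hα : IsSimpleRoots M α) (hβ : IsSimpleRoots N β)
    {e : Fin r ≃ Fin r'} (he : M.reindex e = N) :
    ConjBy orthogonalR (complexRootGroup α) (complexRootGroup β) := by
  obtain ⟨c, hc, hconj⟩ := hα.exists_conj hβ he
  refine ⟨_, conj_toR_mem_orthogonalR hc, ?_⟩
  rw [complexRootGroup, complexRootGroup, ← hconj, map_map_conj complexification]
  simp only [Subgroup.map_map]
  congr 1
  ext1 g
  simp [mul_assoc]

theorem FiniteUpstairsGroup.upstairsGroup {W : Subgroup (GL (Fin 2) ℂ)}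
    (h : FiniteUpstairsGroup W) : UpstairsGroup W := h.2

theorem FiniteUpstairsGroup.finite_map_phi {W : Subgroup (GL (Fin 2) ℂ)}
    (h : FiniteUpstairsGroup W) : Finite (W.map phi) := by
  have := h.1
  exact finite_map _ _

/-- A finite unitary group generated by reflections of order two is a Pauli group. -/
theorem UpstairsGroup.exists_pauliGroup {W : Subgroup (GL (Fin 2) ℂ)} (h : UpstairsGroup W)
    (hu : ∀ g ∈ W, (g : Matrix (Fin 2) (Fin 2) ℂ)ᴴ * g = 1) :
    ∃ S : Set (Fin 3 → ℝ), (∀ a ∈ S, a ⬝ᵥ a = 1) ∧ W = pauliGroup S := by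
  refine ⟨{a | a ⬝ᵥ a = 1 ∧
    ∃ g ∈ W, (g : Matrix (Fin 2) (Fin 2) ℂ) = pauli (a 0) (a 1) (a 2)}, fun a ha => ha.1, ?_⟩
  refine le_antisymm ?_ ?_
  · rw [← h.1]
    refine (Subgroup.closure_le _).2 ?_
    rintro g ⟨hg, hr⟩
    obtain ⟨a, ha, rfl⟩ := exists_eq_pauliGL hr (hu g hg)
    refine Subgroup.subset_closure ⟨a, ⟨ha, _, ?_, pauliGL_val a ha⟩, pauliGL_val a ha⟩
    rwa [h.1]
  · refine (Subgroup.closure_le _).2 ?_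
    rintro g ⟨a, ⟨-, k, hk, hka⟩, hga⟩
    rwa [show g = k from Units.ext (hga.trans hka.symm)]

theorem rootGroup_orthogonal {n : ℕ} {S : Set (Fin n → ℝ)} (hS : ∀ a ∈ S, a ⬝ᵥ a = 1)
    {g : GL (Fin n) ℝ} (hg : g ∈ rootGroup S) : (g : Matrix (Fin n) (Fin n) ℝ)ᵀ * g = 1 := by
  induction hg using Subgroup.closure_induction with
  | mem x hx =>
    obtain ⟨a, ha, hx⟩ := hx
    rw [hx, reflMat_transpose, reflMat_mul_self (hS a ha)]
  | one => simp
  | mul x y _ _ hx hy =>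
    rw [Units.val_mul, transpose_mul, mul_assoc, ← mul_assoc _ (x : Matrix (Fin n) (Fin n) ℝ), hx,
      one_mul, hy]
  | inv x _ hx =>
    have h1 : (x : Matrix (Fin n) (Fin n) ℝ) * (x : Matrix (Fin n) (Fin n) ℝ)ᵀ = 1 :=
      mul_eq_one_comm.1 hx
    have h2 : ((x⁻¹ : GL (Fin n) ℝ) : Matrix (Fin n) (Fin n) ℝ) =
        (x : Matrix (Fin n) (Fin n) ℝ)ᵀ := by
      rw [← mul_one ((x : Matrix (Fin n) (Fin n) ℝ)ᵀ), ← Units.val_one, ← mul_inv_cancel x,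
        Units.val_mul, ← mul_assoc, hx, one_mul]
    rw [h2, transpose_transpose, h1]

/-- Normal form of the image of a finite group. -/
theorem FiniteUpstairsGroup.exists_isSimpleRoots {W : Subgroup (GL (Fin 2) ℂ)}
    (h : FiniteUpstairsGroup W) : ∃ (r : ℕ) (M : CoxeterMatrix (Fin r)) (α : Fin r → Fin 3 → ℝ),
      1 ≤ r ∧ r ≤ 3 ∧ IsSimpleRoots M α ∧
        ConjBy orthogonalR (W.map phi) (complexRootGroup α) := by
  have hfin := h.1
  -- Unitarization brings the reflections into Pauli form, which reduces to a finite real orthogonal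
  -- reflection group.
  obtain ⟨P, hP⟩ := exists_conj_unitary W
  have hup := h.upstairsGroup.conj P
  obtain ⟨S, hS, hWS⟩ := hup.exists_pauliGroup hP
  have hmap := map_phi_pauliGroup hS
  rw [← hWS] at hmap
  have hne := hup.map_phi.2.1
  have hfin2 : Finite (W.map (MulAut.conj P).toMonoidHom) := finite_map _ _
  have hfin3 : Finite ((W.map (MulAut.conj P).toMonoidHom).map phi) := finite_map _ _
  have hfin4 : Finite (rootGroup S) := by
    rw [hmap, Subgroup.map_map] at hfin3
    exact Finite.of_equiv _ ((rootGroup S).equivMapOfInjective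
      ((MulAut.conj toR).toMonoidHom.comp complexification)
      ((MulAut.conj toR).injective.comp complexification_injective)).symm.toEquiv
  obtain ⟨r, M, α, hα, hαS⟩ := ReflQuot.exists_isSimpleRoots (rootGroup S)
    (fun g hg => rootGroup_orthogonal hS hg)
    (generatedByReflections_closure (by
      rintro g ⟨a, ha, hg⟩
      exact isReflection_of_val_eq_reflMat (hS a ha) hg))
  refine ⟨r, M, α, one_le_of_rootGroup_ne_bot (α := α) ?_, hα.rank_le, hα, ?_⟩
  · rw [hαS]
    intro hbot
    apply hne
    rw [hmap, hbot, Subgroup.map_bot, Subgroup.map_bot]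
  · rw [complexRootGroup, hαS, ← hmap]
    exact ConjBy.map_phi ⟨P, trivial, rfl⟩

/-- Finite groups of the same type are conjugate. -/
theorem FiniteUpstairsGroup.conjBy_of_hasCoxeterType {W W' : Subgroup (GL (Fin 2) ℂ)}
    (h : FiniteUpstairsGroup W) (h' : FiniteUpstairsGroup W') (h1 : 1 ≤ r) (h3 : r ≤ 3)
    (hM : HasCoxeterType (W.map phi) M) (hM' : HasCoxeterType (W'.map phi) M) :
    ConjBy ⊤ W W' := by
  obtain ⟨s, N, α, hs1, hs3, hα, hc⟩ := h.exists_isSimpleRoots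
  obtain ⟨s', N', α', hs1', hs3', hα', hc'⟩ := h'.exists_isSimpleRoots
  have := h.finite_map_phi
  have := h'.finite_map_phi
  -- Uniqueness of the type identifies the matrices of the two normal forms up to reindexing, and
  -- equal Gram matrices give conjugate root groups.
  obtain ⟨e, he⟩ := hM.exists_reindex_eq
    (hα.hasCoxeterType_complexRootGroup.of_conjBy hc.symm) h1 h3 hs1 hs3
  have hN := hM'.reindex e
  rw [he] at hN
  obtain ⟨e', he'⟩ := hN.exists_reindex_eq
    (hα'.hasCoxeterType_complexRootGroup.of_conjBy hc'.symm) hs1 hs3 hs1' hs3'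
  rw [h.upstairsGroup.conjBy_iff h'.upstairsGroup]
  exact (hc.trans (hα.conjBy_complexRootGroup hα' he')).trans hc'.symm

/-- Finite real reflection groups of the same type are conjugate. -/
theorem RealReflectionGroup.conjBy_of_hasCoxeterType {Γ Γ' : Subgroup (GL (Fin 3) ℝ)}
    (h : RealReflectionGroup Γ) (h' : RealReflectionGroup Γ') (h1 : 1 ≤ r) (h3 : r ≤ 3)
    (hM : HasCoxeterType Γ M) (hM' : HasCoxeterType Γ' M) : ConjBy ⊤ Γ Γ' := by
  obtain ⟨s, N, α, hs1, hs3, hα, hc⟩ := h.exists_isSimpleRoots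
  obtain ⟨s', N', α', hs1', hs3', hα', hc'⟩ := h'.exists_isSimpleRoots
  have := h.1
  have := h'.1
  obtain ⟨e, he⟩ := hM.exists_reindex_eq (hα.hasCoxeterType.of_conjBy hc.symm) h1 h3 hs1 hs3
  have hN := hM'.reindex e
  rw [he] at hN
  obtain ⟨e', he'⟩ := hN.exists_reindex_eq (hα'.hasCoxeterType.of_conjBy hc'.symm)
    hs1 hs3 hs1' hs3'
  obtain ⟨c, -, hconj⟩ := hα.exists_conj hα' he'
  exact (hc.trans ⟨c, trivial, hconj⟩).trans hc'.symm

/-- Every finite Coxeter group of small rank is realized compatibly over `ℝ` and upstairs. -/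
theorem SmallCoxeter.exists_realization (M : SmallCoxeter) :
    ∃ (W : Subgroup (GL (Fin 2) ℂ)) (Γ : Subgroup (GL (Fin 3) ℝ)), FiniteUpstairsGroup W ∧
      RealReflectionGroup Γ ∧ HasCoxeterType (W.map phi) M.matrix ∧ HasCoxeterType Γ M.matrix ∧
        ConjBy ⊤ (W.map phi) (Γ.map complexification) := by
  have := M.finite
  obtain ⟨α, hα⟩ := exists_isSimpleRoots_of_finite M.rank_le_three M.matrix
  have hreal := hα.realReflectionGroup M.one_le_rank
  have hS : ∀ a ∈ Set.range α, a ⬝ᵥ a = 1 := by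
    rintro _ ⟨i, rfl⟩
    exact hα.unit i
  have hmap := map_phi_pauliGroup hS
  have hort : OrthogonalReflectionSubgroup (complexRootGroup α) := by
    rw [complexRootGroup, ← hmap]
    refine ⟨?_, ?_, ?_⟩
    · rintro _ ⟨g, hg, rfl⟩
      have : pauliGroup (Set.range α) ≤ orthogonalR.comap phi := by
        refine (Subgroup.closure_le _).2 ?_
        rintro x ⟨a, ha, hx⟩
        obtain rfl : x = pauliGL a (hS a ha) := Units.ext (hx.trans (pauliGL_val a _).symm)
        change phi _ ∈ orthogonalR
        rw [phi_mem_orthogonalR_iff, pauliGL, (isReflection_orderOf_eq_two_iff.1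
          (involutionGL_spec _ (evalR_toR_complexVec (hS a ha)))).2]
        norm_num
      exact this hg
    · rw [hmap]
      intro hbot
      apply hreal.2.1
      rw [Subgroup.map_eq_bot_iff_of_injective _ (MulAut.conj toR).injective,
        Subgroup.map_eq_bot_iff_of_injective _ complexification_injective] at hbot
      exact hbot
    · rw [pauliGroup, MonoidHom.map_closure]
      apply generatedByReflections_closure
      rintro _ ⟨x, ⟨a, ha, hx⟩, rfl⟩
      obtain rfl : x = pauliGL a (hS a ha) := Units.ext (hx.trans (pauliGL_val a _).symm)
      exact isReflection_phi (involutionGL_spec _ _)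
  -- The Pauli group of the simple roots need not contain -1 (in rank one it does not), so the
  -- realization is the lift of its image.
  obtain ⟨W, hW, hWmap⟩ := hort.exists_upstairs
  have hfinΓ := hreal.1
  have hfin1 : Finite ((rootGroup (Set.range α)).map complexification) := finite_map _ _
  have hfin2 : Finite (complexRootGroup α) := finite_map _ _
  refine ⟨W, rootGroup (Set.range α), ⟨finite_of_finite_map_phi (by rwa [hWmap]), hW⟩, hreal,
    ?_, hα.hasCoxeterType, ?_⟩
  · rw [hWmap]
    exact hα.hasCoxeterType_complexRootGroup
  · rw [hWmap]
    exact ConjBy.symm ⟨toR, trivial, rfl⟩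

theorem HasCoxeterType.finite_group {K : Type*} [Field K] {n : ℕ} {W : Subgroup (GL (Fin n) K)}
    [Finite W] (h : HasCoxeterType W M) : Finite M.Group := by
  obtain ⟨cs, -⟩ := h
  exact Finite.of_equiv _ cs.mulEquiv.toEquiv

theorem FiniteUpstairsGroup.exists_hasCoxeterType {W : Subgroup (GL (Fin 2) ℂ)}
    (h : FiniteUpstairsGroup W) : ∃ M : SmallCoxeter, HasCoxeterType (W.map phi) M.matrix := by
  obtain ⟨r, M, α, h1, h3, hα, hc⟩ := h.exists_isSimpleRoots
  have hM := hα.hasCoxeterType_complexRootGroup.of_conjBy hc.symm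
  have := h.finite_map_phi
  exact ⟨⟨r, h1, h3, M, hM.finite_group⟩, hM⟩

theorem RealReflectionGroup.exists_hasCoxeterType {Γ : Subgroup (GL (Fin 3) ℝ)}
    (h : RealReflectionGroup Γ) : ∃ M : SmallCoxeter, HasCoxeterType Γ M.matrix := by
  obtain ⟨r, M, α, h1, h3, hα, hc⟩ := h.exists_isSimpleRoots
  have hM := hα.hasCoxeterType.of_conjBy hc.symm
  have := h.1
  exact ⟨⟨r, h1, h3, M, hM.finite_group⟩, hM⟩

/-- On both sides the conjugacy classes are classified by the Coxeter type, and complex conjugacy of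
images preserves the type. -/
theorem exists_equiv_realReflectionGroup :
    ∃ Φ : SubgroupClasses ⊤ FiniteUpstairsGroup ≃ SubgroupClasses ⊤ RealReflectionGroup,
      ∀ W hW Γ hΓ, Φ (classOf ⊤ FiniteUpstairsGroup W hW) = classOf ⊤ RealReflectionGroup Γ hΓ ↔
        ConjBy ⊤ (W.map phi) (Γ.map complexification) := by
  have hcx : ∀ {Γ Γ' : Subgroup (GL (Fin 3) ℝ)}, ConjBy ⊤ Γ Γ' →
      ConjBy ⊤ (Γ.map complexification) (Γ'.map complexification) := by
    rintro Γ _ ⟨c, -, rfl⟩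
    exact ⟨complexification c, trivial, (map_map_conj _ _ _).symm⟩
  have hty : ∀ {W : Subgroup (GL (Fin 2) ℂ)} {Γ : Subgroup (GL (Fin 3) ℝ)} {M : SmallCoxeter},
      HasCoxeterType Γ M.matrix → ConjBy ⊤ (W.map phi) (Γ.map complexification) →
        HasCoxeterType (W.map phi) M.matrix :=
    fun h hc => h.complexification.of_conjBy hc.symm
  obtain ⟨Φ, hΦ⟩ := exists_equiv_of_rel (s := conjSetoid ⊤ FiniteUpstairsGroup)
    (t := conjSetoid ⊤ RealReflectionGroup)
    (fun W Γ => ConjBy ⊤ (W.1.map phi) (Γ.1.map complexification))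
    (fun W => by
      obtain ⟨M, hM⟩ := W.2.exists_hasCoxeterType
      obtain ⟨W', Γ, hW', hΓ, hM', -, hc⟩ := M.exists_realization
      have := W.2.conjBy_of_hasCoxeterType hW' M.one_le_rank M.rank_le_three hM hM'
      exact ⟨⟨Γ, hΓ⟩, (this.map_phi.mono le_top).trans hc⟩)
    (fun Γ => by
      obtain ⟨M, hM⟩ := Γ.2.exists_hasCoxeterType
      obtain ⟨W, Γ', hW, hΓ', -, hM', hc⟩ := M.exists_realization
      have := hΓ'.conjBy_of_hasCoxeterType Γ.2 M.one_le_rank M.rank_le_three hM' hM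
      exact ⟨⟨W, hW⟩, hc.trans (hcx this)⟩)
    (fun W W' Γ Γ' h h' => by
      obtain ⟨M, hM⟩ := Γ.2.exists_hasCoxeterType
      obtain ⟨M', hM'⟩ := Γ'.2.exists_hasCoxeterType
      constructor
      · intro hWW
        have h1 := hty hM' h'
        have h2 := (hty hM h).of_conjBy hWW.map_phi
        have := W'.2.finite_map_phi
        obtain ⟨e, he⟩ := h2.exists_reindex_eq h1 M.one_le_rank M.rank_le_three M'.one_le_rank
          M'.rank_le_three
        have h3 := hM.reindex e
        rw [he] at h3
        exact Γ.2.conjBy_of_hasCoxeterType Γ'.2 M'.one_le_rank M'.rank_le_three h3 hM'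
      · intro hΓΓ
        exact W.2.conjBy_of_hasCoxeterType W'.2 M.one_le_rank M.rank_le_three (hty hM h)
          (hty (hM.of_conjBy hΓΓ) h'))
    (fun W Γ Γ' h h' => h.trans (hcx h'))
  exact ⟨Φ, fun W hW Γ hΓ => hΦ ⟨W, hW⟩ ⟨Γ, hΓ⟩⟩

theorem exists_equiv_coxeter :
    ∃ Φ : SubgroupClasses ⊤ FiniteUpstairsGroup ≃ Quotient coxeterSetoid,
      ∀ W hW (M : SmallCoxeter),
        Φ (classOf ⊤ FiniteUpstairsGroup W hW) = Quotient.mk coxeterSetoid M ↔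
          HasCoxeterType (W.map phi) M.matrix := by
  obtain ⟨Φ, hΦ⟩ := exists_equiv_of_rel (s := conjSetoid ⊤ FiniteUpstairsGroup)
    (t := coxeterSetoid) (fun W M => HasCoxeterType (W.1.map phi) M.matrix)
    (fun W => W.2.exists_hasCoxeterType)
    (fun M => by
      obtain ⟨W, -, hW, -, hM, -⟩ := M.exists_realization
      exact ⟨⟨W, hW⟩, hM⟩)
    (fun W W' M M' h h' => by
      constructor
      · intro hWW
        have := W'.2.finite_map_phi
        exact (h.of_conjBy hWW.map_phi).exists_reindex_eq h' M.one_le_rank M.rank_le_three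
          M'.one_le_rank M'.rank_le_three
      · rintro ⟨e, he⟩
        have h2 := h.reindex e
        rw [he] at h2
        exact W.2.conjBy_of_hasCoxeterType W'.2 M'.one_le_rank M'.rank_le_three h2 h')
    (fun W M M' h h' => by
      obtain ⟨e, he⟩ := h'
      rw [← he]
      exact h.reindex e)
  exact ⟨Φ, fun W hW M => hΦ ⟨W, hW⟩ M⟩

end Classification

/-! ### Examples: the groups of type `A₃`, `B₃`, `H₃` -/

section Examples

open Matrix Real

/-- A group of matrices generated by reflections preserving a finite spanning set is finite. -/
theorem finite_rootGroup {n : ℕ} {S F : Set (Fin n → ℝ)} (hS : ∀ a ∈ S, a ⬝ᵥ a = 1)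
    (hF : F.Finite) (hspan : ∀ i, Pi.single i 1 ∈ Submodule.span ℝ F)
    (hSF : ∀ a ∈ S, ∀ v ∈ F, reflVec a v ∈ F) : Finite (rootGroup S) := by
  have hmaps : ∀ g ∈ rootGroup S, (∀ v ∈ F, (g : Matrix (Fin n) (Fin n) ℝ) *ᵥ v ∈ F) ∧
      ∀ v ∈ F, ((g⁻¹ : GL (Fin n) ℝ) : Matrix (Fin n) (Fin n) ℝ) *ᵥ v ∈ F := by
    intro g hg
    induction hg using Subgroup.closure_induction with
    | mem x hx =>
      obtain ⟨a, ha, hx⟩ := hx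
      have hinv : x⁻¹ = x := inv_eq_of_mul_eq_one_left (Units.ext (by
        rw [Units.val_mul, hx, reflMat_mul_self (hS a ha), Units.val_one]))
      rw [hinv, hx]
      simp only [reflMat_mulVec]
      exact ⟨hSF a ha, hSF a ha⟩
    | one => simp
    | mul x y _ _ hx hy =>
      refine ⟨fun v hv => ?_, fun v hv => ?_⟩
      · rw [Units.val_mul, ← mulVec_mulVec]
        exact hx.1 _ (hy.1 _ hv)
      · rw [_root_.mul_inv_rev, Units.val_mul, ← mulVec_mulVec]
        exact hy.2 _ (hx.2 _ hv)
    | inv x _ hx =>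
      rw [inv_inv]
      exact ⟨hx.2, hx.1⟩
  have := hF.to_subtype
  let f : rootGroup S → (F → F) := fun g v => ⟨_, (hmaps g.1 g.2).1 v.1 v.2⟩
  refine Finite.of_injective f fun g h hgh => ?_
  apply Subtype.ext
  apply Units.ext
  have hEq : Set.EqOn (toLin' ((g : GL (Fin n) ℝ) : Matrix (Fin n) (Fin n) ℝ))
      (toLin' ((h : GL (Fin n) ℝ) : Matrix (Fin n) (Fin n) ℝ)) F := fun v hv =>
    congrArg Subtype.val (congrFun hgh ⟨v, hv⟩)
  apply Matrix.ext_of_mulVec_single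
  intro i
  exact LinearMap.eqOn_span hEq (hspan i)

theorem rootGroup_eq_of_neg {K : Type*} [Field K] {n : ℕ} {S T : Set (Fin n → K)}
    (hST : ∀ a ∈ S, a ∈ T ∨ -a ∈ T) (hTS : ∀ a ∈ T, a ∈ S ∨ -a ∈ S) :
    rootGroup S = rootGroup T := by
  rw [rootGroup, rootGroup]
  congr 1
  ext g
  constructor
  · rintro ⟨a, ha, hg⟩
    rcases hST a ha with h | h
    · exact ⟨a, h, hg⟩
    · exact ⟨-a, h, by rw [reflMat_neg, hg]⟩
  · rintro ⟨a, ha, hg⟩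
    rcases hTS a ha with h | h
    · exact ⟨a, h, hg⟩
    · exact ⟨-a, h, by rw [reflMat_neg, hg]⟩

/-- The product of two Pauli reflections with orthogonal normals has trace 0 and determinant 1, so
its square is -1. -/
theorem neg_one_mem_pauliGroup {S : Set (Fin 3 → ℝ)} (hS : ∀ a ∈ S, a ⬝ᵥ a = 1)
    {a b : Fin 3 → ℝ} (ha : a ∈ S) (hb : b ∈ S) (hab : a ⬝ᵥ b = 0) : -1 ∈ pauliGroup S := by
  have ha' : pauliGL a (hS a ha) ∈ pauliGroup S :=
    Subgroup.subset_closure ⟨a, ha, pauliGL_val a _⟩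
  have hb' : pauliGL b (hS b hb) ∈ pauliGroup S :=
    Subgroup.subset_closure ⟨b, hb, pauliGL_val b _⟩
  have hmem := Subgroup.pow_mem _ (Subgroup.mul_mem _ ha' hb') 2
  convert hmem using 1
  apply Units.ext
  have hdet : ∀ c (hc : c ⬝ᵥ c = 1), (pauliGL c hc : Matrix (Fin 2) (Fin 2) ℂ).det = -1 :=
    fun c hc => det_involution (evalR_toR_complexVec hc)
  set X : Matrix (Fin 2) (Fin 2) ℂ :=
    (pauliGL a (hS a ha) : Matrix (Fin 2) (Fin 2) ℂ) * pauliGL b (hS b hb) with hX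
  have hd : X.det = 1 := by
    rw [hX, det_mul, hdet, hdet]
    norm_num
  have ht : X.trace = 0 := by
    have h1 : X.trace = 2 * ((a ⬝ᵥ b : ℝ) : ℂ) := by
      rw [hX, pauliGL_val, pauliGL_val, trace_fin_two]
      simp [pauli, Matrix.mul_apply, dotProduct, Fin.sum_univ_succ]
      linear_combination (-2 * (a 1 : ℂ) * b 1) * Complex.I_sq
    rw [h1, hab, Complex.ofReal_zero, mul_zero]
  rw [Units.val_pow_eq_pow_val, Units.val_mul, ← hX, pow_two]
  rw [trace_fin_two] at ht
  rw [det_fin_two] at hd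
  have h11 : X 1 1 = -X 0 0 := by linear_combination ht
  rw [h11] at hd
  ext i j
  fin_cases i <;> fin_cases j <;> simp [Matrix.mul_apply, h11] <;>
    first | linear_combination hd | ring1

/-- Signs of normals do not affect the image under `phi`, so the generators need match simple roots
only up to sign. Two orthogonal simple roots provide -1, and a finite spanning set stable under the
reflections provides finiteness. -/
theorem pauliGroup_spec {S F : Set (Fin 3 → ℝ)} {r : ℕ} {M : CoxeterMatrix (Fin r)}
    {α : Fin r → Fin 3 → ℝ} (hα : IsSimpleRoots M α)
    (hS : ∀ a ∈ S, ∃ i, α i = a ∨ α i = -a) (hαS : ∀ i, α i ∈ S ∨ -α i ∈ S)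
    {i j : Fin r} (hij : M i j = 2) (hF : F.Finite)
    (hspan : ∀ i, Pi.single i 1 ∈ Submodule.span ℝ F)
    (hαF : ∀ i, ∀ v ∈ F, reflVec (α i) v ∈ F) :
    FiniteUpstairsGroup (pauliGroup S) ∧ HasCoxeterType ((pauliGroup S).map phi) M := by
  have hunit : ∀ a ∈ S, a ⬝ᵥ a = 1 := by
    intro a ha
    obtain ⟨i, hi | hi⟩ := hS a ha
    · rw [← hi, hα.unit]
    · rw [← neg_dotProduct_neg, ← hi, hα.unit]
  have hroot : rootGroup S = rootGroup (Set.range α) := by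
    apply rootGroup_eq_of_neg
    · intro a ha
      obtain ⟨i, hi | hi⟩ := hS a ha
      · exact Or.inl ⟨i, hi⟩
      · exact Or.inr ⟨i, hi⟩
    · rintro _ ⟨i, rfl⟩
      exact hαS i
  have hmap : (pauliGroup S).map phi = complexRootGroup α := by
    rw [map_phi_pauliGroup hunit, hroot, complexRootGroup]
  have hfin : Finite (rootGroup (Set.range α)) := by
    apply finite_rootGroup _ hF hspan
    · rintro _ ⟨i, rfl⟩
      exact hαF i
    · rintro _ ⟨i, rfl⟩
      exact hα.unit i
  have hfin1 : Finite ((rootGroup (Set.range α)).map complexification) := finite_map _ _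
  have hfin2 : Finite (complexRootGroup α) := finite_map _ _
  refine ⟨⟨finite_of_finite_map_phi (by rwa [hmap]), ?_, ?_⟩, ?_⟩
  · apply generatedByOrderTwoReflections_closure
    rintro g ⟨a, ha, hg⟩
    obtain rfl : g = pauliGL a (hunit a ha) := Units.ext (hg.trans (pauliGL_val a _).symm)
    exact involutionGL_spec _ _
  · have h0 : α i ⬝ᵥ α j = 0 := by
      rw [hα.dotProduct_eq, hij]
      simp
    rcases hαS i with h | h <;> rcases hαS j with h' | h'
    · exact neg_one_mem_pauliGroup hunit h h' h0
    · exact neg_one_mem_pauliGroup hunit h h' (by rw [dotProduct_neg, h0, neg_zero])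
    · exact neg_one_mem_pauliGroup hunit h h' (by rw [neg_dotProduct, h0, neg_zero])
    · exact neg_one_mem_pauliGroup hunit h h' (by rw [neg_dotProduct_neg, h0])
  · rw [hmap]
    exact hα.hasCoxeterType_complexRootGroup

/-- Simple roots in rank three, from the three angles. -/
theorem isSimpleRoots_of_rank_three {M : CoxeterMatrix (Fin 3)} {α : Fin 3 → Fin 3 → ℝ}
    (hdet : (Matrix.of α).det ≠ 0) (hunit : ∀ i, α i ⬝ᵥ α i = 1)
    (h01 : α 0 ⬝ᵥ α 1 = -cos (π / M 0 1)) (h02 : α 0 ⬝ᵥ α 2 = -cos (π / M 0 2))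
    (h12 : α 1 ⬝ᵥ α 2 = -cos (π / M 1 2)) (hM : ∀ i j, M i j ≠ 0) : IsSimpleRoots M α := by
  refine ⟨linearIndependent_rows_of_det_ne_zero hdet, fun i j => ?_, hM⟩
  fin_cases i <;> fin_cases j
  · simpa using hunit 0
  · exact h01
  · exact h02
  · refine (dotProduct_comm _ _).trans (h01.trans ?_)
    rw [M.symmetric]
    rfl
  · simpa using hunit 1
  · exact h12
  · refine (dotProduct_comm _ _).trans (h02.trans ?_)
    rw [M.symmetric]
    rfl
  · refine (dotProduct_comm _ _).trans (h12.trans ?_)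
    rw [M.symmetric]
    rfl
  · simpa using hunit 2

/-- The vertices of the octahedron. -/
def octahedron : Set (Fin 3 → ℝ) :=
  {![1, 0, 0], ![-1, 0, 0], ![0, 1, 0], ![0, -1, 0], ![0, 0, 1], ![0, 0, -1]}

theorem octahedron_finite : octahedron.Finite := by
  unfold octahedron
  exact Set.toFinite _

theorem single_mem_span_octahedron (i : Fin 3) :
    Pi.single i 1 ∈ Submodule.span ℝ octahedron := by
  apply Submodule.subset_span
  have h0 : (Pi.single 0 1 : Fin 3 → ℝ) = ![1, 0, 0] := by
    ext j
    fin_cases j <;> simp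
  have h1 : (Pi.single 1 1 : Fin 3 → ℝ) = ![0, 1, 0] := by
    ext j
    fin_cases j <;> simp
  have h2 : (Pi.single 2 1 : Fin 3 → ℝ) = ![0, 0, 1] := by
    ext j
    fin_cases j <;> simp
  fin_cases i
  · exact Or.inl h0
  · exact Or.inr (Or.inr (Or.inl h1))
  · exact Or.inr (Or.inr (Or.inr (Or.inr (Or.inl h2))))

theorem reflVec_vec (a b c x y z : ℝ) : reflVec ![a, b, c] ![x, y, z] =
    ![x - 2 * (a * x + b * y + c * z) * a, y - 2 * (a * x + b * y + c * z) * b,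
      z - 2 * (a * x + b * y + c * z) * c] := by
  have h : ![a, b, c] ⬝ᵥ ![x, y, z] = a * x + b * y + c * z := by
    simp [dotProduct, Fin.sum_univ_succ]
    ring
  rw [reflVec, h]
  ext i
  fin_cases i <;> simp

theorem reflVec_vec_of_eq {a b c x y z d : ℝ} (h : a * x + b * y + c * z = d) :
    reflVec ![a, b, c] ![x, y, z] = ![x - 2 * d * a, y - 2 * d * b, z - 2 * d * c] := by
  rw [reflVec_vec, h]

theorem inv_sqrt_two_mul_self : (√2)⁻¹ * (√2)⁻¹ = 1 / 2 := by
  rw [← mul_inv, Real.mul_self_sqrt (by norm_num)]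
  norm_num

theorem G12_spec : FiniteUpstairsGroup G12 ∧ HasCoxeterType (G12.map phi) (CoxeterMatrix.A 3) := by
  set c := (√2)⁻¹ with hc
  have hcc : c * c = 1 / 2 := inv_sqrt_two_mul_self
  have hc0 : c ≠ 0 := by positivity
  let S : Set (Fin 3 → ℝ) := {![-c, 0, c], ![c, 0, c], ![c, -c, 0]}
  -- The normals of the generators, ordered along the diagram, with one sign changed to make the
  -- products nonpositive.
  let α : Fin 3 → Fin 3 → ℝ := ![![-c, 0, c], ![c, -c, 0], ![-c, 0, -c]]
  have hG : G12 = pauliGroup S := by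
    rw [G12, generatedBy, pauliGroup]
    congr 1
    ext g
    simp [S, hc]
  have hα : IsSimpleRoots (CoxeterMatrix.A 3) α := by
    apply isSimpleRoots_of_rank_three
    · rw [det_fin_three]
      simp [α, hcc]
      intro h
      exact hc0 (by linarith)
    · intro i
      fin_cases i <;> simp [α, dotProduct, Fin.sum_univ_succ, hcc] <;> norm_num
    · rw [show CoxeterMatrix.A 3 0 1 = 3 from rfl]
      push_cast
      rw [cos_pi_div_three]
      simp [α, dotProduct, Fin.sum_univ_succ, hcc]
    · rw [show CoxeterMatrix.A 3 0 2 = 2 from rfl]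
      push_cast
      rw [cos_pi_div_two]
      simp [α, dotProduct, Fin.sum_univ_succ]
    · rw [show CoxeterMatrix.A 3 1 2 = 3 from rfl]
      push_cast
      rw [cos_pi_div_three]
      simp [α, dotProduct, Fin.sum_univ_succ, hcc]
    · exact fun i j => by fin_cases i <;> fin_cases j <;> exact Nat.succ_ne_zero _
  rw [hG]
  refine pauliGroup_spec hα ?_ ?_ (i := 0) (j := 2) rfl octahedron_finite
    single_mem_span_octahedron ?_
  · rintro a (rfl | rfl | rfl)
    · exact ⟨0, Or.inl rfl⟩
    · exact ⟨2, Or.inr (by simp [α])⟩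
    · exact ⟨1, Or.inl rfl⟩
  · intro i
    fin_cases i
    · left
      simp [S, α]
    · left
      simp [S, α]
    · right
      simp [S, α]
  · rintro i v (rfl | rfl | rfl | rfl | rfl | rfl) <;> fin_cases i <;>
      simp [α, reflVec_vec, octahedron, mul_assoc, hcc]

theorem G13_spec : FiniteUpstairsGroup G13 ∧ HasCoxeterType (G13.map phi) (CoxeterMatrix.B 3) := by
  set c := (√2)⁻¹ with hc
  have hcc : c * c = 1 / 2 := inv_sqrt_two_mul_self
  have hc0 : c ≠ 0 := by positivity
  have hc4 : cos (π / 4) = c := by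
    rw [cos_pi_div_four]
    apply eq_inv_of_mul_eq_one_left
    rw [div_mul_eq_mul_div, Real.mul_self_sqrt (by norm_num), div_self two_ne_zero]
  let S : Set (Fin 3 → ℝ) := {![0, 0, 1], ![-c, 0, c], ![c, -c, 0]}
  -- Again the generators in the order of the diagram; negating the coordinate vector gives the
  -- angle π/4 the right sign.
  let α : Fin 3 → Fin 3 → ℝ := ![![c, -c, 0], ![-c, 0, c], ![0, 0, -1]]
  have hG : G13 = pauliGroup S := by
    rw [G13, generatedBy, pauliGroup]
    congr 1
    ext g
    simp [S, hc]
  have hα : IsSimpleRoots (CoxeterMatrix.B 3) α := by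
    apply isSimpleRoots_of_rank_three
    · rw [det_fin_three]
      simp [α, hcc]
    · intro i
      fin_cases i <;> simp [α, dotProduct, Fin.sum_univ_succ, hcc] <;> norm_num
    · rw [show CoxeterMatrix.B 3 0 1 = 3 from rfl]
      push_cast
      rw [cos_pi_div_three]
      simp [α, dotProduct, Fin.sum_univ_succ, hcc]
    · rw [show CoxeterMatrix.B 3 0 2 = 2 from rfl]
      push_cast
      rw [cos_pi_div_two]
      simp [α, dotProduct, Fin.sum_univ_succ]
    · rw [show CoxeterMatrix.B 3 1 2 = 4 from rfl]
      push_cast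
      rw [hc4]
      simp [α, dotProduct, Fin.sum_univ_succ]
    · exact fun i j => by fin_cases i <;> fin_cases j <;> exact Nat.succ_ne_zero _
  rw [hG]
  refine pauliGroup_spec hα ?_ ?_ (i := 0) (j := 2) rfl octahedron_finite
    single_mem_span_octahedron ?_
  · rintro a (rfl | rfl | rfl)
    · exact ⟨2, Or.inr (by simp [α])⟩
    · exact ⟨1, Or.inl rfl⟩
    · exact ⟨0, Or.inl rfl⟩
  · intro i
    fin_cases i
    · left
      simp [S, α]
    · left
      simp [S, α]
    · right
      simp [S, α]
  · rintro i v (rfl | rfl | rfl | rfl | rfl | rfl) <;> fin_cases i <;>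
      simp [α, reflVec_vec, octahedron, mul_assoc, hcc] <;> norm_num

/-- The vertices of the icosahedron. -/
def icosahedron (τ : ℝ) : Set (Fin 3 → ℝ) :=
  {v | ∃ s t : ℝ, (s = 1 ∨ s = -1) ∧ (t = 1 ∨ t = -1) ∧
    (v = ![0, s * τ, t] ∨ v = ![t, 0, s * τ] ∨ v = ![s * τ, t, 0])}

theorem icosahedron_finite (τ : ℝ) : (icosahedron τ).Finite := by
  have h : ({1, -1} : Set ℝ).Finite := Set.toFinite _
  refine (((h.prod h).image fun p => ![0, p.1 * τ, p.2]).union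
    (((h.prod h).image fun p => ![p.2, 0, p.1 * τ]).union
      ((h.prod h).image fun p => ![p.1 * τ, p.2, 0]))).subset ?_
  rintro v ⟨s, t, hs, ht, h | h | h⟩
  · exact Or.inl ⟨(s, t), ⟨hs, ht⟩, h.symm⟩
  · exact Or.inr (Or.inl ⟨(s, t), ⟨hs, ht⟩, h.symm⟩)
  · exact Or.inr (Or.inr ⟨(s, t), ⟨hs, ht⟩, h.symm⟩)

theorem single_mem_span_icosahedron (τ : ℝ) (i : Fin 3) :
    Pi.single i 1 ∈ Submodule.span ℝ (icosahedron τ) := by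
  have key : ∀ s t : ℝ, (s = 1 ∨ s = -1) → (t = 1 ∨ t = -1) →
      ![0, s * τ, t] ∈ Submodule.span ℝ (icosahedron τ) ∧
      ![t, 0, s * τ] ∈ Submodule.span ℝ (icosahedron τ) ∧
      ![s * τ, t, 0] ∈ Submodule.span ℝ (icosahedron τ) := fun s t hs ht =>
    ⟨Submodule.subset_span ⟨s, t, hs, ht, Or.inl rfl⟩,
      Submodule.subset_span ⟨s, t, hs, ht, Or.inr (Or.inl rfl)⟩,
      Submodule.subset_span ⟨s, t, hs, ht, Or.inr (Or.inr rfl)⟩⟩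
  obtain ⟨a1, a2, a3⟩ := key 1 1 (Or.inl rfl) (Or.inl rfl)
  obtain ⟨b1, b2, b3⟩ := key (-1) 1 (Or.inr rfl) (Or.inl rfl)
  fin_cases i
  · convert Submodule.smul_mem _ (1 / 2 : ℝ) (Submodule.add_mem _ a2 b2) using 1
    ext j
    fin_cases j <;> simp
    norm_num
  · convert Submodule.smul_mem _ (1 / 2 : ℝ) (Submodule.add_mem _ a3 b3) using 1
    ext j
    fin_cases j <;> simp
    norm_num
  · convert Submodule.smul_mem _ (1 / 2 : ℝ) (Submodule.add_mem _ a1 b1) using 1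
    ext j
    fin_cases j <;> simp
    norm_num

theorem reflVec_mem_icosahedron_of_axis {τ : ℝ} {v : Fin 3 → ℝ} (hv : v ∈ icosahedron τ) :
    reflVec ![0, 1, 0] v ∈ icosahedron τ ∧ reflVec ![0, 0, 1] v ∈ icosahedron τ := by
  obtain ⟨s, t, hs, ht, rfl | rfl | rfl⟩ := hv
  all_goals
    have hs' : -s = 1 ∨ -s = -1 := by rcases hs with rfl | rfl <;> simp
    have ht' : -t = 1 ∨ -t = -1 := by rcases ht with rfl | rfl <;> simp
    rw [reflVec_vec, reflVec_vec]
  · refine ⟨⟨-s, t, hs', ht, Or.inl ?_⟩, ⟨s, -t, hs, ht', Or.inl ?_⟩⟩ <;>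
      ext j <;> fin_cases j <;> simp <;> ring
  · refine ⟨⟨s, t, hs, ht, Or.inr (Or.inl ?_)⟩, ⟨-s, t, hs', ht, Or.inr (Or.inl ?_)⟩⟩ <;>
      ext j <;> fin_cases j <;> simp
    ring
  · refine ⟨⟨s, -t, hs, ht', Or.inr (Or.inr ?_)⟩, ⟨s, t, hs, ht, Or.inr (Or.inr ?_)⟩⟩ <;>
      ext j <;> fin_cases j <;> simp
    ring

/-- The relation τ² = τ + 1 makes each product with the normal equal to 0, ±1 or ±τ. The cases are
indexed by the relative sign of the two coordinates and by the position of the zero. -/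
theorem reflVec_mem_icosahedron {τ : ℝ} (hτ : τ ^ 2 = τ + 1) {v : Fin 3 → ℝ}
    (hv : v ∈ icosahedron τ) :
    reflVec ![-((τ - 1) / 2), -(1 / 2), -(τ / 2)] v ∈ icosahedron τ := by
  obtain ⟨s, t, hs, ht, hv⟩ := hv
  have hs' : -s = 1 ∨ -s = -1 := by rcases hs with rfl | rfl <;> simp
  have hst : t = s ∨ t = -s := by
    rcases hs with rfl | rfl <;> rcases ht with rfl | rfl <;> simp
  rcases hst with rfl | rfl <;> rcases hv with rfl | rfl | rfl
  · rw [reflVec_vec_of_eq (d := -(t * τ)) (by ring)]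
    refine ⟨-t, -t, hs', hs', Or.inr (Or.inl ?_)⟩
    ext j
    fin_cases j <;> simp
    all_goals try linear_combination t * hτ
    all_goals try linear_combination (-t) * hτ
    all_goals ring
  · rw [reflVec_vec_of_eq (d := -(t * τ)) (by linear_combination (-t / 2) * hτ)]
    refine ⟨-t, -t, hs', hs', Or.inl ?_⟩
    ext j
    fin_cases j <;> simp
    all_goals try linear_combination (-t) * hτ
    all_goals ring
  · rw [reflVec_vec_of_eq (d := -t) (by linear_combination (-t / 2) * hτ)]
    refine ⟨-t, t, hs', hs, Or.inr (Or.inl ?_)⟩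
    ext j
    fin_cases j <;> simp
    all_goals ring
  · rw [reflVec_vec_of_eq (d := 0) (by ring)]
    refine ⟨s, -s, hs, hs', Or.inl ?_⟩
    ext j
    fin_cases j <;> simp
  · rw [reflVec_vec_of_eq (d := -s) (by linear_combination (-s / 2) * hτ)]
    refine ⟨-s, -s, hs', hs', Or.inr (Or.inr ?_)⟩
    ext j
    fin_cases j <;> simp
    all_goals ring
  · rw [reflVec_vec_of_eq (d := 0) (by linear_combination (-s / 2) * hτ)]
    refine ⟨s, -s, hs, hs', Or.inr (Or.inr ?_)⟩
    ext j
    fin_cases j <;> simp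

theorem G22_spec : FiniteUpstairsGroup G22 ∧ HasCoxeterType (G22.map phi) CoxeterMatrix.H₃ := by
  have hτ : goldenRatio ^ 2 = goldenRatio + 1 := goldenRatio_sq
  have hinv : goldenRatio⁻¹ = goldenRatio - 1 := by
    rw [inv_goldenRatio]
    linarith [goldenRatio_add_goldenConj]
  have hcos : cos (π / 5) = goldenRatio / 2 := by
    rw [cos_pi_div_five, goldenRatio]
    ring
  have hg : G22 = generatedBy {pauli 0 0 1, pauli 0 1 0,
      pauli ((goldenRatio - 1) / 2) (1 / 2) (goldenRatio / 2)} := by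
    rw [G22, hinv]
  generalize goldenRatio = τ at hτ hcos hg
  let S : Set (Fin 3 → ℝ) := {![0, 0, 1], ![0, 1, 0], ![(τ - 1) / 2, 1 / 2, τ / 2]}
  -- The generator linked to both others is placed in the middle and negated.
  let α : Fin 3 → Fin 3 → ℝ := ![![0, 1, 0], ![-((τ - 1) / 2), -(1 / 2), -(τ / 2)], ![0, 0, 1]]
  have hG : G22 = pauliGroup S := by
    rw [hg, generatedBy, pauliGroup]
    congr 1
    ext g
    simp [S]
  have hα : IsSimpleRoots CoxeterMatrix.H₃ α := by
    apply isSimpleRoots_of_rank_three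
    · rw [det_fin_three]
      simp [α]
      intro h
      nlinarith
    · intro i
      fin_cases i <;> simp [α, dotProduct, Fin.sum_univ_succ]
      linear_combination (1 / 2) * hτ
    · rw [show CoxeterMatrix.H₃ 0 1 = 3 from rfl]
      push_cast
      rw [cos_pi_div_three]
      simp [α, dotProduct, Fin.sum_univ_succ]
    · rw [show CoxeterMatrix.H₃ 0 2 = 2 from rfl]
      push_cast
      rw [cos_pi_div_two]
      simp [α, dotProduct, Fin.sum_univ_succ]
    · rw [show CoxeterMatrix.H₃ 1 2 = 5 from rfl]
      push_cast
      rw [hcos]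
      simp [α, dotProduct, Fin.sum_univ_succ]
    · exact fun i j => by fin_cases i <;> fin_cases j <;> exact Nat.succ_ne_zero _
  rw [hG]
  refine pauliGroup_spec hα ?_ ?_ (i := 0) (j := 2) rfl (icosahedron_finite τ)
    (single_mem_span_icosahedron τ) ?_
  · rintro a (rfl | rfl | rfl)
    · exact ⟨2, Or.inl rfl⟩
    · exact ⟨0, Or.inl rfl⟩
    · exact ⟨1, Or.inr (by simp [α])⟩
  · intro i
    fin_cases i
    · left
      simp [S, α]
    · right
      simp [S, α]
    · left
      simp [S, α]
  · intro i v hv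
    fin_cases i
    · exact (reflVec_mem_icosahedron_of_axis hv).1
    · exact reflVec_mem_icosahedron hτ hv
    · exact (reflVec_mem_icosahedron_of_axis hv).2

end Examples

/-! ### Graded invariants -/

section Graded

variable {n : ℕ}

/-- An algebra homomorphism multiplying degrees by `k` is compatible with the gradings. -/
theorem map_homogeneousComponent {σ τ : Type*} {k : ℕ} (hk : 0 < k)
    (f : MvPolynomial σ ℂ →ₐ[ℂ] MvPolynomial τ ℂ)
    (hf : ∀ d p, p.IsHomogeneous d → (f p).IsHomogeneous (k * d)) (d : ℕ) (p : MvPolynomial σ ℂ) :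
    f (homogeneousComponent d p) = homogeneousComponent (k * d) (f p) := by
  conv_rhs => rw [← sum_homogeneousComponent p, map_sum, map_sum]
  have h1 : ∀ i, homogeneousComponent (k * d) (f (homogeneousComponent i p)) =
      if i = d then f (homogeneousComponent i p) else 0 := by
    intro i
    rw [homogeneousComponent_of_mem (hf i _ (homogeneousComponent_isHomogeneous i p))]
    simp only [Nat.mul_right_inj hk.ne', eq_comm]
  simp only [h1]
  rw [Finset.sum_ite_eq']
  split_ifs with h
  · rfl
  · rw [homogeneousComponent_eq_zero _ _ (by simpa using h), map_zero]

theorem homogeneousComponent_eq_zero_of_ne {σ τ : Type*} {k : ℕ}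
    (f : MvPolynomial σ ℂ →ₐ[ℂ] MvPolynomial τ ℂ)
    (hf : ∀ d p, p.IsHomogeneous d → (f p).IsHomogeneous (k * d)) (e : ℕ) (he : ∀ d, k * d ≠ e)
    (p : MvPolynomial σ ℂ) : homogeneousComponent e (f p) = 0 := by
  rw [← sum_homogeneousComponent p, map_sum, map_sum]
  refine Finset.sum_eq_zero fun i _ => ?_
  rw [homogeneousComponent_of_mem (hf i _ (homogeneousComponent_isHomogeneous i p)),
    if_neg (fun h => he i h.symm)]

theorem pullback_X (g : Matrix (Fin n) (Fin n) ℂ) (i : Fin n) :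
    pullback g (X i) = ∑ j, C (g i j) * X j := by
  rw [pullback, aeval_X]

theorem pullback_C (g : Matrix (Fin n) (Fin n) ℂ) (c : ℂ) : pullback g (C c) = C c :=
  AlgHom.commutes _ c

theorem isHomogeneous_pullback (g : Matrix (Fin n) (Fin n) ℂ) {p : MvPolynomial (Fin n) ℂ} {d : ℕ}
    (hp : p.IsHomogeneous d) : (pullback g p).IsHomogeneous d := by
  have := hp.aeval (fun i => ∑ j, C (g i j) * X j) (n := 1) fun i =>
    IsHomogeneous.sum _ _ _ fun j _ => isHomogeneous_C_mul_X _ _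
  rwa [one_mul] at this

theorem pullback_homogeneousComponent (g : Matrix (Fin n) (Fin n) ℂ) (d : ℕ)
    (p : MvPolynomial (Fin n) ℂ) :
    pullback g (homogeneousComponent d p) = homogeneousComponent d (pullback g p) := by
  have := map_homogeneousComponent one_pos (pullback g)
    (fun d p hp => by rw [one_mul]; exact isHomogeneous_pullback g hp) d p
  rwa [one_mul] at this

theorem constantCoeff_pullback (g : Matrix (Fin n) (Fin n) ℂ) (p : MvPolynomial (Fin n) ℂ) :
    constantCoeff (pullback g p) = constantCoeff p := by
  have : (constantCoeff : MvPolynomial (Fin n) ℂ →+* ℂ).comp (pullback g).toRingHom =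
      constantCoeff := by
    apply MvPolynomial.ringHom_ext
    · intro c
      simp
    · intro i
      simp [pullback_X]
  exact RingHom.congr_fun this p

variable {G : Subgroup (GL (Fin n) ℂ)}

/-- The algebra of invariants. -/
def invariants (G : Subgroup (GL (Fin n) ℂ)) : Subalgebra ℂ (MvPolynomial (Fin n) ℂ) where
  carrier := {f | ∀ g ∈ G, pullback g f = f}
  mul_mem' ha hb g hg := by rw [map_mul, ha g hg, hb g hg]
  add_mem' ha hb g hg := by rw [map_add, ha g hg, hb g hg]
  algebraMap_mem' c g _ := AlgHom.commutes _ c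

theorem mul_mem_posInvariants {f p : MvPolynomial (Fin n) ℂ} (hf : f ∈ invariants G)
    (hp : p ∈ posInvariants G) : f * p ∈ posInvariants G :=
  ⟨(invariants G).mul_mem hf hp.1, by rw [map_mul, hp.2, mul_zero]⟩

theorem sub_constantCoeff_mem {f : MvPolynomial (Fin n) ℂ} (hf : f ∈ invariants G) :
    f - C (constantCoeff f) ∈ posInvariants G :=
  ⟨(invariants G).sub_mem hf ((invariants G).algebraMap_mem _), by simp⟩

theorem modSq_eq_zero {f : MvPolynomial (Fin n) ℂ} :
    modSq G f = 0 ↔ f ∈ posInvariants G * posInvariants G :=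
  Submodule.Quotient.mk_eq_zero _

/-- Modulo the square, an invariant acts through its constant coefficient. -/
theorem modSq_mul {f p : MvPolynomial (Fin n) ℂ} (hf : f ∈ invariants G)
    (hp : p ∈ posInvariants G) : modSq G (f * p) = constantCoeff f • modSq G p := by
  rw [← map_smul, ← sub_eq_zero, ← map_sub, modSq_eq_zero, smul_eq_C_mul, ← sub_mul]
  exact Submodule.mul_mem_mul (sub_constantCoeff_mem hf) hp

theorem homogeneousComponent_mem_invariants {f : MvPolynomial (Fin n) ℂ} (hf : f ∈ invariants G)
    (d : ℕ) : homogeneousComponent d f ∈ invariants G := fun g hg => by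
  rw [pullback_homogeneousComponent, hf g hg]

theorem constantCoeff_homogeneousComponent {f : MvPolynomial (Fin n) ℂ}
    (hf : constantCoeff f = 0) (d : ℕ) : constantCoeff (homogeneousComponent d f) = 0 := by
  rw [constantCoeff_eq] at hf ⊢
  rw [coeff_homogeneousComponent]
  split_ifs
  · exact hf
  · rfl

theorem homogeneousComponent_mem_posInvariants {f : MvPolynomial (Fin n) ℂ}
    (hf : f ∈ posInvariants G) (d : ℕ) : homogeneousComponent d f ∈ posInvariants G :=
  ⟨homogeneousComponent_mem_invariants hf.1 d, constantCoeff_homogeneousComponent hf.2 d⟩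

theorem homogeneousComponent_mem_mul {f : MvPolynomial (Fin n) ℂ}
    (hf : f ∈ posInvariants G * posInvariants G) (d : ℕ) :
    homogeneousComponent d f ∈ posInvariants G * posInvariants G := by
  induction hf using Submodule.mul_induction_on' with
  | mem_mul_mem a ha b hb =>
    rw [← sum_homogeneousComponent a, ← sum_homogeneousComponent b, Finset.sum_mul_sum, map_sum]
    refine Submodule.sum_mem _ fun i _ => ?_
    rw [map_sum]
    refine Submodule.sum_mem _ fun j _ => ?_
    rw [homogeneousComponent_of_mem ((homogeneousComponent_isHomogeneous i a).mul
      (homogeneousComponent_isHomogeneous j b))]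
    split_ifs
    · exact Submodule.mul_mem_mul (homogeneousComponent_mem_posInvariants ha i)
        (homogeneousComponent_mem_posInvariants hb j)
    · exact Submodule.zero_mem _
  | add x _ y _ hx hy =>
    rw [map_add]
    exact Submodule.add_mem _ hx hy

theorem mul_posInvariants_le : posInvariants G * posInvariants G ≤ posInvariants G :=
  Submodule.mul_le.2 fun _ ha _ hb => mul_mem_posInvariants ha.1 hb

/-- The degrees are those of any homogeneous basis of the cotangent space. -/
theorem hasDegrees_of_basis {k : ℕ} {f : Fin k → MvPolynomial (Fin n) ℂ} {e : Fin k → ℕ}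
    (hf : ∀ i, f i ∈ posInvariants G) (he : ∀ i, (f i).IsHomogeneous (e i))
    (hli : LinearIndependent ℂ fun i => modSq G (f i))
    (hspan : ∀ d p, p ∈ posInvariants G → p.IsHomogeneous d →
      modSq G p ∈ Submodule.span ℂ (Set.range fun i => modSq G (f i))) :
    HasDegrees G (Finset.univ.val.map e) := by
  intro d
  have hV : (posInvariants G ⊓ homogeneousSubmodule (Fin n) ℂ d).map (modSq G) =
      Submodule.span ℂ (Set.range fun i : {i // e i = d} => modSq G (f i)) := by
    apply le_antisymm
    · rintro _ ⟨p, ⟨hp, hpd⟩, rfl⟩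
      have hpd : p.IsHomogeneous d := hpd
      obtain ⟨c, hc⟩ := (Submodule.mem_span_range_iff_exists_fun ℂ).1 (hspan d p hp hpd)
      simp only [← map_smul] at hc
      rw [← map_sum, ← sub_eq_zero, ← map_sub, modSq_eq_zero] at hc
      -- The square is graded, so taking components of degree `d` removes from the combination all
      -- basis elements of other degrees.
      have h1 := homogeneousComponent_mem_mul hc d
      rw [map_sub, map_sum, homogeneousComponent_eq_self hpd, ← modSq_eq_zero, map_sub,
        sub_eq_zero] at h1
      rw [← h1, map_sum]
      refine Submodule.sum_mem _ fun i _ => ?_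
      rw [map_smul, homogeneousComponent_of_mem (he i), map_smul]
      apply Submodule.smul_mem
      split_ifs with h
      · exact Submodule.subset_span ⟨⟨i, h.symm⟩, rfl⟩
      · rw [map_zero]
        exact Submodule.zero_mem _
    · rw [Submodule.span_le]
      rintro _ ⟨⟨i, hi⟩, rfl⟩
      exact ⟨f i, ⟨hf i, hi ▸ he i⟩, rfl⟩
  have hcard := finrank_span_eq_card (hli.comp (Subtype.val : {i // e i = d} → Fin k)
    Subtype.val_injective)
  rw [degreeMultiplicity, hV]
  refine hcard.trans ?_
  rw [Multiset.count_map, Fintype.card_subtype, Finset.card_def, Finset.filter_val]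
  simp only [eq_comm]

/-- The Reynolds operator. -/
def reynolds (G : Subgroup (GL (Fin n) ℂ)) [Fintype G] :
    MvPolynomial (Fin n) ℂ →ₗ[ℂ] MvPolynomial (Fin n) ℂ :=
  (Fintype.card G : ℂ)⁻¹ • ∑ g : G,
    (pullback ((g : GL (Fin n) ℂ) : Matrix (Fin n) (Fin n) ℂ)).toLinearMap

variable [Fintype G]

theorem reynolds_apply (f : MvPolynomial (Fin n) ℂ) :
    reynolds G f = (Fintype.card G : ℂ)⁻¹ • ∑ g : G,
      pullback ((g : GL (Fin n) ℂ) : Matrix (Fin n) (Fin n) ℂ) f := by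
  simp [reynolds]

theorem pullback_reynolds {g : GL (Fin n) ℂ} (hg : g ∈ G) (f : MvPolynomial (Fin n) ℂ) :
    pullback (g : Matrix (Fin n) (Fin n) ℂ) (reynolds G f) = reynolds G f := by
  rw [reynolds_apply, map_smul, map_sum]
  have h : ∀ x : G, pullback (g : Matrix (Fin n) (Fin n) ℂ)
      (pullback ((x : GL (Fin n) ℂ) : Matrix (Fin n) (Fin n) ℂ) f) =
      pullback (((x * ⟨g, hg⟩ : G) : GL (Fin n) ℂ) : Matrix (Fin n) (Fin n) ℂ) f := by
    intro x
    rw [← pullback_mul, Subgroup.coe_mul, Units.val_mul]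
  simp only [h]
  exact congrArg ((Fintype.card G : ℂ)⁻¹ • ·) (Equiv.sum_comp (Equiv.mulRight (⟨g, hg⟩ : G))
    (fun x : G => pullback ((x : GL (Fin n) ℂ) : Matrix (Fin n) (Fin n) ℂ) f))

theorem reynolds_mem (f : MvPolynomial (Fin n) ℂ) : reynolds G f ∈ invariants G :=
  fun _ hg => pullback_reynolds hg f

theorem reynolds_of_mem {f : MvPolynomial (Fin n) ℂ} (hf : f ∈ invariants G) :
    reynolds G f = f := by
  have h : ∀ g : G, pullback ((g : GL (Fin n) ℂ) : Matrix (Fin n) (Fin n) ℂ) f = f :=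
    fun g => hf g g.2
  simp only [reynolds_apply, h]
  rw [Finset.sum_const, Finset.card_univ,
    ← Nat.cast_smul_eq_nsmul ℂ, smul_smul, inv_mul_cancel₀ (by exact_mod_cast Fintype.card_ne_zero),
    one_smul]

theorem reynolds_mul {f : MvPolynomial (Fin n) ℂ} (hf : f ∈ invariants G)
    (p : MvPolynomial (Fin n) ℂ) : reynolds G (f * p) = f * reynolds G p := by
  rw [reynolds_apply, reynolds_apply, mul_smul_comm, Finset.mul_sum]
  congr 1
  exact Finset.sum_congr rfl fun g _ => by rw [map_mul, hf g g.2]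

theorem constantCoeff_reynolds (f : MvPolynomial (Fin n) ℂ) :
    constantCoeff (reynolds G f) = constantCoeff f := by
  rw [reynolds_apply, smul_eq_C_mul, map_mul, constantCoeff_C, map_sum]
  simp only [constantCoeff_pullback]
  rw [Finset.sum_const, Finset.card_univ, nsmul_eq_mul, inv_mul_cancel_left₀
    (by exact_mod_cast Fintype.card_ne_zero)]

end Graded

/-! ### Relations between invariants of a reflection group -/

section Chevalley

open Matrix

variable {n : ℕ} {W : Subgroup (GL (Fin n) ℂ)}

/-- The ideal generated by the invariants without constant term. -/
def hilbertIdeal (W : Subgroup (GL (Fin n) ℂ)) : Ideal (MvPolynomial (Fin n) ℂ) :=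
  Ideal.span (posInvariants W)

theorem mem_hilbertIdeal {f : MvPolynomial (Fin n) ℂ} (hf : f ∈ posInvariants W) :
    f ∈ hilbertIdeal W := Ideal.subset_span hf

theorem pullback_mem_hilbertIdeal {w : GL (Fin n) ℂ} (hw : w ∈ W) {f : MvPolynomial (Fin n) ℂ}
    (hf : f ∈ hilbertIdeal W) :
    pullback (w : Matrix (Fin n) (Fin n) ℂ) f ∈ hilbertIdeal W := by
  have h : hilbertIdeal W ≤ (hilbertIdeal W).comap
      (pullback (w : Matrix (Fin n) (Fin n) ℂ)).toRingHom := by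
    refine Ideal.span_le.2 fun a ha => ?_
    change pullback (w : Matrix (Fin n) (Fin n) ℂ) a ∈ hilbertIdeal W
    rw [ha.1 w hw]
    exact mem_hilbertIdeal ha
  exact h hf

theorem constantCoeff_of_mem_hilbertIdeal {f : MvPolynomial (Fin n) ℂ}
    (hf : f ∈ hilbertIdeal W) : constantCoeff f = 0 := by
  have h : hilbertIdeal W ≤ RingHom.ker (constantCoeff : MvPolynomial (Fin n) ℂ →+* ℂ) :=
    Ideal.span_le.2 fun a ha => ha.2
  exact h hf

/-- The linear form with given coefficients. -/
def linearForm (v : Fin n → ℂ) : MvPolynomial (Fin n) ℂ := ∑ j, C (v j) * X j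

theorem isHomogeneous_linearForm (v : Fin n → ℂ) : (linearForm v).IsHomogeneous 1 :=
  IsHomogeneous.sum _ _ _ fun _ _ => isHomogeneous_C_mul_X _ _

theorem linearForm_ne_zero {v : Fin n → ℂ} (hv : v ≠ 0) : linearForm v ≠ 0 := by
  obtain ⟨i, hi⟩ := Function.ne_iff.1 hv
  intro h
  have h1 := congrArg (eval (Pi.single i 1)) h
  simp only [linearForm, map_sum, map_mul, eval_C, eval_X, Pi.single_apply, mul_ite, mul_one,
    mul_zero, Finset.sum_ite_eq', Finset.mem_univ, if_true, map_zero] at h1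
  exact hi h1

theorem linearForm_dvd_pullback_sub (u v : Fin n → ℂ) (f : MvPolynomial (Fin n) ℂ) :
    linearForm v ∣ pullback (1 + vecMulVec u v) f - f := by
  induction f using MvPolynomial.induction_on with
  | C a => rw [pullback_C, sub_self]; exact dvd_zero _
  | add p q hp hq =>
    rw [map_add, add_sub_add_comm]
    exact dvd_add hp hq
  | mul_X p i hp =>
    have hX : pullback (1 + vecMulVec u v) (X i) - X i = C (u i) * linearForm v := by
      rw [pullback_X, linearForm, Finset.mul_sum]
      simp only [Matrix.add_apply, Matrix.one_apply, vecMulVec_apply, C_add, add_mul,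
        Finset.sum_add_distrib, C_mul, mul_assoc]
      simp
    have : pullback (1 + vecMulVec u v) (p * X i) - p * X i =
        (pullback (1 + vecMulVec u v) p - p) * pullback (1 + vecMulVec u v) (X i) +
          p * (pullback (1 + vecMulVec u v) (X i) - X i) := by
      rw [map_mul]; ring
    rw [this, hX]
    exact dvd_add (Dvd.dvd.mul_right hp _) (Dvd.intro_left (p * C (u i)) (by ring))

theorem totalDegree_pullback_le (g : Matrix (Fin n) (Fin n) ℂ) (f : MvPolynomial (Fin n) ℂ) :
    (pullback g f).totalDegree ≤ f.totalDegree := by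
  conv_lhs => rw [← sum_homogeneousComponent f, map_sum]
  refine totalDegree_finsetSum_le fun i hi => ?_
  exact (isHomogeneous_pullback g (homogeneousComponent_isHomogeneous i f)).totalDegree_le.trans
    (Nat.lt_succ_iff.1 (Finset.mem_range.1 hi))

/-- In a relation between invariants, either a coefficient is in the Hilbert ideal, or the
corresponding invariant is redundant. -/
theorem coeff_mem_hilbertIdeal [Finite W] (hW : GeneratedByReflections W) {k : ℕ}
    {g : Fin (k + 1) → MvPolynomial (Fin n) ℂ} (hg : ∀ i, g i ∈ invariants W)
    (hno : ∀ u ∈ invariants W, ∀ a : Fin k → MvPolynomial (Fin n) ℂ, (∀ i, a i ∈ invariants W) →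
      u * g 0 = ∑ i, a i * g i.succ → constantCoeff u = 0) (N : ℕ) :
    ∀ h : Fin (k + 1) → MvPolynomial (Fin n) ℂ, (h 0).totalDegree < N → ∑ i, g i * h i = 0 →
      h 0 ∈ hilbertIdeal W := by
  have := Fintype.ofFinite W
  induction N with
  | zero => intro h h0; exact absurd h0 (Nat.not_lt_zero _)
  | succ N ih =>
    intro h h0 hrel
    -- Apply a reflection to the relation, subtract, and divide by the linear form of its
    -- hyperplane: the quotients satisfy a relation of the same kind with first coefficient of
    -- smaller degree.
    have hrefl : ∀ s ∈ W, IsReflection s →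
        pullback (s : Matrix (Fin n) (Fin n) ℂ) (h 0) - h 0 ∈ hilbertIdeal W := by
      intro s hs hsr
      obtain ⟨u, v, hsv, huv⟩ := hsr.exists_eq
      have hv : v ≠ 0 := by
        rintro rfl
        simp at huv
      have hl := linearForm_ne_zero hv
      choose q hq using fun i => linearForm_dvd_pullback_sub u v (h i)
      have hrel' : ∑ i, g i * q i = 0 := by
        apply mul_left_cancel₀ hl
        rw [mul_zero, Finset.mul_sum]
        have h1 : pullback (s : Matrix (Fin n) (Fin n) ℂ) (∑ i, g i * h i) - ∑ i, g i * h i =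
            0 := by
          rw [hrel, map_zero, sub_zero]
        rw [map_sum, ← Finset.sum_sub_distrib] at h1
        rw [← h1]
        refine Finset.sum_congr rfl fun i _ => ?_
        rw [map_mul, hg i s hs, ← mul_sub, hsv, hq i]
        ring
      rw [hsv, hq 0]
      apply Ideal.mul_mem_left
      by_cases hq0 : q 0 = 0
      · rw [hq0]
        exact Ideal.zero_mem _
      refine ih q ?_ hrel'
      have h2 := totalDegree_mul_of_isDomain hl hq0
      rw [← hq 0, (isHomogeneous_linearForm v).totalDegree hl] at h2
      have h3 := (totalDegree_sub (pullback (1 + vecMulVec u v) (h 0)) (h 0)).trans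
        (max_le (totalDegree_pullback_le _ _) le_rfl)
      omega
    -- Modulo the Hilbert ideal, which is stable under `W`, invariance passes from reflections to
    -- the group they generate.
    have hall : ∀ w ∈ W,
        pullback (w : Matrix (Fin n) (Fin n) ℂ) (h 0) - h 0 ∈ hilbertIdeal W := by
      intro w hw
      have hle : Subgroup.closure {g | g ∈ W ∧ IsReflection g} ≤ W := hW.le
      rw [← hW] at hw
      induction hw using Subgroup.closure_induction with
      | mem x hx => exact hrefl x hx.1 hx.2
      | one => rw [Units.val_one, pullback_one, sub_self]; exact Ideal.zero_mem _
      | mul x y hx hy ihx ihy =>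
        have : pullback ((x * y : GL (Fin n) ℂ) : Matrix (Fin n) (Fin n) ℂ) (h 0) - h 0 =
            pullback (y : Matrix (Fin n) (Fin n) ℂ)
              (pullback (x : Matrix (Fin n) (Fin n) ℂ) (h 0) - h 0) +
            (pullback (y : Matrix (Fin n) (Fin n) ℂ) (h 0) - h 0) := by
          rw [Units.val_mul, pullback_mul, map_sub]; ring
        rw [this]
        exact Ideal.add_mem _ (pullback_mem_hilbertIdeal (hle hy) ihx) ihy
      | inv x hx ihx =>
        have : pullback ((x⁻¹ : GL (Fin n) ℂ) : Matrix (Fin n) (Fin n) ℂ) (h 0) - h 0 =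
            -pullback ((x⁻¹ : GL (Fin n) ℂ) : Matrix (Fin n) (Fin n) ℂ)
              (pullback (x : Matrix (Fin n) (Fin n) ℂ) (h 0) - h 0) := by
          rw [map_sub, ← pullback_mul, Units.mul_inv, pullback_one]; ring
        rw [this]
        exact neg_mem (pullback_mem_hilbertIdeal (W.inv_mem (hle hx)) ihx)
    -- Averaging the relation expresses `reynolds W (h 0) * g 0` through the other `g i` with
    -- invariant coefficients, so `hno` kills its constant term. Also `h 0` is congruent to its
    -- average.
    have hR : reynolds W (h 0) ∈ hilbertIdeal W := by
      refine mem_hilbertIdeal ⟨reynolds_mem _, ?_⟩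
      refine hno _ (reynolds_mem _) (fun i => -reynolds W (h i.succ))
        (fun i => (invariants W).neg_mem (reynolds_mem _)) ?_
      have h1 : reynolds W (∑ i, g i * h i) = 0 := by rw [hrel, map_zero]
      rw [map_sum, Fin.sum_univ_succ] at h1
      simp only [reynolds_mul (hg _)] at h1
      simp only [neg_mul, Finset.sum_neg_distrib]
      rw [mul_comm, eq_neg_iff_add_eq_zero, ← h1]
      simp only [mul_comm]
    have hD : reynolds W (h 0) - h 0 ∈ hilbertIdeal W := by
      have h1 : reynolds W (h 0) - h 0 = C ((Fintype.card W : ℂ)⁻¹) * ∑ w : W,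
          (pullback ((w : GL (Fin n) ℂ) : Matrix (Fin n) (Fin n) ℂ) (h 0) - h 0) := by
        rw [Finset.sum_sub_distrib, mul_sub, ← smul_eq_C_mul, ← smul_eq_C_mul, ← reynolds_apply,
          Finset.sum_const, Finset.card_univ, ← Nat.cast_smul_eq_nsmul ℂ, smul_smul,
          inv_mul_cancel₀ (by exact_mod_cast Fintype.card_ne_zero), one_smul]
      rw [h1]
      exact Ideal.mul_mem_left _ _ (Ideal.sum_mem _ fun w _ => hall w w.2)
    have := Ideal.sub_mem _ hR hD
    rwa [sub_sub_cancel] at this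

/-- Expand `p` in positive invariants: averaging pulls each of them out, and the average left over
still has no constant term because of the factor `x`. -/
theorem reynolds_mul_mem_sq [Fintype W] {p : MvPolynomial (Fin n) ℂ} (hp : p ∈ hilbertIdeal W) :
    ∀ x : MvPolynomial (Fin n) ℂ, constantCoeff x = 0 →
      reynolds W (x * p) ∈ posInvariants W * posInvariants W := by
  induction hp using Submodule.span_induction with
  | mem a ha =>
    intro x hx
    rw [mul_comm x, reynolds_mul ha.1]
    exact Submodule.mul_mem_mul ha ⟨reynolds_mem _, by rw [constantCoeff_reynolds, hx]⟩
  | zero => intro x _; rw [mul_zero, map_zero]; exact Submodule.zero_mem _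
  | add a b _ _ iha ihb =>
    intro x hx
    rw [mul_add, map_add]
    exact Submodule.add_mem _ (iha x hx) (ihb x hx)
  | smul r a _ ih =>
    intro x hx
    rw [smul_eq_mul, ← mul_assoc]
    exact ih _ (by rw [map_mul, hx, zero_mul])

/-- Linear independence of a shear of a linearly independent family. -/
theorem linearIndependent_shear {V : Type*} [AddCommGroup V] [Module ℂ V] {k : ℕ}
    {v : Fin (k + 1) → V} (hv : LinearIndependent ℂ v) {c : ℂ} (hc : c ≠ 0) (b : Fin k → ℂ) :
    LinearIndependent ℂ fun i : Fin k => c • v i.succ + b i • v 0 := by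
  rw [Fintype.linearIndependent_iff] at hv ⊢
  intro t ht i
  have h1 := hv (Fin.cons (∑ i, t i * b i) fun i => t i * c) (by
    rw [Fin.sum_univ_succ]
    simp only [Fin.cons_zero, Fin.cons_succ]
    rw [← ht, Finset.sum_smul, ← Finset.sum_add_distrib]
    refine Finset.sum_congr rfl fun i _ => ?_
    rw [smul_add, smul_smul, smul_smul, add_comm]) i.succ
  rw [Fin.cons_succ] at h1
  exact (mul_eq_zero.1 h1).resolve_right hc

end Chevalley

/-! ### Jacobians, and at most two independent classes in the cotangent space of the plane. -/

section Plane

open Matrix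

variable {W : Subgroup (GL (Fin 2) ℂ)}

/-- If `g 0` is not redundant, then `hx 0` and `hy 0` lie in the Hilbert ideal; averaging X₀ hx₀ +
X₁ hy₀ puts it in the square, against independence. If `u * g 0` is a combination of the others with
`u` nonzero at the origin, eliminate `g 0`: the new invariants are a shear of the old ones modulo
squares, and induction applies. -/
theorem eq_zero_of_relations [Finite W] (hW : GeneratedByReflections W) {k : ℕ} :
    ∀ {g hx hy : Fin k → MvPolynomial (Fin 2) ℂ}, (∀ i, g i ∈ invariants W) →
    ∑ i, g i * hx i = 0 → ∑ i, g i * hy i = 0 →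
    (∀ i, X 0 * hx i + X 1 * hy i ∈ posInvariants W) →
    LinearIndependent ℂ (fun i => modSq W (X 0 * hx i + X 1 * hy i)) → ∀ i, g i = 0 := by
  have := Fintype.ofFinite W
  induction k with
  | zero => intro g hx hy _ _ _ _ _ i; exact i.elim0
  | succ k ih =>
    intro g hx hy hg hgx hgy hF hli
    by_cases hno : ∀ u ∈ invariants W, ∀ a : Fin k → MvPolynomial (Fin 2) ℂ,
      (∀ i, a i ∈ invariants W) → u * g 0 = ∑ i, a i * g i.succ → constantCoeff u = 0
    · exfalso
      apply hli.ne_zero 0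
      rw [modSq_eq_zero, ← reynolds_of_mem (hF 0).1, map_add]
      exact Submodule.add_mem _
        (reynolds_mul_mem_sq (coeff_mem_hilbertIdeal hW hg hno _ hx (Nat.lt_succ_self _) hgx) _
          (by simp))
        (reynolds_mul_mem_sq (coeff_mem_hilbertIdeal hW hg hno _ hy (Nat.lt_succ_self _) hgy) _
          (by simp))
    · push Not at hno
      obtain ⟨u, hu, a, ha, hua, hu0⟩ := hno
      have hrel : ∀ h : Fin (k + 1) → MvPolynomial (Fin 2) ℂ, ∑ i, g i * h i = 0 →
          ∑ i : Fin k, g i.succ * (u * h i.succ + a i * h 0) = 0 := by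
        intro h hh
        have h1 : u * ∑ i, g i * h i = 0 := by rw [hh, mul_zero]
        rw [Fin.sum_univ_succ, mul_add, ← mul_assoc, hua, Finset.sum_mul, Finset.mul_sum,
          ← Finset.sum_add_distrib] at h1
        rw [← h1]
        exact Finset.sum_congr rfl fun i _ => by ring
      have hF' : ∀ i : Fin k, X 0 * (u * hx i.succ + a i * hx 0) +
          X 1 * (u * hy i.succ + a i * hy 0) =
          u * (X 0 * hx i.succ + X 1 * hy i.succ) + a i * (X 0 * hx 0 + X 1 * hy 0) := by
        intro i; ring
      have hsucc := ih (g := fun i => g i.succ) (fun i => hg i.succ) (hrel hx hgx) (hrel hy hgy)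
        (fun i => by
          rw [hF']
          exact Submodule.add_mem _ (mul_mem_posInvariants hu (hF _))
            (mul_mem_posInvariants (ha i) (hF _)))
        (by
          simp only [hF', map_add, modSq_mul hu (hF _), modSq_mul (ha _) (hF _)]
          simp only [← map_add]
          exact linearIndependent_shear hli hu0 fun i => constantCoeff (a i))
      intro i
      refine Fin.cases ?_ hsucc i
      have hune : u ≠ 0 := by
        rintro rfl
        exact hu0 (map_zero _)
      apply (mul_eq_zero.1 _).resolve_left hune
      rw [hua]
      exact Finset.sum_eq_zero fun i _ => by rw [hsucc i, mul_zero]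

/-- The Jacobian determinant. -/
def jacobian (f g : MvPolynomial (Fin 2) ℂ) : MvPolynomial (Fin 2) ℂ :=
  pderiv 0 f * pderiv 1 g - pderiv 1 f * pderiv 0 g

theorem pderiv_pullback {n : ℕ} (w : Matrix (Fin n) (Fin n) ℂ) (i : Fin n)
    (f : MvPolynomial (Fin n) ℂ) :
    pderiv i (pullback w f) = ∑ k, C (w k i) * pullback w (pderiv k f) := by
  induction f using MvPolynomial.induction_on with
  | C a => simp
  | add p q hp hq => simp only [map_add, hp, hq, mul_add, Finset.sum_add_distrib]
  | mul_X p j hp =>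
    have hX : pderiv i (pullback w (X j)) = C (w j i) := by
      rw [pullback_X, map_sum]
      simp [pderiv_X, Pi.single_apply]
    rw [map_mul, Derivation.leibniz, hp, hX]
    simp only [Derivation.leibniz, map_add, map_mul, smul_eq_mul, mul_add, Finset.sum_add_distrib,
      pderiv_X, Finset.mul_sum]
    congr 1
    · rw [Finset.sum_eq_single j]
      · simp [mul_comm]
      · intro b _ hb
        simp [hb.symm]
      · simp
    · exact Finset.sum_congr rfl fun k _ => by ring

theorem jacobian_pullback (w : Matrix (Fin 2) (Fin 2) ℂ) (f g : MvPolynomial (Fin 2) ℂ) :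
    jacobian (pullback w f) (pullback w g) = C w.det * pullback w (jacobian f g) := by
  simp only [jacobian, pderiv_pullback, Fin.sum_univ_two, map_sub, map_mul, Matrix.det_fin_two]
  ring

/-- A Jacobian of invariants is invariant up to the determinant, which here is ±1. -/
theorem jacobian_mul_mem {W : Subgroup (GL (Fin 2) ℂ)}
    (hdet : ∀ w ∈ W, (w : Matrix (Fin 2) (Fin 2) ℂ).det ^ 2 = 1)
    {f g f' g' : MvPolynomial (Fin 2) ℂ} (hf : f ∈ invariants W) (hg : g ∈ invariants W)
    (hf' : f' ∈ invariants W) (hg' : g' ∈ invariants W) :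
    jacobian f g * jacobian f' g' ∈ invariants W := by
  intro w hw
  have h1 := jacobian_pullback (w : Matrix (Fin 2) (Fin 2) ℂ) f g
  have h2 := jacobian_pullback (w : Matrix (Fin 2) (Fin 2) ℂ) f' g'
  rw [hf w hw, hg w hw] at h1
  rw [hf' w hw, hg' w hw] at h2
  have h3 : (C (w : Matrix (Fin 2) (Fin 2) ℂ).det : MvPolynomial (Fin 2) ℂ) ^ 2 = 1 := by
    rw [← C_pow, hdet w hw, C_1]
  rw [map_mul]
  generalize pullback (w : Matrix (Fin 2) (Fin 2) ℂ) (jacobian f g) = a at h1 ⊢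
  generalize pullback (w : Matrix (Fin 2) (Fin 2) ℂ) (jacobian f' g') = b at h2 ⊢
  rw [h1, h2]
  linear_combination -(a * b) * h3

theorem euler {f : MvPolynomial (Fin 2) ℂ} {d : ℕ} (hf : f.IsHomogeneous d) :
    X 0 * pderiv 0 f + X 1 * pderiv 1 f = (d : ℂ) • f := by
  have := hf.sum_X_mul_pderiv
  rw [Fin.sum_univ_two] at this
  rw [this, Nat.cast_smul_eq_nsmul]

theorem linearIndependent_smul {V ι : Type*} [AddCommGroup V] [Module ℂ V] {v : ι → V}
    (hv : LinearIndependent ℂ v) {c : ι → ℂ} (hc : ∀ i, c i ≠ 0) :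
    LinearIndependent ℂ fun i => c i • v i :=
  hv.units_smul fun i => Units.mk0 (c i) (hc i)

theorem degree_ne_zero {n : ℕ} {G : Subgroup (GL (Fin n) ℂ)} {f : MvPolynomial (Fin n) ℂ} {d : ℕ}
    (hf : f ∈ posInvariants G) (hd : f.IsHomogeneous d) (h0 : f ≠ 0) : d ≠ 0 := by
  rintro rfl
  have h2 : f = C (coeff 0 f) :=
    totalDegree_eq_zero_iff_eq_C.1 (Nat.le_zero.1 hd.totalDegree_le)
  apply h0
  have h3 := hf.2
  rw [constantCoeff_eq] at h3
  rw [h2, h3, C_0]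

theorem ne_zero_of_modSq {n k : ℕ} {G : Subgroup (GL (Fin n) ℂ)}
    {f : Fin k → MvPolynomial (Fin n) ℂ}
    (hli : LinearIndependent ℂ fun i => modSq G (f i)) (i : Fin k) : f i ≠ 0 := fun h =>
  hli.ne_zero i (by rw [h, map_zero])

/-- The coefficients are the two partial derivatives; by Euler's identity the invariants they
assemble to are nonzero multiples of the `f i`. -/
theorem eq_zero_of_pderiv_relations [Finite W] (hW : GeneratedByReflections W) {k : ℕ}
    {f g : Fin k → MvPolynomial (Fin 2) ℂ} {e : Fin k → ℕ} (hf : ∀ i, f i ∈ posInvariants W)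
    (he : ∀ i, (f i).IsHomogeneous (e i)) (hli : LinearIndependent ℂ fun i => modSq W (f i))
    (hg : ∀ i, g i ∈ invariants W) (h0 : ∑ i, g i * pderiv 0 (f i) = 0)
    (h1 : ∑ i, g i * pderiv 1 (f i) = 0) (i : Fin k) : g i = 0 := by
  have hE := fun i => euler (he i)
  have hpos : ∀ i, (e i : ℂ) ≠ 0 := fun i =>
    Nat.cast_ne_zero.2 (degree_ne_zero (hf i) (he i) (ne_zero_of_modSq hli i))
  refine eq_zero_of_relations hW hg h0 h1 (fun i => ?_) ?_ i
  · rw [hE]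
    exact Submodule.smul_mem _ _ (hf i)
  · simp only [hE, map_smul]
    exact linearIndependent_smul hli hpos

/-- If the Jacobian vanished, Euler's identity would make (e₁ f₁, -e₀ f₀) annihilate both partial
derivatives, hence zero. -/
theorem jacobian_ne_zero [Finite W] (hW : GeneratedByReflections W)
    {f : Fin 2 → MvPolynomial (Fin 2) ℂ} {e : Fin 2 → ℕ} (hf : ∀ i, f i ∈ posInvariants W)
    (he : ∀ i, (f i).IsHomogeneous (e i)) (hli : LinearIndependent ℂ fun i => modSq W (f i)) :
    jacobian (f 0) (f 1) ≠ 0 := by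
  intro hJ
  rw [jacobian] at hJ
  have hE := fun i => euler (he i)
  have h1 := eq_zero_of_pderiv_relations hW hf he hli
    (g := ![(e 1 : ℂ) • f 1, -((e 0 : ℂ) • f 0)]) (by
      intro i
      fin_cases i
      · exact (invariants W).smul_mem (hf 1).1 _
      · exact (invariants W).neg_mem ((invariants W).smul_mem (hf 0).1 _))
    (by
      simp only [Fin.sum_univ_two, cons_val_zero, cons_val_one, ← hE]
      linear_combination (X 1 : MvPolynomial (Fin 2) ℂ) * hJ)
    (by
      simp only [Fin.sum_univ_two, cons_val_zero, cons_val_one, ← hE]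
      linear_combination -(X 0 : MvPolynomial (Fin 2) ℂ) * hJ) 0
  simp only [cons_val_zero] at h1
  exact (smul_eq_zero.1 h1).elim
    (Nat.cast_ne_zero.2 (degree_ne_zero (hf 1) (he 1) (ne_zero_of_modSq hli 1)))
    (ne_zero_of_modSq hli 1)

/-- The cotangent space has dimension at most two. -/
theorem not_linearIndependent_three [Finite W] (hW : GeneratedByReflections W)
    (hdet : ∀ w ∈ W, (w : Matrix (Fin 2) (Fin 2) ℂ).det ^ 2 = 1)
    {f : Fin 3 → MvPolynomial (Fin 2) ℂ} {e : Fin 3 → ℕ} (hf : ∀ i, f i ∈ posInvariants W)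
    (he : ∀ i, (f i).IsHomogeneous (e i)) :
    ¬ LinearIndependent ℂ fun i => modSq W (f i) := by
  intro hli
  have hJ := jacobian_ne_zero hW (f := ![f 0, f 1]) (e := ![e 0, e 1])
    (by intro i; fin_cases i <;> exact hf _) (by intro i; fin_cases i <;> exact he _)
    (by
      have := hli.comp ![0, 1] (by decide)
      convert this using 2 with i
      fin_cases i <;> rfl)
  simp only [cons_val_zero, cons_val_one] at hJ
  -- The cross product of the two rows of partial derivatives annihilates both of them. Its entries
  -- are Jacobians; multiplying by one more Jacobian makes them invariant, and the last entry
  -- becomes a nonzero square.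
  have h := eq_zero_of_pderiv_relations hW hf he hli
    (g := ![jacobian (f 0) (f 1) * jacobian (f 1) (f 2), jacobian (f 0) (f 1) * jacobian (f 2) (f 0),
      jacobian (f 0) (f 1) * jacobian (f 0) (f 1)]) (by
      intro i
      fin_cases i <;>
        exact jacobian_mul_mem hdet (hf _).1 (hf _).1 (hf _).1 (hf _).1)
    (by
      simp only [Fin.sum_univ_three, cons_val_zero, cons_val_one, cons_val_two, head_cons,
        tail_cons, jacobian]
      ring)
    (by
      simp only [Fin.sum_univ_three, cons_val_zero, cons_val_one, cons_val_two, head_cons,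
        tail_cons, jacobian]
      ring) 2
  exact hJ (mul_self_eq_zero.1 h)

end Plane

/-! ### At least two independent classes, and the basic invariants. -/

section Dimension

variable {n : ℕ} {W : Subgroup (GL (Fin n) ℂ)}

/-- `x` is a root of the monic polynomial whose roots are its transforms; the lower coefficients are
invariants without constant term. -/
theorem exists_pow_mem_hilbertIdeal [Finite W] (x : MvPolynomial (Fin n) ℂ)
    (hx : constantCoeff x = 0) : ∃ N, x ^ N ∈ hilbertIdeal W := by
  have := Fintype.ofFinite W
  obtain ⟨p, hp⟩ : ∃ p : W → MvPolynomial (Fin n) ℂ, ∀ w : W, p w =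
    pullback ((w : GL (Fin n) ℂ) : Matrix (Fin n) (Fin n) ℂ) x := ⟨_, fun _ => rfl⟩
  have hpg : ∀ w g : W, pullback ((g : GL (Fin n) ℂ) : Matrix (Fin n) (Fin n) ℂ) (p w) =
      p (w * g) := by
    intro w g
    rw [hp, hp, ← pullback_mul, Subgroup.coe_mul, Units.val_mul]
  have hp0 : ∀ w, constantCoeff (p w) = 0 := fun w => by rw [hp, constantCoeff_pullback, hx]
  obtain ⟨Q, hQ⟩ : ∃ Q : Polynomial (MvPolynomial (Fin n) ℂ),
    Q = ∏ w : W, (Polynomial.X - Polynomial.C (p w)) := ⟨_, rfl⟩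
  have hmonic : Q.Monic := hQ ▸ Polynomial.monic_prod_X_sub_C p Finset.univ
  have hinv : ∀ j, Q.coeff j ∈ invariants W := by
    intro j g hg
    have h1 : Q.map ((pullback (g : Matrix (Fin n) (Fin n) ℂ) :
        MvPolynomial (Fin n) ℂ →ₐ[ℂ] _) : MvPolynomial (Fin n) ℂ →+* _) = Q := by
      rw [hQ, Polynomial.map_prod, ← Equiv.prod_comp (Equiv.mulRight (⟨g, hg⟩ : W))
        fun w => (Polynomial.X - Polynomial.C (p w))]
      refine Finset.prod_congr rfl fun w _ => ?_
      rw [Polynomial.map_sub, Polynomial.map_X, Polynomial.map_C, RingHom.coe_coe,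
        hpg w ⟨g, hg⟩, Equiv.coe_mulRight]
    conv_rhs => rw [← h1]
    rw [Polynomial.coeff_map, RingHom.coe_coe]
  have hcc : Q.map constantCoeff = Polynomial.X ^ Fintype.card W := by
    rw [hQ, Polynomial.map_prod]
    simp only [Polynomial.map_sub, Polynomial.map_X, Polynomial.map_C, hp0, map_zero, sub_zero]
    rw [Finset.prod_const, Finset.card_univ]
  have hdeg : Q.natDegree = Fintype.card W := by
    rw [← hmonic.natDegree_map (constantCoeff : MvPolynomial (Fin n) ℂ →+* ℂ), hcc,
      Polynomial.natDegree_X_pow]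
  have hroot : Q.eval x = 0 := by
    rw [hQ, Polynomial.eval_prod]
    apply Finset.prod_eq_zero (Finset.mem_univ (1 : W))
    rw [hp, Subgroup.coe_one, Units.val_one, pullback_one, Polynomial.eval_sub,
      Polynomial.eval_X, Polynomial.eval_C, sub_self]
  rw [Polynomial.eval_eq_sum_range, Finset.sum_range_succ, hmonic.coeff_natDegree, one_mul,
    add_comm, ← eq_neg_iff_add_eq_zero] at hroot
  refine ⟨Q.natDegree, ?_⟩
  rw [hroot]
  refine neg_mem (Ideal.sum_mem _ fun j hj => Ideal.mul_mem_right _ _ (mem_hilbertIdeal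
    ⟨hinv j, ?_⟩))
  have h3 := congrArg (fun q => Polynomial.coeff q j) hcc
  simp only [Polynomial.coeff_map, Polynomial.coeff_X_pow] at h3
  rwa [if_neg (hdeg ▸ (Finset.mem_range.1 hj).ne)] at h3

/-- The cotangent space has dimension at least two. -/
theorem not_posInvariants_le {W : Subgroup (GL (Fin 2) ℂ)} [Finite W]
    {f : MvPolynomial (Fin 2) ℂ} (hf : constantCoeff f = 0) :
    ¬ posInvariants W ≤ Submodule.span ℂ {f} ⊔ posInvariants W * posInvariants W := by
  intro hle
  have hsq : posInvariants W * posInvariants W ≤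
      (hilbertIdeal W • hilbertIdeal W).restrictScalars ℂ :=
    Submodule.mul_le.2 fun a ha b hb =>
      Ideal.mul_mem_mul (mem_hilbertIdeal ha) (mem_hilbertIdeal hb)
  have h1 : hilbertIdeal W ≤ Ideal.span {f} ⊔ hilbertIdeal W • hilbertIdeal W := by
    refine Ideal.span_le.2 fun a ha => ?_
    obtain ⟨b, hb, c, hc, rfl⟩ := Submodule.mem_sup.1 (hle ha)
    obtain ⟨t, rfl⟩ := Submodule.mem_span_singleton.1 hb
    refine Submodule.add_mem_sup ?_ (hsq hc)
    rw [smul_eq_C_mul]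
    exact Ideal.mul_mem_left _ _ (Ideal.mem_span_singleton_self f)
  -- Nakayama: if the Hilbert ideal were generated by `f` modulo its square, some `u` with constant
  -- term 1 would send it into the ideal of `f`.
  obtain ⟨u, hu1, hu⟩ := Submodule.exists_sub_one_mem_and_smul_le_of_fg_of_le_sup
    (IsNoetherian.noetherian (hilbertIdeal W)) le_rfl h1
  have hu0 : constantCoeff u = 1 := by
    have := constantCoeff_of_mem_hilbertIdeal hu1
    rwa [map_sub, map_one, sub_eq_zero] at this
  have hdvd : ∀ p ∈ hilbertIdeal W, f ∣ u * p := fun p hp =>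
    Ideal.mem_span_singleton.1 (hu (Submodule.smul_mem_pointwise_smul p u _ hp))
  obtain ⟨M, hM⟩ := exists_pow_mem_hilbertIdeal (W := W) (X 0 : MvPolynomial (Fin 2) ℂ) (by simp)
  obtain ⟨N, hN⟩ := exists_pow_mem_hilbertIdeal (W := W) (X 1 : MvPolynomial (Fin 2) ℂ) (by simp)
  obtain ⟨a, ha⟩ := hdvd _ hM
  obtain ⟨b, hb⟩ := hdvd _ hN
  have hf0 : f ≠ 0 := by
    rintro rfl
    rw [zero_mul] at ha
    rcases mul_eq_zero.1 ha with h | h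
    · rw [h, map_zero] at hu0
      exact zero_ne_one hu0
    · exact pow_ne_zero _ (X_ne_zero _) h
  -- Now `f` divides the products of `u` with powers of both variables. These are coprime, so `f`
  -- divides `u`, which contradicts the constant terms.
  have hab : a * X 1 ^ N = X 0 ^ M * b := by
    apply mul_left_cancel₀ hf0
    linear_combination -(X 1 ^ N : MvPolynomial (Fin 2) ℂ) * ha + X 0 ^ M * hb
  obtain ⟨a', ha'⟩ := (X_prime (R := ℂ) (i := (0 : Fin 2))).pow_dvd_of_dvd_mul_right M
    (fun h => by
      have := (X_prime (R := ℂ) (i := (0 : Fin 2))).dvd_of_dvd_pow h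
      rw [X_dvd_X] at this
      exact absurd this (by decide)) (Dvd.intro _ hab.symm)
  have hufa : u = f * a' := by
    apply mul_right_cancel₀ (pow_ne_zero M (X_ne_zero (0 : Fin 2)) : (X 0 ^ M : MvPolynomial (Fin 2) ℂ) ≠ 0)
    rw [ha, ha']
    ring
  rw [hufa, map_mul, hf, zero_mul] at hu0
  exact zero_ne_one hu0

theorem exists_homogeneous_not_mem {n : ℕ} {W : Subgroup (GL (Fin n) ℂ)}
    {f : MvPolynomial (Fin n) ℂ}
    (h : ¬ posInvariants W ≤ Submodule.span ℂ {f} ⊔ posInvariants W * posInvariants W) :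
    ∃ p d, p ∈ posInvariants W ∧ p.IsHomogeneous d ∧
      p ∉ Submodule.span ℂ {f} ⊔ posInvariants W * posInvariants W := by
  by_contra! hcon
  apply h
  intro p hp
  rw [← sum_homogeneousComponent p]
  exact Submodule.sum_mem _ fun i _ => hcon _ i (homogeneousComponent_mem_posInvariants hp i)
    (homogeneousComponent_isHomogeneous i p)

/-- A reflection group of the plane with determinants `±1` has two basic invariants. -/
theorem exists_basic_invariants {W : Subgroup (GL (Fin 2) ℂ)} [Finite W]
    (hW : GeneratedByReflections W)
    (hdet : ∀ w ∈ W, (w : Matrix (Fin 2) (Fin 2) ℂ).det ^ 2 = 1) :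
    ∃ (f : Fin 2 → MvPolynomial (Fin 2) ℂ) (e : Fin 2 → ℕ), (∀ i, f i ∈ posInvariants W) ∧
      (∀ i, (f i).IsHomogeneous (e i)) ∧ (LinearIndependent ℂ fun i => modSq W (f i)) ∧
      ∀ d p, p ∈ posInvariants W → p.IsHomogeneous d →
        modSq W p ∈ Submodule.span ℂ (Set.range fun i => modSq W (f i)) := by
  obtain ⟨f₀, d₀, hf₀, hd₀, h₀⟩ := exists_homogeneous_not_mem
    (not_posInvariants_le (W := W) (f := 0) (map_zero _))
  rw [Submodule.span_zero_singleton, bot_sup_eq] at h₀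
  obtain ⟨f₁, d₁, hf₁, hd₁, h₁⟩ := exists_homogeneous_not_mem
    (not_posInvariants_le (W := W) hf₀.2)
  have hli : LinearIndependent ℂ fun i => modSq W ((![f₀, f₁] : Fin 2 → _) i) := by
    have h : LinearIndependent ℂ ![modSq W f₀, modSq W f₁] := by
      refine (LinearIndependent.pair_iff' (mt modSq_eq_zero.1 h₀)).2 fun a ha => h₁ ?_
      rw [← map_smul, eq_comm, ← sub_eq_zero, ← map_sub, modSq_eq_zero] at ha
      rw [← add_sub_cancel (a • f₀) f₁]
      exact Submodule.add_mem_sup (Submodule.smul_mem _ _ (Submodule.mem_span_singleton_self _)) ha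
    convert h using 1
    ext i
    fin_cases i <;> rfl
  refine ⟨![f₀, f₁], ![d₀, d₁], Fin.forall_fin_two.2 ⟨hf₀, hf₁⟩, Fin.forall_fin_two.2 ⟨hd₀, hd₁⟩,
    hli, fun d p hp hd => ?_⟩
  by_contra hsp
  -- A homogeneous invariant outside the span would be a third independent class.
  refine not_linearIndependent_three hW hdet (f := Fin.cons p ![f₀, f₁])
    (e := Fin.cons d ![d₀, d₁]) ?_ ?_ ?_
  · exact Fin.cases hp (Fin.forall_fin_two.2 ⟨hf₀, hf₁⟩)
  · exact Fin.cases hd (Fin.forall_fin_two.2 ⟨hd₀, hd₁⟩)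
  · have h := linearIndependent_finCons.2 ⟨hli, hsp⟩
    have h' : (fun i => modSq W ((Fin.cons p ![f₀, f₁] : Fin 3 → _) i)) =
        Fin.cons (modSq W p) fun i => modSq W ((![f₀, f₁] : Fin 2 → _) i) :=
      funext fun i => Fin.cases rfl (fun j => rfl) i
    rw [h']
    exact h

end Dimension

/-! ### The quotient of the plane by `{1, -1}` -/

section Line

variable {n : ℕ} {G : Subgroup (GL (Fin n) ℂ)}

/-- Restriction of polynomials to the line spanned by a vector. -/
def restrictLine (e : Fin n → ℂ) : MvPolynomial (Fin n) ℂ →ₐ[ℂ] Polynomial ℂ :=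
  aeval fun i => Polynomial.C (e i) * Polynomial.X

theorem eval_restrictLine (e : Fin n → ℂ) (t : ℂ) (p : MvPolynomial (Fin n) ℂ) :
    (restrictLine e p).eval t = eval (t • e) p := by
  have : ((Polynomial.aeval t).comp (restrictLine e)) = aeval (t • e) := by
    apply algHom_ext
    intro i
    rw [AlgHom.comp_apply, restrictLine, aeval_X, aeval_X, map_mul, Polynomial.aeval_C,
      Polynomial.aeval_X, Pi.smul_apply, smul_eq_mul, mul_comm]
    rfl
  have h := DFunLike.congr_fun this p
  rw [AlgHom.comp_apply, Polynomial.coe_aeval_eq_eval] at h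
  rw [h, aeval_eq_eval]

theorem restrictLine_of_isHomogeneous (e : Fin n → ℂ) {p : MvPolynomial (Fin n) ℂ} {d : ℕ}
    (hp : p.IsHomogeneous d) :
    restrictLine e p = Polynomial.C (eval e p) * Polynomial.X ^ d := by
  apply Polynomial.funext
  intro t
  rw [eval_restrictLine, Polynomial.eval_mul, Polynomial.eval_C, Polynomial.eval_pow,
    Polynomial.eval_X, eval_eq, eval_eq, Finset.sum_mul]
  refine Finset.sum_congr rfl fun m hm => ?_
  have hd : ∑ i ∈ m.support, m i = d := by
    rw [← Finsupp.degree_apply, Finsupp.degree_eq_weight_one]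
    exact hp (mem_support_iff.1 hm)
  simp only [Pi.smul_apply, smul_eq_mul, mul_pow, Finset.prod_mul_distrib,
    Finset.prod_pow_eq_pow_sum, hd]
  ring

/-- An invariant of a group acting by `-1` on a line is even on this line. -/
theorem X_sq_dvd_restrictLine {g : GL (Fin n) ℂ} (hg : g ∈ G) {e : Fin n → ℂ}
    (he : Matrix.mulVec (g : Matrix (Fin n) (Fin n) ℂ) e = -e) {f : MvPolynomial (Fin n) ℂ}
    (hf : f ∈ posInvariants G) : Polynomial.X ^ 2 ∣ restrictLine e f := by
  have h0 : (restrictLine e f).coeff 0 = 0 := by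
    rw [Polynomial.coeff_zero_eq_eval_zero, eval_restrictLine, zero_smul]
    rw [eval_zero]
    exact hf.2
  have h1 : (restrictLine e f).comp (-Polynomial.X) = restrictLine e f := by
    apply Polynomial.funext
    intro t
    rw [Polynomial.eval_comp, eval_restrictLine, eval_restrictLine, Polynomial.eval_neg,
      Polynomial.eval_X]
    conv_rhs => rw [← hf.1 g hg, eval_pullback, Matrix.mulVec_smul, he]
    rw [neg_smul, smul_neg]
  rw [Polynomial.X_pow_dvd_iff]
  intro d hd
  interval_cases d
  · exact h0
  · have h2 := congrArg (fun q => (Polynomial.derivative q).eval 0) h1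
    simp only [Polynomial.derivative_comp, Polynomial.derivative_neg, Polynomial.derivative_X,
      Polynomial.eval_mul, Polynomial.eval_neg, Polynomial.eval_one, Polynomial.eval_comp,
      Polynomial.eval_X, neg_zero, ← Polynomial.coeff_zero_eq_eval_zero,
      Polynomial.coeff_derivative] at h2
    simp only [zero_add, Nat.cast_zero, mul_one] at h2
    linear_combination -h2 / 2

/-- On the line both factors are even and vanish at the origin, so their product vanishes to order
four. -/
theorem X_pow_four_dvd_restrictLine {g : GL (Fin n) ℂ} (hg : g ∈ G) {e : Fin n → ℂ}
    (he : Matrix.mulVec (g : Matrix (Fin n) (Fin n) ℂ) e = -e) {f : MvPolynomial (Fin n) ℂ}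
    (hf : f ∈ posInvariants G * posInvariants G) : Polynomial.X ^ 4 ∣ restrictLine e f := by
  induction hf using Submodule.mul_induction_on' with
  | mem_mul_mem a ha b hb =>
    rw [map_mul, show 4 = 2 + 2 from rfl, pow_add]
    exact mul_dvd_mul (X_sq_dvd_restrictLine hg he ha) (X_sq_dvd_restrictLine hg he hb)
  | add x _ y _ hx hy =>
    rw [map_add]
    exact dvd_add hx hy

/-- Quadratic elements of the square of the ideal of invariants vanish on lines where the group
acts by `-1`. -/
theorem eval_eq_zero_of_mem_sq {g : GL (Fin n) ℂ} (hg : g ∈ G) {e : Fin n → ℂ}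
    (he : Matrix.mulVec (g : Matrix (Fin n) (Fin n) ℂ) e = -e) {f : MvPolynomial (Fin n) ℂ}
    (hf : f ∈ posInvariants G * posInvariants G) (h2 : f.IsHomogeneous 2) : eval e f = 0 := by
  have h := X_pow_four_dvd_restrictLine hg he hf
  rw [restrictLine_of_isHomogeneous e h2, Polynomial.X_pow_dvd_iff] at h
  simpa using h 2 (by norm_num)

end Line

/-! ### The invariants of {1, -1}, and the fundamental system xy, x², y². -/

theorem isTangentMatrix_phi (g : GL (Fin 2) ℂ) : IsTangentMatrix quadInvariants g (phi g) := by
  intro i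
  rw [phi_val, symSq_apply]
  have hC : (C (2 : ℂ) : MvPolynomial (Fin 2) ℂ) = 2 := map_ofNat C 2
  fin_cases i <;>
    simp [quadInvariants, pullback_X, Fin.sum_univ_succ, smul_eq_C_mul, C_mul, C_add, C_pow,
      hC] <;>
    ring

theorem neg_one_mem_muTwo : (-1 : GL (Fin 2) ℂ) ∈ muTwo := mem_muTwo_iff.2 (Or.inr rfl)

theorem neg_one_mulVec (e : Fin 2 → ℂ) :
    Matrix.mulVec ((-1 : GL (Fin 2) ℂ) : Matrix (Fin 2) (Fin 2) ℂ) e = -e := by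
  rw [Units.val_neg, Units.val_one, Matrix.neg_mulVec, Matrix.one_mulVec]

theorem mem_invariants_muTwo {f : MvPolynomial (Fin 2) ℂ} : f ∈ invariants muTwo ↔
    pullback ((-1 : GL (Fin 2) ℂ) : Matrix (Fin 2) (Fin 2) ℂ) f = f := by
  refine ⟨fun h => h _ neg_one_mem_muTwo, fun h g hg => ?_⟩
  rcases mem_muTwo_iff.1 hg with rfl | rfl
  · exact pullback_one f
  · exact h

theorem pullback_neg_one_monomial (m : Fin 2 →₀ ℕ) (c : ℂ) :
    pullback ((-1 : GL (Fin 2) ℂ) : Matrix (Fin 2) (Fin 2) ℂ) (monomial m c) =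
      monomial m ((-1) ^ (m 0 + m 1) * c) := by
  rw [monomial_eq, monomial_eq, Finsupp.prod_fintype _ _ (by simp), Fin.prod_univ_two]
  have hX : ∀ i : Fin 2, pullback ((-1 : GL (Fin 2) ℂ) : Matrix (Fin 2) (Fin 2) ℂ) (X i) =
      -X i := by
    intro i
    rw [pullback_X, Units.val_neg, Units.val_one]
    simp [Matrix.one_apply]
  rw [map_mul, map_mul, map_pow, map_pow, hX, hX, pullback_C, C_mul, C_pow, C_neg, C_1,
    neg_pow (X 0 : MvPolynomial (Fin 2) ℂ), neg_pow (X 1 : MvPolynomial (Fin 2) ℂ), pow_add]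
  ring

theorem coeff_pullback_neg_one (f : MvPolynomial (Fin 2) ℂ) (m : Fin 2 →₀ ℕ) :
    coeff m (pullback ((-1 : GL (Fin 2) ℂ) : Matrix (Fin 2) (Fin 2) ℂ) f) =
      (-1) ^ (m 0 + m 1) * coeff m f := by
  classical
  induction f using MvPolynomial.induction_on' with
  | monomial u a =>
    rw [pullback_neg_one_monomial, coeff_monomial, coeff_monomial]
    split_ifs with h
    · rw [h]
    · rw [mul_zero]
  | add p q hp hq => rw [map_add, coeff_add, coeff_add, hp, hq, mul_add]

theorem quadInvariants_mem (i : Fin 3) : quadInvariants i ∈ posInvariants muTwo := by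
  refine ⟨mem_invariants_muTwo.2 ?_, ?_⟩
  · rw [isTangentMatrix_phi, phi_neg, map_one]
    simp [Matrix.one_apply]
  · fin_cases i <;> simp [quadInvariants]

theorem quadInvariants_isHomogeneous (i : Fin 3) : (quadInvariants i).IsHomogeneous 2 := by
  fin_cases i
  · exact (isHomogeneous_X ℂ (0 : Fin 2)).mul (isHomogeneous_X ℂ 1)
  · exact (isHomogeneous_X ℂ (0 : Fin 2)).pow 2
  · exact (isHomogeneous_X ℂ (1 : Fin 2)).pow 2

/-- The invariants of `{1, -1}` are the polynomials in `XY, X², Y²`. -/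
theorem exists_aeval_quadInvariants {f : MvPolynomial (Fin 2) ℂ} (hf : f ∈ invariants muTwo) :
    ∃ F : MvPolynomial (Fin 3) ℂ, aeval quadInvariants F = f := by
  change f ∈ (aeval quadInvariants : MvPolynomial (Fin 3) ℂ →ₐ[ℂ] MvPolynomial (Fin 2) ℂ).range
  rw [f.as_sum]
  refine Subalgebra.sum_mem _ fun m hm => ?_
  -- Invariance under -1 kills the coefficients of odd degree; an even monomial is a product of
  -- squares, times xy if both exponents are odd.
  have heven : Even (m 0 + m 1) := by
    by_contra h
    have h1 := coeff_pullback_neg_one f m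
    rw [mem_invariants_muTwo.1 hf, (Nat.not_even_iff_odd.1 h).neg_one_pow] at h1
    exact mem_support_iff.1 hm (by linear_combination h1 / 2)
  have hq : ∀ i, quadInvariants i ∈
      (aeval quadInvariants : MvPolynomial (Fin 3) ℂ →ₐ[ℂ] MvPolynomial (Fin 2) ℂ).range :=
    fun i => ⟨X i, aeval_X _ _⟩
  have h0 := hq 0
  have h1 := hq 1
  have h2 := hq 2
  simp only [quadInvariants, Matrix.cons_val] at h0 h1 h2
  rw [monomial_eq, Finsupp.prod_fintype _ _ (by simp), Fin.prod_univ_two]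
  refine Subalgebra.mul_mem _ (Subalgebra.algebraMap_mem _ _) ?_
  rcases Nat.even_or_odd' (m 0) with ⟨a, ha | ha⟩
  · obtain ⟨b, hb⟩ : Even (m 1) := (Nat.even_add.1 heven).1 ⟨a, by omega⟩
    rw [ha, hb, pow_mul, ← two_mul, pow_mul]
    exact Subalgebra.mul_mem _ (Subalgebra.pow_mem _ h1 _) (Subalgebra.pow_mem _ h2 _)
  · obtain ⟨b, hb⟩ : Odd (m 1) := by
      rw [← Nat.not_even_iff_odd, ← Nat.even_add.1 heven, Nat.not_even_iff_odd]
      exact ⟨a, ha⟩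
    have : (X 0 ^ m 0 * X 1 ^ m 1 : MvPolynomial (Fin 2) ℂ) =
        X 0 * X 1 * ((X 0 ^ 2) ^ a * (X 1 ^ 2) ^ b) := by
      rw [ha, hb]; ring
    rw [this]
    exact Subalgebra.mul_mem _ h0
      (Subalgebra.mul_mem _ (Subalgebra.pow_mem _ h1 _) (Subalgebra.pow_mem _ h2 _))

theorem constantCoeff_aeval_quadInvariants (F : MvPolynomial (Fin 3) ℂ) :
    constantCoeff (aeval quadInvariants F) = constantCoeff F := by
  induction F using MvPolynomial.induction_on with
  | C a => simp
  | add p q hp hq => simp only [map_add, hp, hq]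
  | mul_X p i hp => rw [map_mul, map_mul, map_mul, aeval_X, (quadInvariants_mem i).2, mul_zero,
      constantCoeff_X, mul_zero]

theorem aeval_quadInvariants_mem (F : MvPolynomial (Fin 3) ℂ) :
    aeval quadInvariants F ∈ invariants muTwo := by
  induction F using MvPolynomial.induction_on with
  | C a => rw [aeval_C]; exact (invariants muTwo).algebraMap_mem a
  | add p q hp hq => rw [map_add]; exact (invariants muTwo).add_mem hp hq
  | mul_X p i hp =>
    rw [map_mul, aeval_X]
    exact (invariants muTwo).mul_mem hp (quadInvariants_mem i).1

theorem modSq_mem_span_quadInvariants {f : MvPolynomial (Fin 2) ℂ}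
    (hf : f ∈ posInvariants muTwo) :
    modSq muTwo f ∈ Submodule.span ℂ (Set.range fun i => modSq muTwo (quadInvariants i)) := by
  obtain ⟨F, rfl⟩ := exists_aeval_quadInvariants hf.1
  have h : ∀ F : MvPolynomial (Fin 3) ℂ,
      modSq muTwo (aeval quadInvariants F - C (constantCoeff F)) ∈
        Submodule.span ℂ (Set.range fun i => modSq muTwo (quadInvariants i)) := by
    intro F
    induction F using MvPolynomial.induction_on with
    | C a => simp
    | add p q hp hq =>
      simp only [map_add, add_sub_add_comm] at hp hq ⊢
      exact Submodule.add_mem _ hp hq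
    | mul_X p i hp =>
      rw [map_mul, aeval_X, map_mul, constantCoeff_X, mul_zero, C_0, sub_zero,
        modSq_mul (aeval_quadInvariants_mem p) (quadInvariants_mem i)]
      exact Submodule.smul_mem _ _ (Submodule.subset_span ⟨i, rfl⟩)
  have h1 := h F
  have h2 := hf.2
  rw [constantCoeff_aeval_quadInvariants] at h2
  rwa [h2, C_0, sub_zero] at h1

/-- As -1 acts by -1 on every line, a quadratic form in the square vanishes everywhere. Hence
quadratic identities modulo squares are actual identities. -/
theorem eq_zero_of_mem_sq_muTwo {f : MvPolynomial (Fin 2) ℂ}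
    (hf : f ∈ posInvariants muTwo * posInvariants muTwo) (h2 : f.IsHomogeneous 2) : f = 0 :=
  MvPolynomial.funext fun e => by
    rw [eval_eq_zero_of_mem_sq neg_one_mem_muTwo (neg_one_mulVec e) hf h2, map_zero]

theorem linearIndependent_quadInvariants : LinearIndependent ℂ quadInvariants := by
  rw [Fintype.linearIndependent_iff]
  intro c hc
  simp only [Fin.sum_univ_three, quadInvariants, Matrix.cons_val_zero, Matrix.cons_val_one,
    Matrix.cons_val_two, Matrix.head_cons, Matrix.tail_cons] at hc
  have h1 := congrArg (eval ![1, 0]) hc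
  have h2 := congrArg (eval ![0, 1]) hc
  have h3 := congrArg (eval ![1, 1]) hc
  simp [smul_eval] at h1 h2 h3
  rw [h1, h2] at h3
  intro i
  fin_cases i
  · simpa using h3
  · exact h1
  · exact h2

theorem linearIndependent_modSq_quadInvariants :
    LinearIndependent ℂ fun i => modSq muTwo (quadInvariants i) := by
  rw [Fintype.linearIndependent_iff]
  intro c hc
  simp only [← map_smul, ← map_sum] at hc
  exact Fintype.linearIndependent_iff.1 linearIndependent_quadInvariants c
    (eq_zero_of_mem_sq_muTwo (modSq_eq_zero.1 hc) (IsHomogeneous.sum _ _ _ fun i _ =>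
      (homogeneousSubmodule _ _ 2).smul_mem _ (quadInvariants_isHomogeneous i)))

theorem isFundamentalSystem_quadInvariants : IsFundamentalSystem muTwo quadInvariants where
  mem := quadInvariants_mem
  homogeneous i := ⟨2, quadInvariants_isHomogeneous i⟩
  linearIndependent := linearIndependent_modSq_quadInvariants
  span := by
    apply le_antisymm
    · rw [Submodule.span_le]
      rintro _ ⟨i, rfl⟩
      exact ⟨_, quadInvariants_mem i, rfl⟩
    · rintro _ ⟨f, hf, rfl⟩
      exact modSq_mem_span_quadInvariants hf
  stable g _ i := by
    rw [isTangentMatrix_phi g i]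
    exact Submodule.sum_mem _ fun j _ => Submodule.smul_mem _ _ (Submodule.subset_span ⟨j, rfl⟩)

/-! ### The relation between the quadratic invariants -/

theorem quadForm_isHomogeneous : quadForm.IsHomogeneous 2 :=
  ((isHomogeneous_X ℂ (0 : Fin 3)).pow 2).sub ((isHomogeneous_X ℂ (1 : Fin 3)).mul
    (isHomogeneous_X ℂ 2))

theorem aeval_quadForm : aeval quadInvariants quadForm = 0 := by
  simp [quadForm, quadInvariants]
  ring

theorem quadForm_ne_zero : quadForm ≠ 0 := by
  intro h
  have := congrArg (eval ![1, 0, 0]) h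
  simp [quadForm] at this

/-- Normal form modulo the quadratic form. -/
theorem exists_normal_form (F : MvPolynomial (Fin 3) ℂ) :
    ∃ (a b : MvPolynomial (Fin 2) ℂ) (q : MvPolynomial (Fin 3) ℂ),
      F = rename Fin.succ a + X 0 * rename Fin.succ b + quadForm * q := by
  induction F using MvPolynomial.induction_on with
  | C c => exact ⟨C c, 0, 0, by simp⟩
  | add p p' hp hp' =>
    obtain ⟨a, b, q, rfl⟩ := hp
    obtain ⟨a', b', q', rfl⟩ := hp'
    exact ⟨a + a', b + b', q + q', by simp only [map_add]; ring⟩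
  | mul_X p i hp =>
    obtain ⟨a, b, q, rfl⟩ := hp
    refine Fin.cases ?_ (fun j => ?_) i
    · refine ⟨X 0 * X 1 * b, a, rename Fin.succ b + q * X 0, ?_⟩
      simp only [map_mul, rename_X, quadForm]
      rw [show Fin.succ (0 : Fin 2) = 1 from rfl, show Fin.succ (1 : Fin 2) = 2 from rfl]
      ring
    · exact ⟨a * X j, b * X j, q * X j.succ, by simp only [map_mul, rename_X]; ring⟩

/-- A normal form modulo R maps to a(x², y²) + xy b(x², y²). Changing the sign of x separates the
two terms, so both vanish. -/
theorem relationIdeal_quadInvariants : relationIdeal quadInvariants = Ideal.span {quadForm} := by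
  apply le_antisymm
  · intro F hF
    obtain ⟨a, b, q, rfl⟩ := exists_normal_form F
    have hF : aeval quadInvariants (rename Fin.succ a + X 0 * rename Fin.succ b + quadForm * q) =
      0 := hF
    have hexp : ∀ c : MvPolynomial (Fin 2) ℂ,
        aeval quadInvariants (rename Fin.succ c) = expand 2 c := by
      intro c
      rw [← AlgHom.comp_apply]
      congr 1
      apply algHom_ext
      intro j
      rw [AlgHom.comp_apply, rename_X, aeval_X, expand_X]
      fin_cases j <;> rfl
    rw [map_add, map_add, map_mul, map_mul, aeval_quadForm, zero_mul, add_zero, aeval_X, hexp,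
      hexp, quadInvariants, Matrix.cons_val_zero] at hF
    have hsub : ∀ c : MvPolynomial (Fin 2) ℂ,
        aeval ![-X 0, X 1] (expand 2 c) = expand 2 c := by
      intro c
      rw [← AlgHom.comp_apply]
      congr 1
      apply algHom_ext
      intro j
      fin_cases j <;> simp
    have hF' := congrArg (aeval (![-X 0, X 1] : Fin 2 → MvPolynomial (Fin 2) ℂ)) hF
    rw [map_add, map_mul, hsub, hsub, map_mul, aeval_X, aeval_X, map_zero] at hF'
    simp only [Matrix.cons_val_zero, Matrix.cons_val_one] at hF'
    have ha : expand 2 a = 0 := by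
      have : (2 : ℂ) • expand 2 a = 0 := by
        rw [two_smul]
        linear_combination hF + hF'
      exact (smul_eq_zero.1 this).resolve_left two_ne_zero
    have ha0 : a = 0 := expand_injective two_pos (by rw [ha, map_zero])
    have hb0 : b = 0 := by
      apply expand_injective two_pos
      rw [map_zero]
      rw [ha, zero_add] at hF
      exact (mul_eq_zero.1 hF).resolve_left (mul_ne_zero (X_ne_zero _) (X_ne_zero _))
    rw [ha0, hb0]
    simp only [map_zero, mul_zero, zero_add]
    exact Ideal.mul_mem_right _ _ (Ideal.mem_span_singleton_self _)
  · rw [Ideal.span_le, Set.singleton_subset_iff]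
    exact aeval_quadForm

/-- The cone R = 0 has dimension two: at most, because R is not a zero divisor; at least, because it
properly contains a line on which `X 1` vanishes. -/
theorem isCompleteIntersection_quadInvariants :
    IsCompleteIntersection (relationIdeal quadInvariants) := by
  have hprime : (Ideal.span {quadForm}).IsPrime := by
    rw [← relationIdeal_quadInvariants]
    exact RingHom.ker_isPrime _
  rw [IsCompleteIntersection, relationIdeal_quadInvariants]
  have h1 : Submodule.spanFinrank (Ideal.span {quadForm}) = 1 :=
    Submodule.spanFinrank_singleton quadForm_ne_zero
  have hA : ringKrullDim (MvPolynomial (Fin 3) ℂ) = 3 := by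
    rw [MvPolynomial.ringKrullDim_of_isNoetherianRing, ringKrullDim_eq_zero_of_field]
    simp
  have hle := ringKrullDim_quotient_succ_le_of_nonZeroDivisor
    (mem_nonZeroDivisors_of_ne_zero quadForm_ne_zero)
  rw [hA] at hle
  let ψ : MvPolynomial (Fin 3) ℂ →ₐ[ℂ] Polynomial ℂ := aeval ![0, 0, Polynomial.X]
  have hψ : ∀ F ∈ Ideal.span {quadForm}, ψ F = 0 := by
    intro F hF
    obtain ⟨q, rfl⟩ := Ideal.mem_span_singleton.1 hF
    rw [map_mul]
    simp [ψ, quadForm]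
  have hsurj : Function.Surjective ψ := by
    intro q
    refine ⟨Polynomial.aeval (X 2) q, ?_⟩
    rw [← Polynomial.aeval_algHom_apply]
    simp [ψ]
  have hge : ringKrullDim (Polynomial ℂ) + 1 ≤
      ringKrullDim (MvPolynomial (Fin 3) ℂ ⧸ Ideal.span {quadForm}) := by
    refine ringKrullDim_succ_le_of_surjective
      (Ideal.Quotient.lift _ ψ.toRingHom hψ)
      (Ideal.Quotient.lift_surjective_of_surjective _ _ hsurj)
      (r := Ideal.Quotient.mk _ (X 1)) (mem_nonZeroDivisors_of_ne_zero ?_) ?_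
    · rw [Ne, Ideal.Quotient.eq_zero_iff_mem, ← relationIdeal_quadInvariants]
      intro h
      have h : aeval quadInvariants (X 1) = 0 := h
      rw [aeval_X] at h
      exact pow_ne_zero 2 (X_ne_zero (0 : Fin 2)) h
    · rw [Ideal.Quotient.lift_mk]
      change ψ (X 1) = 0
      simp [ψ]
  rw [Polynomial.ringKrullDim_of_isNoetherianRing, ringKrullDim_eq_zero_of_field] at hge
  rw [h1]
  apply le_antisymm
  · rw [add_comm]
    exact_mod_cast hle
  · calc ((3 : ℕ) : WithBot ℕ∞) = 1 + (0 + 1 + 1) := by norm_num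
      _ ≤ _ := by
        rw [Nat.cast_one]
        gcongr

/-! ### Goodness -/

section Goodness

variable {W : Subgroup (GL (Fin 2) ℂ)}

/-- Linear substitutions. -/
def linearSubst {r s : ℕ} (M : Matrix (Fin r) (Fin s) ℂ) :
    MvPolynomial (Fin r) ℂ →ₐ[ℂ] MvPolynomial (Fin s) ℂ :=
  aeval fun i => ∑ j, C (M i j) * X j

theorem linearSubst_X {r s : ℕ} (M : Matrix (Fin r) (Fin s) ℂ) (i : Fin r) :
    linearSubst M (X i) = ∑ j, C (M i j) * X j := aeval_X _ _

theorem linearSubst_mul {r s t : ℕ} (M : Matrix (Fin r) (Fin s) ℂ) (N : Matrix (Fin s) (Fin t) ℂ)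
    (f : MvPolynomial (Fin r) ℂ) : linearSubst (M * N) f = linearSubst N (linearSubst M f) := by
  have : linearSubst (M * N) = (linearSubst N).comp (linearSubst M) := by
    apply algHom_ext
    intro i
    simp only [AlgHom.comp_apply, linearSubst_X, map_sum, map_mul, algHom_C, Matrix.mul_apply,
      algebraMap_eq, Finset.sum_mul, Finset.mul_sum]
    rw [Finset.sum_comm]
    simp only [mul_assoc]
  rw [this, AlgHom.comp_apply]

theorem pullback_eq_linearSubst {n : ℕ} (g : Matrix (Fin n) (Fin n) ℂ) :
    pullback g = linearSubst g := rfl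

theorem aeval_linearSubst {r s n : ℕ} {M : Matrix (Fin r) (Fin s) ℂ}
    {p : Fin r → MvPolynomial (Fin n) ℂ} {q : Fin s → MvPolynomial (Fin n) ℂ}
    (h : ∀ i, p i = ∑ j, M i j • q j) (f : MvPolynomial (Fin r) ℂ) :
    aeval q (linearSubst M f) = aeval p f := by
  rw [← AlgHom.comp_apply]
  congr 1
  apply algHom_ext
  intro i
  rw [AlgHom.comp_apply, linearSubst_X, aeval_X, map_sum, h]
  refine Finset.sum_congr rfl fun j _ => ?_
  rw [map_mul, aeval_X, algHom_C, smul_eq_C_mul, algebraMap_eq]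

theorem constantCoeff_linearSubst {r s : ℕ} (M : Matrix (Fin r) (Fin s) ℂ)
    (f : MvPolynomial (Fin r) ℂ) : constantCoeff (linearSubst M f) = constantCoeff f := by
  induction f using MvPolynomial.induction_on with
  | C a => rw [algHom_C, algebraMap_eq, constantCoeff_C, constantCoeff_C]
  | add p q hp hq => simp only [map_add, hp, hq]
  | mul_X p i hp => simp [linearSubst_X]

/-- As R generates the ideal of relations, g acts on I / A₊I through det(g)²; goodness is therefore
a condition on determinants. -/
theorem pullback_symSq_quadForm (g : Matrix (Fin 2) (Fin 2) ℂ) :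
    pullback (symSq g) quadForm = C (g.det ^ 2) * quadForm :=
  MvPolynomial.funext fun x => by
    rw [eval_pullback, map_mul, eval_C, eval_quadForm, eval_quadForm, evalR_symSq]

/-- Any fundamental system of `{1, -1}` is a linear transform of `XY, X², Y²`. -/
theorem IsFundamentalSystem.exists_eq_sum {r : ℕ} {p : Fin r → MvPolynomial (Fin 2) ℂ}
    (hp : IsFundamentalSystem muTwo p) (i : Fin r) :
    (p i).IsHomogeneous 2 ∧ ∃ b : Fin 3 → ℂ, p i = ∑ j, b j • quadInvariants j := by
  obtain ⟨b, hb⟩ := (Submodule.mem_span_range_iff_exists_fun ℂ).1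
    (modSq_mem_span_quadInvariants (hp.mem i))
  simp only [← map_smul] at hb
  rw [← map_sum, eq_comm, ← sub_eq_zero, ← map_sub, modSq_eq_zero] at hb
  have hs : (∑ j, b j • quadInvariants j).IsHomogeneous 2 := IsHomogeneous.sum _ _ _ fun j _ =>
    (homogeneousSubmodule _ _ 2).smul_mem _ (quadInvariants_isHomogeneous j)
  obtain ⟨d, hd⟩ := hp.homogeneous i
  -- In another degree, `p i` would be a homogeneous component of an element of the square, and its
  -- class would be zero.
  by_cases h2 : d = 2
  · subst h2
    exact ⟨hd, b, sub_eq_zero.1 (eq_zero_of_mem_sq_muTwo hb (hd.sub hs))⟩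
  · exfalso
    have h := homogeneousComponent_mem_mul hb d
    rw [map_sub, homogeneousComponent_of_mem hs, if_neg h2, sub_zero,
      homogeneousComponent_eq_self hd] at h
    exact hp.linearIndependent.ne_zero i (modSq_eq_zero.2 h)

theorem IsFundamentalSystem.quadInvariants_eq_sum {r : ℕ} {p : Fin r → MvPolynomial (Fin 2) ℂ}
    (hp : IsFundamentalSystem muTwo p) (j : Fin 3) :
    ∃ a : Fin r → ℂ, quadInvariants j = ∑ i, a i • p i := by
  have hmem : modSq muTwo (quadInvariants j) ∈ (posInvariants muTwo).map (modSq muTwo) :=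
    ⟨_, quadInvariants_mem j, rfl⟩
  rw [← hp.span] at hmem
  obtain ⟨a, ha⟩ := (Submodule.mem_span_range_iff_exists_fun ℂ).1 hmem
  simp only [← map_smul] at ha
  rw [← map_sum, eq_comm, ← sub_eq_zero, ← map_sub, modSq_eq_zero] at ha
  exact ⟨a, sub_eq_zero.1 (eq_zero_of_mem_sq_muTwo ha ((quadInvariants_isHomogeneous j).sub
    (IsHomogeneous.sum _ _ _ fun i _ =>
      (homogeneousSubmodule _ _ 2).smul_mem _ (hp.exists_eq_sum i).1)))⟩

/-- If `{1, -1}` is good in `W`, the determinants of `W` are `±1`. -/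
theorem IsGood.det_sq (h : IsGood muTwo W) {w : GL (Fin 2) ℂ} (hw : w ∈ W) :
    (w : Matrix (Fin 2) (Fin 2) ℂ).det ^ 2 = 1 := by
  obtain ⟨-, -, r, p, hp, -, htriv⟩ := h
  -- Goodness provides an unknown fundamental system. The matrices `A` and `B` pass between it and
  -- the standard one, and only the product of `A` and `B` in this order is needed.
  choose B hB using fun i => (hp.exists_eq_sum i).2
  choose A hA using hp.quadInvariants_eq_sum
  have hAB : Matrix.of A * Matrix.of B = 1 := by
    ext j k
    have h1 : ∑ k, ((Matrix.of A * Matrix.of B) j k - (1 : Matrix _ _ ℂ) j k) •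
        quadInvariants k = 0 := by
      simp only [sub_smul, Finset.sum_sub_distrib, Matrix.one_apply, ite_smul, one_smul, zero_smul,
        Finset.sum_ite_eq, Finset.mem_univ, if_true]
      rw [sub_eq_zero, hA j]
      simp only [Matrix.mul_apply, Matrix.of_apply, Finset.sum_smul, mul_smul]
      rw [Finset.sum_comm]
      refine Finset.sum_congr rfl fun i _ => ?_
      rw [hB i, Finset.smul_sum]
    exact sub_eq_zero.1 (Fintype.linearIndependent_iff.1 linearIndependent_quadInvariants _ h1 k)
  have hc : IsTangentMatrix p w (Matrix.of B * (phi w : Matrix (Fin 3) (Fin 3) ℂ) *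
      Matrix.of A) := by
    intro i
    rw [hB i, map_sum]
    simp only [map_smul, isTangentMatrix_phi w _]
    have : ∀ k, ∑ j, (phi w : Matrix (Fin 3) (Fin 3) ℂ) k j • quadInvariants j =
        ∑ l, ((phi w : Matrix (Fin 3) (Fin 3) ℂ) * Matrix.of A) k l • p l := by
      intro k
      simp only [Matrix.mul_apply, Matrix.of_apply, Finset.sum_smul, mul_smul]
      rw [Finset.sum_comm]
      refine Finset.sum_congr rfl fun j _ => ?_
      rw [hA j, Finset.smul_sum]
    simp only [this]
    rw [Matrix.mul_assoc]
    simp only [Matrix.mul_apply (M := Matrix.of B), Matrix.of_apply, Finset.sum_smul, mul_smul,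
      Finset.smul_sum]
    rw [Finset.sum_comm]
  have hf : linearSubst (Matrix.of A) quadForm ∈ relationIdeal p := by
    change aeval p (linearSubst (Matrix.of A) quadForm) = 0
    rw [aeval_linearSubst (M := Matrix.of A) hA, aeval_quadForm]
  have h1 := htriv w hw _ hc _ hf
  have h2 : pullback (Matrix.of B * (phi w : Matrix (Fin 3) (Fin 3) ℂ) * Matrix.of A)
      (linearSubst (Matrix.of A) quadForm) = C ((w : Matrix (Fin 2) (Fin 2) ℂ).det ^ 2) *
        linearSubst (Matrix.of A) quadForm := by
    rw [pullback_eq_linearSubst, ← linearSubst_mul, ← Matrix.mul_assoc, ← Matrix.mul_assoc, hAB,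
      Matrix.one_mul, linearSubst_mul, ← pullback_eq_linearSubst, phi_val, pullback_symSq_quadForm,
      map_mul, algHom_C, algebraMap_eq]
  rw [h2] at h1
  have hle : RingHom.ker (constantCoeff : MvPolynomial (Fin r) ℂ →+* ℂ) * relationIdeal p ≤
      (RingHom.ker (constantCoeff : MvPolynomial (Fin 3) ℂ →+* ℂ) *
        Ideal.span {quadForm}).comap (linearSubst (Matrix.of B)).toRingHom := by
    rw [Ideal.mul_le]
    intro x hx y hy
    change linearSubst (Matrix.of B) (x * y) ∈
      RingHom.ker (constantCoeff : MvPolynomial (Fin 3) ℂ →+* ℂ) * Ideal.span {quadForm}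
    rw [map_mul]
    refine Ideal.mul_mem_mul ?_ ?_
    · rw [RingHom.mem_ker, constantCoeff_linearSubst]
      exact hx
    · rw [← relationIdeal_quadInvariants]
      change aeval quadInvariants (linearSubst (Matrix.of B) y) = 0
      rw [aeval_linearSubst (M := Matrix.of B) hB]
      exact hy
  have h3 : linearSubst (Matrix.of B) (C ((w : Matrix (Fin 2) (Fin 2) ℂ).det ^ 2) *
    linearSubst (Matrix.of A) quadForm - linearSubst (Matrix.of A) quadForm) ∈
      RingHom.ker (constantCoeff : MvPolynomial (Fin 3) ℂ →+* ℂ) * Ideal.span {quadForm} := hle h1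
  rw [map_sub, map_mul, algHom_C, algebraMap_eq, ← linearSubst_mul, hAB,
    ← pullback_eq_linearSubst, pullback_one, Ideal.mem_mul_span_singleton] at h3
  obtain ⟨z, hz, hzR⟩ := h3
  -- Back in standard coordinates, (det² - 1) R lies in A₊R; cancelling R leaves a constant without
  -- constant term.
  have h4 : z = C ((w : Matrix (Fin 2) (Fin 2) ℂ).det ^ 2) - 1 :=
    mul_right_cancel₀ quadForm_ne_zero (by rw [hzR]; ring)
  rw [h4, RingHom.mem_ker, map_sub, constantCoeff_C, map_one] at hz
  exact sub_eq_zero.1 hz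

/-- The determinant of a reflection is not 1, so it is -1 here and the reflection is an involution.
-/
theorem IsGood.generatedByOrderTwoReflections (hgen : GeneratedByReflections W)
    (h : IsGood muTwo W) : GeneratedByOrderTwoReflections W := by
  have hset : {g | g ∈ W ∧ IsReflection g ∧ orderOf g = 2} = {g | g ∈ W ∧ IsReflection g} := by
    ext g
    refine ⟨fun hg => ⟨hg.1, hg.2.1⟩, fun hg => ⟨hg.1, hg.2, ?_⟩⟩
    have hdet : (g : Matrix (Fin 2) (Fin 2) ℂ).det = -1 := by
      obtain ⟨u, v, huv, h0⟩ := hg.2.exists_eq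
      refine (sq_eq_one_iff.1 (h.det_sq hg.1)).resolve_left ?_
      rw [huv, det_one_add_vecMulVec]
      simpa using h0
    exact orderOf_eq_prime (by rw [pow_two]; exact hg.2.mul_self_of_det hdet) hg.2.ne_one
  rw [GeneratedByOrderTwoReflections, hset]
  exact hgen

theorem UpstairsGroup.isGood (h : UpstairsGroup W) : IsGood muTwo W := by
  refine ⟨?_, ?_, 3, quadInvariants, isFundamentalSystem_quadInvariants,
    isCompleteIntersection_quadInvariants, ?_⟩
  · rw [muTwo, Subgroup.zpowers_le]
    exact h.2
  · intro w _
    rw [Subgroup.mem_normalizer_iff]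
    intro g
    constructor
    · intro hg
      rcases mem_muTwo_iff.1 hg with rfl | rfl <;> simp [neg_one_mem_muTwo]
    · intro hg
      rcases mem_muTwo_iff.1 hg with hg' | hg'
      · rw [mul_inv_eq_one, mul_eq_left] at hg'
        exact hg' ▸ muTwo.one_mem
      · rw [mul_inv_eq_iff_eq_mul] at hg'
        have : g = -1 := by
          apply mul_left_cancel (a := w)
          rw [hg']
          simp
        exact this ▸ neg_one_mem_muTwo
  · intro w hw c hc f hf
    -- The tangent matrix is unique because the quadratic invariants are independent.
    have hcphi : c = phi w := by
      ext i j
      have h1 : ∑ j, (c i j - (phi w : Matrix (Fin 3) (Fin 3) ℂ) i j) • quadInvariants j = 0 := by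
        simp only [sub_smul, Finset.sum_sub_distrib]
        rw [← hc i, ← isTangentMatrix_phi w i, sub_self]
      exact sub_eq_zero.1
        (Fintype.linearIndependent_iff.1 linearIndependent_quadInvariants _ h1 j)
    rw [relationIdeal_quadInvariants] at hf ⊢
    obtain ⟨q, rfl⟩ := Ideal.mem_span_singleton.1 hf
    rw [Ideal.mem_mul_span_singleton, hcphi]
    refine ⟨pullback (phi w : Matrix (Fin 3) (Fin 3) ℂ) q - q, ?_, ?_⟩
    · rw [RingHom.mem_ker, map_sub, constantCoeff_pullback, sub_self]
    · rw [map_mul, phi_val, pullback_symSq_quadForm, h.det_sq hw, C_1, one_mul]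
      ring

end Goodness

/-! ### Degrees of the quotient group -/

section Degrees

variable {W : Subgroup (GL (Fin 2) ℂ)}

theorem aeval_pullback_phi (w : GL (Fin 2) ℂ) (F : MvPolynomial (Fin 3) ℂ) :
    aeval quadInvariants (pullback (phi w : Matrix (Fin 3) (Fin 3) ℂ) F) =
      pullback (w : Matrix (Fin 2) (Fin 2) ℂ) (aeval quadInvariants F) := by
  rw [pullback_eq_linearSubst, aeval_linearSubst (isTangentMatrix_phi w), ← AlgHom.comp_apply]
  congr 1
  apply algHom_ext
  intro i
  rw [AlgHom.comp_apply, aeval_X, aeval_X]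

theorem aeval_mem_invariants {F : MvPolynomial (Fin 3) ℂ} (hF : F ∈ invariants (W.map phi)) :
    aeval quadInvariants F ∈ invariants W := fun w hw => by
  rw [← aeval_pullback_phi, hF _ (Subgroup.mem_map_of_mem phi hw)]

theorem aeval_mem_posInvariants {F : MvPolynomial (Fin 3) ℂ}
    (hF : F ∈ posInvariants (W.map phi)) : aeval quadInvariants F ∈ posInvariants W :=
  ⟨aeval_mem_invariants hF.1, by rw [constantCoeff_aeval_quadInvariants]; exact hF.2⟩

theorem isHomogeneous_aeval_quadInvariants (d : ℕ) (F : MvPolynomial (Fin 3) ℂ)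
    (hF : F.IsHomogeneous d) : (aeval quadInvariants F).IsHomogeneous (2 * d) :=
  hF.aeval _ quadInvariants_isHomogeneous

/-- Take any polynomial lift and average it over the image group; the restriction to the plane is
already invariant and does not change. -/
theorem exists_invariant_lift [Finite W] (hneg : -1 ∈ W) {f : MvPolynomial (Fin 2) ℂ}
    (hf : f ∈ invariants W) :
    ∃ F ∈ invariants (W.map phi), aeval quadInvariants F = f := by
  have : Finite (W.map phi) := finite_map phi W
  have := Fintype.ofFinite (W.map phi)
  obtain ⟨F, rfl⟩ := exists_aeval_quadInvariants (mem_invariants_muTwo.2 (hf _ hneg))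
  refine ⟨reynolds (W.map phi) F, reynolds_mem F, ?_⟩
  have h : ∀ g : W.map phi, aeval quadInvariants
      (pullback ((g : GL (Fin 3) ℂ) : Matrix (Fin 3) (Fin 3) ℂ) F) = aeval quadInvariants F := by
    rintro ⟨_, w, hw, rfl⟩
    rw [aeval_pullback_phi, hf w hw]
  rw [reynolds_apply, map_smul, map_sum]
  simp only [h]
  rw [Finset.sum_const, Finset.card_univ, ← Nat.cast_smul_eq_nsmul ℂ, smul_smul,
    inv_mul_cancel₀ (by exact_mod_cast Fintype.card_ne_zero), one_smul]

theorem exists_posInvariant_lift [Finite W] (hneg : -1 ∈ W) {f : MvPolynomial (Fin 2) ℂ}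
    (hf : f ∈ posInvariants W) :
    ∃ F ∈ posInvariants (W.map phi), aeval quadInvariants F = f := by
  obtain ⟨F, hF, rfl⟩ := exists_invariant_lift hneg hf.1
  exact ⟨F, ⟨hF, by rw [← constantCoeff_aeval_quadInvariants]; exact hf.2⟩, rfl⟩

/-- A homogeneous invariant has even degree, and lifts to half this degree. -/
theorem exists_homogeneous_lift [Finite W] (hneg : -1 ∈ W) {f : MvPolynomial (Fin 2) ℂ} {e : ℕ}
    (hf : f ∈ posInvariants W) (he : f.IsHomogeneous e) (h0 : f ≠ 0) :
    ∃ (a : ℕ) (F : MvPolynomial (Fin 3) ℂ), e = 2 * a ∧ F ∈ posInvariants (W.map phi) ∧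
      F.IsHomogeneous a ∧ aeval quadInvariants F = f := by
  obtain ⟨F, hF, rfl⟩ := exists_posInvariant_lift hneg hf
  have hself := homogeneousComponent_eq_self he
  obtain ⟨a, rfl⟩ : ∃ a, e = 2 * a := by
    by_contra! hodd
    rw [homogeneousComponent_eq_zero_of_ne _ isHomogeneous_aeval_quadInvariants e
      fun d => (hodd d).symm] at hself
    exact h0 hself.symm
  refine ⟨a, homogeneousComponent a F, rfl, homogeneousComponent_mem_posInvariants hF a,
    homogeneousComponent_isHomogeneous a F, ?_⟩
  rw [map_homogeneousComponent two_pos _ isHomogeneous_aeval_quadInvariants, hself]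

theorem mul_posInvariants_le_map [Finite W] (hneg : -1 ∈ W) :
    posInvariants W * posInvariants W ≤
      (posInvariants (W.map phi) * posInvariants (W.map phi)).map
        (aeval quadInvariants : MvPolynomial (Fin 3) ℂ →ₐ[ℂ] _).toLinearMap := by
  refine Submodule.mul_le.2 fun f hf g hg => ?_
  obtain ⟨F, hF, rfl⟩ := exists_posInvariant_lift hneg hf
  obtain ⟨G, hG, rfl⟩ := exists_posInvariant_lift hneg hg
  exact ⟨F * G, Submodule.mul_mem_mul hF hG, map_mul (aeval quadInvariants) F G⟩

theorem aeval_mem_sq {F : MvPolynomial (Fin 3) ℂ}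
    (hF : F ∈ posInvariants (W.map phi) * posInvariants (W.map phi)) :
    aeval quadInvariants F ∈ posInvariants W * posInvariants W := by
  have h : posInvariants (W.map phi) * posInvariants (W.map phi) ≤
      (posInvariants W * posInvariants W).comap
        (aeval quadInvariants : MvPolynomial (Fin 3) ℂ →ₐ[ℂ] _).toLinearMap :=
    Submodule.mul_le.2 fun f hf g hg => by
      rw [Submodule.mem_comap, AlgHom.toLinearMap_apply, map_mul]
      exact Submodule.mul_mem_mul (aeval_mem_posInvariants hf) (aeval_mem_posInvariants hg)
  exact h hF

theorem UpstairsGroup.quadForm_mem (h : UpstairsGroup W) :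
    quadForm ∈ posInvariants (W.map phi) := by
  refine ⟨?_, by simp [quadForm]⟩
  rintro _ ⟨w, hw, rfl⟩
  exact phi_mem_orthogonalR_iff.2 (h.det_sq hw)

theorem UpstairsGroup.exists_eq_quadForm_mul (h : UpstairsGroup W) {F : MvPolynomial (Fin 3) ℂ}
    (hF : F ∈ invariants (W.map phi)) (h0 : aeval quadInvariants F = 0) :
    ∃ q ∈ invariants (W.map phi), F = q * quadForm := by
  have hmem : F ∈ relationIdeal quadInvariants := h0
  rw [relationIdeal_quadInvariants] at hmem
  obtain ⟨q, rfl⟩ := Ideal.mem_span_singleton'.1 hmem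
  refine ⟨q, fun g hg => ?_, rfl⟩
  have h1 := hF g hg
  rw [map_mul, h.quadForm_mem.1 g hg] at h1
  exact mul_right_cancel₀ quadForm_ne_zero h1

/-- Used to show that R is not in the square of the invariant ideal: the image of a reflection
negates a vector on which R is nonzero. -/
theorem UpstairsGroup.exists_phi_mulVec_eq_neg (h : UpstairsGroup W) :
    ∃ g ∈ W.map phi, ∃ e : Fin 3 → ℂ, evalR e = 1 ∧
      Matrix.mulVec (g : Matrix (Fin 3) (Fin 3) ℂ) e = -e := by
  obtain ⟨g, hg, hr⟩ := h.exists_reflection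
  obtain ⟨e, he, rfl⟩ := exists_eq_involution hr
  refine ⟨_, Subgroup.mem_map_of_mem phi hg, e, he, ?_⟩
  rw [phi_val, involutionGL_val, symSq_involution he, Matrix.add_mulVec, Matrix.one_mulVec,
    Matrix.vecMulVec_mulVec]
  have h1 : polarR e ⬝ᵥ e = 1 := by
    rw [← he, evalR, polarR]
    simp [dotProduct, Fin.sum_univ_succ]
    ring
  rw [h1]
  ext i
  simp
  ring

/-- Invariants of W are the invariants of its image modulo R. So the cotangent space of the image
has as basis R, of degree 2, and lifts of the two basic invariants, of half their degrees. -/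
theorem UpstairsGroup.exists_hasDegrees [Finite W] (h : UpstairsGroup W)
    (hgen : GeneratedByReflections W) :
    ∃ a b : ℕ, HasDegrees (W.map phi) {2, a, b} ∧ HasDegrees W {2 * a, 2 * b} := by
  obtain ⟨f, e, hf, he, hli, hspan⟩ := exists_basic_invariants hgen fun w hw => h.det_sq hw
  choose a F hea hF hFa hFf using fun i =>
    exists_homogeneous_lift h.2 (hf i) (he i) (ne_zero_of_modSq hli i)
  refine ⟨a 0, a 1, ?_, ?_⟩
  · have hmem : ∀ i, (Fin.cons quadForm F : Fin 3 → _) i ∈ posInvariants (W.map phi) :=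
      Fin.cases h.quadForm_mem hF
    have hval : (Finset.univ.val.map (Fin.cons 2 a : Fin 3 → ℕ)) = {2, a 0, a 1} := rfl
    rw [← hval]
    refine hasDegrees_of_basis hmem (Fin.cases quadForm_isHomogeneous hFa) ?_ ?_
    · rw [Fintype.linearIndependent_iff]
      intro c hc
      rw [Fin.sum_univ_succ] at hc
      simp only [Fin.cons_zero, Fin.cons_succ, ← map_smul] at hc
      rw [← map_sum, ← map_add, modSq_eq_zero] at hc
      -- Restriction to the plane kills R and shows that the coefficients of the lifts vanish.
      have h1 := aeval_mem_sq hc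
      rw [map_add, map_smul, aeval_quadForm, smul_zero, zero_add, map_sum] at h1
      simp only [map_smul, hFf] at h1
      rw [← modSq_eq_zero, map_sum] at h1
      simp only [map_smul] at h1
      have h2 := Fintype.linearIndependent_iff.1 hli _ h1
      simp only [h2, zero_smul, Finset.sum_const_zero, add_zero] at hc
      obtain ⟨g, hg, v, hv, hgv⟩ := h.exists_phi_mulVec_eq_neg
      -- What remains is a multiple of R in the square. It vanishes at a vector negated by the group
      -- where R equals 1, so its coefficient is 0.
      have h3 := eval_eq_zero_of_mem_sq hg hgv hc
        ((homogeneousSubmodule _ _ 2).smul_mem _ quadForm_isHomogeneous)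
      rw [smul_eval, eval_quadForm, hv, mul_one] at h3
      exact Fin.cases h3 h2
    · intro d P hP hPd
      obtain ⟨c, hc⟩ := (Submodule.mem_span_range_iff_exists_fun ℂ).1
        (hspan _ _ (aeval_mem_posInvariants hP) (isHomogeneous_aeval_quadInvariants d P hPd))
      simp only [← map_smul] at hc
      rw [← map_sum, eq_comm, ← sub_eq_zero, ← map_sub, modSq_eq_zero] at hc
      obtain ⟨Z, hZ, hZ'⟩ := mul_posInvariants_le_map h.2 hc
      have hZ' : aeval quadInvariants Z = aeval quadInvariants P - ∑ i, c i • f i := hZ'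
      -- Correcting by the lift `Z` of the quadratic error leaves a relation, which is an invariant
      -- multiple of R.
      obtain ⟨q, hq, hqR⟩ := h.exists_eq_quadForm_mul (F := P - ∑ i, c i • F i - Z)
        ((invariants _).sub_mem ((invariants _).sub_mem hP.1
          ((invariants _).sum_mem fun i _ => (invariants _).smul_mem (hF i).1 _))
          (mul_posInvariants_le hZ).1)
        (by
          rw [map_sub, map_sub, map_sum, hZ']
          simp only [map_smul, hFf]
          rw [sub_self])
      have hPe : P = q * quadForm + Z + ∑ i, c i • F i := by
        rw [← hqR]
        ring
      rw [hPe, map_add, map_add, modSq_mul hq h.quadForm_mem, modSq_eq_zero.2 hZ, add_zero,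
        map_sum]
      refine Submodule.add_mem _ (Submodule.smul_mem _ _ (Submodule.subset_span ⟨0, rfl⟩))
        (Submodule.sum_mem _ fun i _ => ?_)
      rw [map_smul]
      exact Submodule.smul_mem _ _ (Submodule.subset_span ⟨i.succ, rfl⟩)
  · have hval : (Finset.univ.val.map e) = {2 * a 0, 2 * a 1} := by
      rw [← hea, ← hea]
      rfl
    rw [← hval]
    exact hasDegrees_of_basis hf he hli hspan

theorem HasDegrees.unique {n : ℕ} {G : Subgroup (GL (Fin n) ℂ)} {D E : Multiset ℕ}
    (hD : HasDegrees G D) (hE : HasDegrees G E) : D = E :=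
  Multiset.ext.2 fun d => by rw [← hD d, hE d]

/-- The degrees form a well-defined multiset, so any `a`, `b` with 2, a, b as degrees of the image
agree with the constructed pair up to order. -/
theorem goodness_and_degrees (hW : IsReflectionGroup W) (hneg : -1 ∈ W) :
    (IsGood muTwo W ↔ GeneratedByOrderTwoReflections W) ∧
      (IsGood muTwo W →
        (∃ a b : ℕ, HasDegrees (W.map phi) {2, a, b}) ∧
        ∀ a b : ℕ, HasDegrees (W.map phi) {2, a, b} → HasDegrees W {2 * a, 2 * b}) := by
  have := hW.1
  have hiff : IsGood muTwo W ↔ GeneratedByOrderTwoReflections W :=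
    ⟨fun h => h.generatedByOrderTwoReflections hW.2, fun h => UpstairsGroup.isGood ⟨h, hneg⟩⟩
  refine ⟨hiff, fun hg => ?_⟩
  obtain ⟨a, b, hab, hab'⟩ := UpstairsGroup.exists_hasDegrees ⟨hiff.1 hg, hneg⟩ hW.2
  refine ⟨⟨a, b, hab⟩, fun c d hcd => ?_⟩
  have h1 : ({c, d} : Multiset ℕ) = {a, b} := (Multiset.cons_inj_right 2).1 (hcd.unique hab)
  have h2 := congrArg (Multiset.map (2 * ·)) h1
  simp only [Multiset.insert_eq_cons, Multiset.map_cons, Multiset.map_singleton] at h2 hab'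
  rw [Multiset.insert_eq_cons, h2]
  exact hab'

end Degrees

end

end ReflQuot

theorem mainTheorem6 :
    -- `φ` is the action on the tangent space at `0` of `ℂ² / {1, -1}`, and its kernel is `{1, -1}`
    (IsFundamentalSystem muTwo quadInvariants ∧
      (∀ g : GL (Fin 2) ℂ, IsTangentMatrix quadInvariants g (phi g)) ∧
      MonoidHom.ker phi = muTwo) ∧
    -- goodness criterion and degrees
    (∀ W : Subgroup (GL (Fin 2) ℂ), IsReflectionGroup W → -1 ∈ W →
      (IsGood muTwo W ↔ GeneratedByOrderTwoReflections W) ∧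
      (IsGood muTwo W →
        (∃ a b : ℕ, HasDegrees (W.map phi) {2, a, b}) ∧
        ∀ a b : ℕ, HasDegrees (W.map phi) {2, a, b} → HasDegrees W {2 * a, 2 * b})) ∧
    -- bijection with conjugacy classes of reflection subgroups of `O(R)`
    (∃ Φ : SubgroupClasses ⊤ UpstairsGroup ≃
        SubgroupClasses orthogonalR OrthogonalReflectionSubgroup,
      ∀ W hW Γ hΓ, Φ (classOf ⊤ UpstairsGroup W hW) =
          classOf orthogonalR OrthogonalReflectionSubgroup Γ hΓ ↔
        ConjBy orthogonalR (W.map phi) Γ) ∧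
    -- bijection between finite groups and finite real reflection groups in dimension three
    (∃ Φ : SubgroupClasses ⊤ FiniteUpstairsGroup ≃ SubgroupClasses ⊤ RealReflectionGroup,
      ∀ W hW Γ hΓ, Φ (classOf ⊤ FiniteUpstairsGroup W hW) = classOf ⊤ RealReflectionGroup Γ hΓ ↔
        ConjBy ⊤ (W.map phi) (Γ.map complexification)) ∧
    -- bijection with isomorphism classes of finite Coxeter groups of rank between `1` and `3`
    (∃ Φ : SubgroupClasses ⊤ FiniteUpstairsGroup ≃ Quotient coxeterSetoid,
      ∀ W hW (M : SmallCoxeter),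
        Φ (classOf ⊤ FiniteUpstairsGroup W hW) = Quotient.mk coxeterSetoid M ↔
          HasCoxeterType (W.map phi) M.matrix) ∧
    -- the groups corresponding to `A₃`, `B₃`, `H₃`
    ((FiniteUpstairsGroup G12 ∧ HasCoxeterType (G12.map phi) (CoxeterMatrix.A 3)) ∧
      (FiniteUpstairsGroup G13 ∧ HasCoxeterType (G13.map phi) (CoxeterMatrix.B 3)) ∧
      (FiniteUpstairsGroup G22 ∧ HasCoxeterType (G22.map phi) CoxeterMatrix.H₃)) := by
  exact ⟨⟨isFundamentalSystem_quadInvariants, isTangentMatrix_phi, ker_phi⟩,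
    fun _ hW hneg => goodness_and_degrees hW hneg, exists_equiv_orthogonalReflectionSubgroup,
    exists_equiv_realReflectionGroup, exists_equiv_coxeter, G12_spec, G13_spec, G22_spec⟩
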